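/- Let $A\in\{0,\star\}^{d\times d}$ and $B\in\{0,\star\}^{d\times m}$ be sparsity matrices. The pair $(A,B)$ is *structurally controllable* if real values can be assigned to the star entries so that the resulting system $\dot x=A'x+B'u$ is controllable (every state can be steered to every state in finite time). Assume that $(A,B)$ is structurally controllable and that each star entry $B_{ij}$ has a cost $w_{ij}\ge 0$. For $N \in\{0,\star\}^{d\times m}$ put $\|N\|_w=\sum_{(i,j):\,N_{ij}=\star}w_{ij}$, let $\mathcal K$ be the set of all $B'\in\{0,\star\}^{d\times m}$ with $B'_{ij}=0$ whenever $B_{ij}=0$ and $(A,B')$ structurally controllable, and let $(\mathcal P_1)$ be the problem of minimizing $\|B'\|_w$ over $B'\in\mathcal K$. Let $G(A)$ be the digraph on the states $v_1,\dots,v_d$ with an edge $v_j\to v_i$ iff $A_{ij}=\star$; a *source component* is a strongly connected component of $G(A)$ that no edge enters from outside. Let $\Gamma(A,B)$ be the bipartite graph with left vertices $v^1_1,\dots,v^1_d,u_1,\dots,u_m$, right vertices $v^2_1,\dots,v^2_d$, an edge $(v^1_j,v^2_i)$ of cost $0$ for each $A_{ij}=\star$, and an edge $(u_j,v^2_i)$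 of cost $w_{ij}$ for each $B_{ij}=\star$. * **Algorithm 1 (accessibility).** For each source component $S$ choose a pair $(\ell,k)$ with $v_\ell\in S$ and $w_{\ell k}$ minimal among all $w_{ij}$ with $v_i\in S$, $j \in \{1,\dots,m\}$, where $w_{ij}$ counts as $\infty$ if $B_{ij}=0$. The output $B'$ has stars exactly at the chosen pairs. * **Algorithm 2 (matching).** Find a maximum-cardinality matching $M$ of $\Gamma(A,B)$ that has minimum total cost among all maximum matchings. The output $\widetilde B$ has a star at $(\ell,k)$ iff $(u_k,v^2_\ell)\in M$. * **Algorithm 3.** Take an output $B'$ of Algorithm 1 and an output $\widetilde B$ of Algorithm 2. Let $B''$ be obtained from $B'$ by setting to $0$ all rows $\ell$ such that $v_\ell$ lies in a source component $S$ containing some $v_i$ with $\widetilde B_{ik}=\star$ for some $k$. The output is $B^*=B''\sqcup\widetilde B$, whose stars are those of $B''$ and those of $\widetilde B$. **Theorem.** For every structurally controllable $(A,B)$ with nonnegative costs, Algorithm 3 has an output, and every output $B^*$ of Algorithm 3 (whichever choices are made in Algorithms 1 and 2) lies in $\mathcal K$ and satisfies $\|B^*\|_w\le 2\|\hat B\|_w$,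 where $\hat B$ is a solution of $(\mathcal P_1)$ (which exists). Moreover, Algorithm 3 can be carried out in $O((d+m)^3)$ time: there are a single program for a random access machine with exact real arithmetic (two-dimensional arrays of natural numbers and of reals; reading or writing a cell, addition, subtraction, comparison and branching at unit cost) and a constant $C$, both independent of the input, such that for all $d\ge1$, $m\ge 0$ and all such $A$, $B$, $w$ the program, started on $(d,m,A,B,w)$, halts after at most $C\,(d+m)^3$ steps having computed an output of Algorithm 3. -/

import Mathlib

open scoped Matrix

noncomputable section

namespace StructuralControl

/-! ### Linear systems and structural controllability -/

/-- A matrix over the two symbols `0` and `⋆`; `true` stands for `⋆`, `false` for a fixed zero. -/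
abbrev SparsityMatrix (n k : ℕ) : Type := Matrix (Fin n) (Fin k) Bool

/-- Controllability of `x' = A x + B u`: every initial state can be steered to every final state
in some finite time by some continuous input. -/
def Controllable {d m : ℕ} (A : Matrix (Fin d) (Fin d) ℝ) (B : Matrix (Fin d) (Fin m) ℝ) : Prop :=
  ∀ x₀ x₁ : Fin d → ℝ, ∃ T : ℝ, 0 < T ∧ ∃ (u : ℝ → Fin m → ℝ) (x : ℝ → Fin d → ℝ),
    ContinuousOn u (Set.Icc 0 T) ∧ x 0 = x₀ ∧ x T = x₁ ∧
    ∀ t ∈ Set.Icc 0 T, HasDerivWithinAt x (A *ᵥ x t + B *ᵥ u t) (Set.Icc 0 T) t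

/-- `R'` is obtained from `R` by assigning real values to the star entries. -/
def IsRealization {n k : ℕ} (R : SparsityMatrix n k) (R' : Matrix (Fin n) (Fin k) ℝ) : Prop :=
  ∀ i j, R i j = false → R' i j = 0

def StructurallyControllable {d m : ℕ} (A : SparsityMatrix d d) (B : SparsityMatrix d m) : Prop :=
  ∃ (A' : Matrix (Fin d) (Fin d) ℝ) (B' : Matrix (Fin d) (Fin m) ℝ),
    IsRealization A A' ∧ IsRealization B B' ∧ Controllable A' B'

/-! ### The optimization problem -/

/-- The weighted norm: the total cost of the star entries of `N`. -/
def weightedNorm {n k : ℕ} (w : Fin n → Fin k → ℝ) (N : SparsityMatrix n k) : ℝ :=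
  ∑ i, ∑ j, if N i j = true then w i j else 0

/-- The admissible input matrices: those with a zero wherever `B` has one that keep the pair
structurally controllable. -/
def admissible {d m : ℕ} (A : SparsityMatrix d d) (B : SparsityMatrix d m) :
    Set (SparsityMatrix d m) :=
  {B' | (∀ i j, B i j = false → B' i j = false) ∧ StructurallyControllable A B'}

/-- `Bhat` minimizes the weighted norm over the admissible input matrices. -/
def SolvesMinCost {d m : ℕ} (A : SparsityMatrix d d) (B : SparsityMatrix d m)
    (w : Fin d → Fin m → ℝ) (Bhat : SparsityMatrix d m) : Prop :=
  Bhat ∈ admissible A B ∧ ∀ B' ∈ admissible A B, weightedNorm w Bhat ≤ weightedNorm w B'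

/-! ### Source components of the state digraph -/

/-- The digraph on the states, with an edge from `j` to `i` exactly when `A i j = ⋆`. -/
def stateDigraph {d : ℕ} (A : SparsityMatrix d d) : Digraph (Fin d) where
  Adj j i := A i j = true

def Reaches {d : ℕ} (A : SparsityMatrix d d) (v v' : Fin d) : Prop :=
  Relation.ReflTransGen (stateDigraph A).Adj v v'

/-- `S` is the vertex set of a strongly connected component of the state digraph. -/
def IsSCC {d : ℕ} (A : SparsityMatrix d d) (S : Set (Fin d)) : Prop :=
  ∃ v, S = {v' | Reaches A v v' ∧ Reaches A v' v}

/-- A strongly connected component that no edge enters from outside. -/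
def IsSourceSCC {d : ℕ} (A : SparsityMatrix d d) (S : Set (Fin d)) : Prop :=
  IsSCC A S ∧ ∀ v v', (stateDigraph A).Adj v v' → v' ∈ S → v ∈ S

/-! ### Matchings in the bipartite graph -/

/-- Potential edges of the bipartite graph: the left vertices are the states (`Sum.inl`) and the
inputs (`Sum.inr`), the right vertices are the states. -/
abbrev BipEdge (d m : ℕ) : Type := (Fin d ⊕ Fin m) × Fin d

/-- The edges of the bipartite graph of the pair `(A, B)`. -/
def bipartiteEdges {d m : ℕ} (A : SparsityMatrix d d) (B : SparsityMatrix d m) :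
    Set (BipEdge d m) :=
  {e | Sum.elim (fun j => A e.2 j) (fun j => B e.2 j) e.1 = true}

/-- A set of edges no two of which share a vertex. -/
def IsMatching {d m : ℕ} (A : SparsityMatrix d d) (B : SparsityMatrix d m)
    (M : Finset (BipEdge d m)) : Prop :=
  (∀ e ∈ M, e ∈ bipartiteEdges A B) ∧
  ∀ e ∈ M, ∀ e' ∈ M, e ≠ e' → e.1 ≠ e'.1 ∧ e.2 ≠ e'.2

def IsMaximumMatching {d m : ℕ} (A : SparsityMatrix d d) (B : SparsityMatrix d m)
    (M : Finset (BipEdge d m)) : Prop :=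
  IsMatching A B M ∧ ∀ M', IsMatching A B M' → M'.card ≤ M.card

/-- State edges are free; the edge from input `j` to state `i` costs `w i j`. -/
def edgeCost {d m : ℕ} (w : Fin d → Fin m → ℝ) (e : BipEdge d m) : ℝ :=
  Sum.elim (fun _ => 0) (fun j => w e.2 j) e.1

/-- Minimum cost maximum matching. -/
def IsMCMM {d m : ℕ} (A : SparsityMatrix d d) (B : SparsityMatrix d m)
    (w : Fin d → Fin m → ℝ) (M : Finset (BipEdge d m)) : Prop :=
  IsMaximumMatching A B M ∧
  ∀ M', IsMaximumMatching A B M' → ∑ e ∈ M, edgeCost w e ≤ ∑ e ∈ M', edgeCost w e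

/-! ### The algorithms, as relations between inputs and possible outputs

The algorithms leave choices open (ties between costs, which matching is found); each relation
holds for exactly the results of all possible choices. -/

/-- The cost of the connection from input `k` to state `i`, infinite when it is not available. -/
def connectionCost {d m : ℕ} (B : SparsityMatrix d m) (w : Fin d → Fin m → ℝ)
    (i : Fin d) (k : Fin m) : WithTop ℝ :=
  if B i k = true then (w i k : WithTop ℝ) else ⊤

/-- Accessibility algorithm: select, for each source component, one cheapest connection into it. -/
def IsAccessibilityOutput {d m : ℕ} (A : SparsityMatrix d d) (B : SparsityMatrix d m)
    (w : Fin d → Fin m → ℝ) (B' : SparsityMatrix d m) : Prop :=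
  ∃ f : {S : Set (Fin d) // IsSourceSCC A S} → Fin d × Fin m,
    (∀ S, (f S).1 ∈ S.1 ∧ ∀ i ∈ S.1, ∀ k,
      connectionCost B w (f S).1 (f S).2 ≤ connectionCost B w i k) ∧
    ∀ i k, B' i k = true ↔ ∃ S, f S = (i, k)

/-- Matching algorithm: keep the input connections of a minimum cost maximum matching. -/
def IsMatchingOutput {d m : ℕ} (A : SparsityMatrix d d) (B : SparsityMatrix d m)
    (w : Fin d → Fin m → ℝ) (Bt : SparsityMatrix d m) : Prop :=
  ∃ M : Finset (BipEdge d m), IsMCMM A B w M ∧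
    ∀ i k, Bt i k = true ↔ (Sum.inr k, i) ∈ M

/-- The state `i` lies in a source component into which `Bt` has a connection. -/
def AlreadyServed {d m : ℕ} (A : SparsityMatrix d d) (Bt : SparsityMatrix d m)
    (i : Fin d) : Prop :=
  ∃ S, IsSourceSCC A S ∧ i ∈ S ∧ ∃ l ∈ S, ∃ k, Bt l k = true

/-- The combined algorithm: from an accessibility output `B'` delete all connections into source
components already served by a matching output `Bt`, then take the union with `Bt`. -/
def IsCombinedOutput {d m : ℕ} (A : SparsityMatrix d d) (B : SparsityMatrix d m)
    (w : Fin d → Fin m → ℝ) (Bs : SparsityMatrix d m) : Prop :=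
  ∃ B' Bt : SparsityMatrix d m, IsAccessibilityOutput A B w B' ∧ IsMatchingOutput A B w Bt ∧
    ∀ i k, Bs i k = true ↔ (B' i k = true ∧ ¬ AlreadyServed A Bt i) ∨ Bt i k = true

/-! ### A unit-cost random access machine with exact real arithmetic

The memory consists of two-dimensional arrays of natural numbers and of real numbers. The array
names and the constants occurring in a program are fixed with the program, the indices of a cell
are computed. The only arithmetic is addition and subtraction. Every operation has unit cost. -/

/-- Cell `(i, j)` of the natural number array `a` holds `nat a i j`; likewise for `real`. -/
structure Memory where
  nat : ℕ → ℕ → ℕ → ℕ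
  real : ℕ → ℕ → ℕ → ℝ

def Memory.setNat (s : Memory) (a i j v : ℕ) : Memory :=
  { s with nat := fun a' i' j' => if a' = a ∧ i' = i ∧ j' = j then v else s.nat a' i' j' }

def Memory.setReal (s : Memory) (a i j : ℕ) (v : ℝ) : Memory :=
  { s with real := fun a' i' j' => if a' = a ∧ i' = i ∧ j' = j then v else s.real a' i' j' }

inductive NatExpr : Type
  | const (n : ℕ)
  | get (a : ℕ) (i j : NatExpr)
  | add (e₁ e₂ : NatExpr)
  | sub (e₁ e₂ : NatExpr)

inductive RealExpr : Type
  | const (n : ℕ)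
  | get (a : ℕ) (i j : NatExpr)
  | add (e₁ e₂ : RealExpr)
  | sub (e₁ e₂ : RealExpr)

inductive BoolExpr : Type
  | natLt (e₁ e₂ : NatExpr)
  | natEq (e₁ e₂ : NatExpr)
  | realLt (e₁ e₂ : RealExpr)
  | not (b : BoolExpr)
  | and (b₁ b₂ : BoolExpr)

/-- Subtraction of natural numbers is truncated at zero. -/
def NatExpr.eval (s : Memory) : NatExpr → ℕ
  | const n => n
  | get a i j => s.nat a (i.eval s) (j.eval s)
  | add e₁ e₂ => e₁.eval s + e₂.eval s
  | sub e₁ e₂ => e₁.eval s - e₂.eval s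

def RealExpr.eval (s : Memory) : RealExpr → ℝ
  | const n => (n : ℝ)
  | get a i j => s.real a (i.eval s) (j.eval s)
  | add e₁ e₂ => e₁.eval s + e₂.eval s
  | sub e₁ e₂ => e₁.eval s - e₂.eval s

def BoolExpr.eval (s : Memory) : BoolExpr → Prop
  | natLt e₁ e₂ => e₁.eval s < e₂.eval s
  | natEq e₁ e₂ => e₁.eval s = e₂.eval s
  | realLt e₁ e₂ => e₁.eval s < e₂.eval s
  | not b => ¬ b.eval s
  | and b₁ b₂ => b₁.eval s ∧ b₂.eval s

/-- The number of operations needed to evaluate an expression. -/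
def NatExpr.cost : NatExpr → ℕ
  | const _ => 1
  | get _ i j => i.cost + j.cost + 1
  | add e₁ e₂ => e₁.cost + e₂.cost + 1
  | sub e₁ e₂ => e₁.cost + e₂.cost + 1

def RealExpr.cost : RealExpr → ℕ
  | const _ => 1
  | get _ i j => i.cost + j.cost + 1
  | add e₁ e₂ => e₁.cost + e₂.cost + 1
  | sub e₁ e₂ => e₁.cost + e₂.cost + 1

def BoolExpr.cost : BoolExpr → ℕ
  | natLt e₁ e₂ => e₁.cost + e₂.cost + 1
  | natEq e₁ e₂ => e₁.cost + e₂.cost + 1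
  | realLt e₁ e₂ => e₁.cost + e₂.cost + 1
  | not b => b.cost + 1
  | and b₁ b₂ => b₁.cost + b₂.cost + 1

inductive Program : Type
  | skip
  | setNat (a : ℕ) (i j e : NatExpr)
  | setReal (a : ℕ) (i j : NatExpr) (e : RealExpr)
  | seq (p q : Program)
  | branch (b : BoolExpr) (p q : Program)
  | loop (b : BoolExpr) (p : Program)

/-- `Runs p s t s'`: started in memory `s`, the program `p` halts in memory `s'` after exactly `t`
steps. `loop b p` repeats `p` as long as `b` holds. -/
inductive Runs : Program → Memory → ℕ → Memory → Prop
  | skip (s : Memory) : Runs .skip s 1 s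
  | setNat (a : ℕ) (i j e : NatExpr) (s : Memory) :
      Runs (.setNat a i j e) s (i.cost + j.cost + e.cost + 1)
        (s.setNat a (i.eval s) (j.eval s) (e.eval s))
  | setReal (a : ℕ) (i j : NatExpr) (e : RealExpr) (s : Memory) :
      Runs (.setReal a i j e) s (i.cost + j.cost + e.cost + 1)
        (s.setReal a (i.eval s) (j.eval s) (e.eval s))
  | seq {p q : Program} {s s₁ s₂ : Memory} {t₁ t₂ : ℕ}
      (hp : Runs p s t₁ s₁) (hq : Runs q s₁ t₂ s₂) : Runs (.seq p q) s (t₁ + t₂) s₂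
  | branchTrue {b : BoolExpr} {p q : Program} {s s₁ : Memory} {t : ℕ}
      (hb : b.eval s) (hp : Runs p s t s₁) : Runs (.branch b p q) s (b.cost + 1 + t) s₁
  | branchFalse {b : BoolExpr} {p q : Program} {s s₁ : Memory} {t : ℕ}
      (hb : ¬ b.eval s) (hq : Runs q s t s₁) : Runs (.branch b p q) s (b.cost + 1 + t) s₁
  | loopTrue {b : BoolExpr} {p : Program} {s s₁ s₂ : Memory} {t₁ t₂ : ℕ}
      (hb : b.eval s) (hp : Runs p s t₁ s₁) (hl : Runs (.loop b p) s₁ t₂ s₂) :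
      Runs (.loop b p) s (b.cost + 1 + t₁ + t₂) s₂
  | loopFalse {b : BoolExpr} {p : Program} {s : Memory}
      (hb : ¬ b.eval s) : Runs (.loop b p) s (b.cost + 1) s

/-- The cells of a sparsity matrix: `1` for `⋆`, and `0` for a zero and outside the matrix. -/
def matrixCells {n k : ℕ} (N : SparsityMatrix n k) (i j : ℕ) : ℕ :=
  if h : i < n ∧ j < k then (if N ⟨i, h.1⟩ ⟨j, h.2⟩ = true then 1 else 0) else 0

/-- The initial memory: the natural number array `0` holds `d` and `m` in its cells `(0, 0)` and
`(0, 1)`, the natural number arrays `1` and `2` hold `A` and `B`, the real array `0` holds the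
costs, and all other cells are zero. -/
def inputMemory {d m : ℕ} (A : SparsityMatrix d d) (B : SparsityMatrix d m)
    (w : Fin d → Fin m → ℝ) : Memory where
  nat a i j :=
    if a = 0 then (if i = 0 ∧ j = 0 then d else if i = 0 ∧ j = 1 then m else 0)
    else if a = 1 then matrixCells A i j
    else if a = 2 then matrixCells B i j
    else 0
  real a i j :=
    if a = 0 then (if h : i < d ∧ j < m then w ⟨i, h.1⟩ ⟨j, h.2⟩ else 0) else 0

/-- The output is read from the natural number array `3`. -/
def HoldsOutput {d m : ℕ} (s : Memory) (N : SparsityMatrix d m) : Prop :=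
  ∀ i j, s.nat 3 i j = matrixCells N i j

end StructuralControl

end

open StructuralControl

/-! Lin's theorem (`structurallyControllable_iff`) splits structural controllability into two
combinatorial conditions: an input enters every source component of the state digraph, and the
bipartite graph has a matching covering all right vertices. Each condition alone gives a lower bound
for the optimum. An admissible matrix has a star in every source component, and these stars are
distinct because the components are disjoint; hence an accessibility output costs no more. An
admissible matrix also contains the input edges of a covering matching; hence a matching output
costs no more. As costs are nonnegative, the union costs at most the sum, which gives the factor 2.
The union satisfies both conditions, because a deleted connection always leads into a component that
the matching already serves.

Necessity in Lin's theorem: the part of a trajectory in a set that nothing enters obeys an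
autonomous linear equation, and a row vector annihilating `[A B]` is a conserved quantity;
independence of the rows turns into a matching by Hall's theorem. Sufficiency: a covering matching
decomposes the states into stems that begin at inputs and disjoint cycles. Unit weights on the stems
pass the Hautus test. The cycles are attached one by one (`RealizableOn.extend`), each through an
edge from the part already built or from an input. The weight of a cycle is chosen so large that its
eigenvalues avoid the zeros of the transfer function to the state where the entering edge begins
(`HautusOn.exists_radius`). The Hautus test implies the Kalman condition, and the Gramian then
yields the steering inputs.

The running time is proved for an explicit program by timed Hoare triples (`Run`). With `n = d + m`
columns, the Hungarian method needs `d` phases, each with at most `n + 1` tree extensions of cost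
`O(n)`. Hall's condition keeps it from getting stuck, and linear programming duality proves
optimality (`TightMatching.exists_isMCMM`). Source components are found from the transitive closure
by Warshall's algorithm, with one representative state for each, and are then scanned for cheapest
connections. -/

namespace StructuralControl

/-! ### Necessary conditions for controllability. -/

section Necessity

variable {d m : ℕ} {A : Matrix (Fin d) (Fin d) ℝ} {B : Matrix (Fin d) (Fin m) ℝ}

theorem hasDerivWithinAt_Ici_of_Icc {E : Type*} [NormedAddCommGroup E] [NormedSpace ℝ E]
    {f : ℝ → E} {f' : E} {T t : ℝ} (h : HasDerivWithinAt f f' (Set.Icc 0 T) t)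
    (ht : t ∈ Set.Ico 0 T) : HasDerivWithinAt f f' (Set.Ici t) t :=
  h.mono_of_mem_nhdsWithin (Filter.mem_of_superset (Icc_mem_nhdsGE ht.2)
    (Set.Icc_subset_Icc_left ht.1))

/-- An input must enter every nonempty set of states that no edge enters. -/
theorem Controllable.exists_input (hC : Controllable A B) {S : Set (Fin d)} (hne : S.Nonempty)
    (hS : ∀ i ∈ S, ∀ j ∉ S, A i j = 0) : ∃ i ∈ S, ∃ k, B i k ≠ 0 := by
  classical
  by_contra! hB
  obtain ⟨i₀, hi₀⟩ := hne
  obtain ⟨T, hT, u, x, -, hx0, hxT, hx⟩ := hC 0 (Pi.single i₀ 1)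
  let P : (Fin d → ℝ) →L[ℝ] (Fin d → ℝ) :=
    LinearMap.toContinuousLinearMap
      (Matrix.toLin' (Matrix.diagonal fun i => if i ∈ S then 1 else 0))
  let L : (Fin d → ℝ) →L[ℝ] (Fin d → ℝ) := LinearMap.toContinuousLinearMap (Matrix.toLin' A)
  have hP : ∀ (y : Fin d → ℝ) i, P y i = if i ∈ S then y i else 0 := by
    intro y i
    simp [P, Matrix.mulVec_diagonal]
  -- Neither an edge nor an input enters `S`, so the projection of the trajectory to `S` solves an
  -- autonomous linear equation. Starting from zero it stays zero by uniqueness, whereas it should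
  -- end in a unit vector.
  have key : ∀ t, P (A *ᵥ x t + B *ᵥ u t) = (P.comp L) (P (x t)) := by
    intro t
    ext i
    simp only [ContinuousLinearMap.comp_apply, hP]
    split_ifs with hi
    · have h1 : (B *ᵥ u t) i = 0 := by
        simp [Matrix.mulVec, dotProduct, hB i hi]
      have h2 : (A *ᵥ x t) i = L (P (x t)) i := by
        simp only [L, LinearMap.coe_toContinuousLinearMap', Matrix.toLin'_apply, Matrix.mulVec,
          dotProduct]
        refine Finset.sum_congr rfl fun j _ => ?_
        rw [hP]
        split_ifs with hj
        · rfl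
        · simp [hS i hi j hj]
      rw [Pi.add_apply, h1, h2, add_zero]
    · rfl
  have hd : ∀ t ∈ Set.Icc 0 T, HasDerivWithinAt (fun t => P (x t)) ((P.comp L) (P (x t)))
      (Set.Icc 0 T) t := by
    intro t ht
    rw [← key]
    exact P.hasFDerivAt.comp_hasDerivWithinAt t (hx t ht)
  have := ODE_solution_unique (v := fun _ => P.comp L) (fun _ => (P.comp L).lipschitz)
    (f := fun t => P (x t)) (g := fun _ => 0) (a := 0) (b := T)
    (fun t ht => (hd t ht).continuousWithinAt)
    (fun t ht => hasDerivWithinAt_Ici_of_Icc (hd t ⟨ht.1, ht.2.le⟩) ht)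
    continuousOn_const (fun t _ => by simpa using hasDerivWithinAt_const _ _ _) (by simp [hx0])
    (Set.right_mem_Icc.2 hT.le)
  have h1 := congrFun this i₀
  simp [hP, hi₀, hxT] at h1

/-- The functional `q` is constant along every trajectory, so steering from `0` to `q` forces `q ⬝ᵥ
q = 0`. -/
theorem Controllable.eq_zero_of_vecMul (hC : Controllable A B) {q : Fin d → ℝ}
    (hA : q ᵥ* A = 0) (hB : q ᵥ* B = 0) : q = 0 := by
  obtain ⟨T, hT, u, x, -, hx0, hxT, hx⟩ := hC 0 q
  let L : (Fin d → ℝ) →L[ℝ] ℝ := LinearMap.toContinuousLinearMap (dotProductBilin ℝ ℝ q)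
  have hd : ∀ t ∈ Set.Icc 0 T, HasDerivWithinAt (fun t => L (x t)) 0 (Set.Icc 0 T) t := by
    intro t ht
    have : L (A *ᵥ x t + B *ᵥ u t) = 0 := by
      simp [L, dotProductBilin, dotProduct_add, Matrix.dotProduct_mulVec, hA, hB]
    have h := L.hasFDerivAt.comp_hasDerivWithinAt t (hx t ht)
    rw [this] at h
    exact h
  have := constant_of_has_deriv_right_zero (fun t ht => (hd t ht).continuousWithinAt)
    (fun t ht => hasDerivWithinAt_Ici_of_Icc (hd t ⟨ht.1, ht.2.le⟩) ht) T
    (Set.right_mem_Icc.2 hT.le)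
  rw [hx0, hxT, map_zero] at this
  exact dotProduct_self_eq_zero.1 this

/-- Hall's theorem: the rows in a set `s` are linearly independent and supported on the columns in
which one of them is nonzero, so there are at least as many such columns as rows. -/
theorem exists_injective_of_vecMul_injective {ι κ : Type*} [Fintype ι] [Fintype κ]
    [DecidableEq ι] [DecidableEq κ] {M : Matrix ι κ ℝ} (h : ∀ q, q ᵥ* M = 0 → q = 0) :
    ∃ f : ι → κ, Function.Injective f ∧ ∀ i, M i (f i) ≠ 0 := by
  classical
  have := (Finset.all_card_le_biUnion_card_iff_exists_injective
    (fun i => Finset.univ.filter fun c => M i c ≠ 0)).1 fun s => by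
      set t := s.biUnion fun i => Finset.univ.filter fun c => M i c ≠ 0 with ht
      let L : (s → ℝ) →ₗ[ℝ] (t → ℝ) := Matrix.vecMulLinear (M.submatrix (↑) (↑))
      have hL : Function.Injective L := by
        rw [injective_iff_map_eq_zero]
        intro q hq
        have h1 := h (fun i => if hi : i ∈ s then q ⟨i, hi⟩ else 0) (by
          ext c
          have h2 : (∑ i, (if hi : i ∈ s then q ⟨i, hi⟩ else 0) * M i c) =
              ∑ i : s, q i * M i c := by
            rw [← Finset.sum_subset (Finset.subset_univ s) (by
              intro i _ hi; simp [hi]), ← Finset.sum_coe_sort s]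
            exact Finset.sum_congr rfl fun i _ => by simp
          simp only [Matrix.vecMul, dotProduct, Pi.zero_apply]
          rw [h2]
          by_cases hc : c ∈ t
          · exact congrFun hq ⟨c, hc⟩
          · refine Finset.sum_eq_zero fun i _ => ?_
            have : M i c = 0 := by
              by_contra hne
              exact hc (Finset.mem_biUnion.2 ⟨i, i.2, by simp [hne]⟩)
            rw [this, mul_zero])
        ext i
        have := congrFun h1 i
        simpa using this
      have := LinearMap.finrank_le_finrank_of_injective hL
      simpa using this
  obtain ⟨f, hf, hf'⟩ := this
  exact ⟨f, hf, fun i => by simpa using hf' i⟩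

end Necessity

/-! ### From the Kalman condition to steering inputs, by the Gramian. -/

section Kalman

variable {d m : ℕ} {A : Matrix (Fin d) (Fin d) ℝ} {B : Matrix (Fin d) (Fin m) ℝ}

/-- The Gramian `W = ∫ Φ(-s) B Bᵀ Φ(-s)ᵀ ds` over `[0, 1]` satisfies `z ⬝ᵥ W z = ∫ |u z s|² ds`. If
`W z = 0`, then `u z` vanishes on `[0, 1]`, and its derivatives at `0` are, up to sign, the rows `z
ᵥ* (A ^ n * B)`. So `W` is bijective, and variation of constants gives an input for every pair of
end points. -/
theorem controllable_of_kalman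
    (h : ∀ q : Fin d → ℝ, (∀ n, q ᵥ* (A ^ n * B) = 0) → q = 0) : Controllable A B := by
  let L : (Fin d → ℝ) →L[ℝ] (Fin d → ℝ) := LinearMap.toContinuousLinearMap (Matrix.toLin' A)
  let b : (Fin m → ℝ) →L[ℝ] (Fin d → ℝ) := LinearMap.toContinuousLinearMap (Matrix.toLin' B)
  let Φ : ℝ → (Fin d → ℝ) →L[ℝ] (Fin d → ℝ) := fun t => NormedSpace.exp (t • L)
  have hΦ : ∀ t, HasDerivAt Φ (L * Φ t) t := hasDerivAt_exp_smul_const' L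
  have hΦ' : ∀ t, HasDerivAt Φ (Φ t * L) t := hasDerivAt_exp_smul_const L
  have hΦc : Continuous Φ := continuous_iff_continuousAt.2 fun t => (hΦ t).continuousAt
  have hΦ0 : Φ 0 = 1 := by simp [Φ, NormedSpace.exp_zero]
  have hΦn : ∀ t, Φ t * Φ (-t) = 1 := by
    intro t
    simp only [Φ]
    let _ : NormedAlgebra ℚ ((Fin d → ℝ) →L[ℝ] (Fin d → ℝ)) := NormedAlgebra.restrictScalars ℚ ℝ _
    rw [← NormedSpace.exp_add_of_commute
      (((Commute.refl L).smul_left t).smul_right (-t)), ← add_smul, add_neg_cancel, zero_smul,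
      NormedSpace.exp_zero]
  let col : Fin m → Fin d → ℝ := fun k => b (Pi.single k 1)
  let u : (Fin d → ℝ) → ℝ → Fin m → ℝ := fun z s k => z ⬝ᵥ Φ (-s) (col k)
  have huc : ∀ z, Continuous (u z) := by
    intro z
    refine continuous_pi fun k => ?_
    simp only [u, dotProduct]
    fun_prop
  let g : (Fin d → ℝ) → ℝ → Fin d → ℝ := fun z s => Φ (-s) (b (u z s))
  have hgc : ∀ z, Continuous (g z) := by
    intro z
    have := huc z
    simp only [g]
    fun_prop
  have hgi : ∀ z, IntervalIntegrable (g z) MeasureTheory.volume 0 1 := fun z =>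
    (hgc z).intervalIntegrable _ _
  let W : (Fin d → ℝ) →ₗ[ℝ] (Fin d → ℝ) :=
    { toFun := fun z => ∫ s in (0:ℝ)..1, g z s
      map_add' := by
        intro z z'
        rw [← intervalIntegral.integral_add (hgi z) (hgi z')]
        refine intervalIntegral.integral_congr fun s _ => ?_
        have : u (z + z') s = u z s + u z' s := by ext k; exact add_dotProduct _ _ _
        simp [g, this]
      map_smul' := by
        intro c z
        rw [RingHom.id_apply, ← intervalIntegral.integral_smul]
        refine intervalIntegral.integral_congr fun s _ => ?_
        have : u (c • z) s = c • u z s := by ext k; exact smul_dotProduct _ _ _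
        simp [g, this] }
  have hWz : ∀ z, z ⬝ᵥ W z = ∫ s in (0:ℝ)..1, ∑ k, u z s k ^ 2 := by
    intro z
    let D : (Fin d → ℝ) →L[ℝ] ℝ := LinearMap.toContinuousLinearMap (dotProductBilin ℝ ℝ z)
    have h1 : z ⬝ᵥ W z = D (∫ s in (0:ℝ)..1, g z s) := rfl
    rw [h1, ← D.intervalIntegral_comp_comm (hgi z)]
    refine intervalIntegral.integral_congr fun s _ => ?_
    have h2 : u z s = ∑ k, u z s k • (Pi.single k 1 : Fin m → ℝ) := by
      ext k; simp [Finset.sum_apply, Pi.single_apply]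
    change D (Φ (-s) (b (u z s))) = _
    conv_lhs => rw [h2]
    simp only [map_sum, map_smul, smul_eq_mul, sq]
    rfl
  have hW : Function.Injective W := by
    rw [injective_iff_map_eq_zero]
    intro z hz
    have h0 : ∫ s in (0:ℝ)..1, ∑ k, u z s k ^ 2 = 0 := by rw [← hWz, hz, dotProduct_zero]
    have hu0 : ∀ s ∈ Set.Icc (0:ℝ) 1, ∀ k, u z s k = 0 := by
      intro s hs k
      by_contra hne
      have := huc z
      have hpos : 0 < ∫ s in (0:ℝ)..1, ∑ k, u z s k ^ 2 :=
        intervalIntegral.integral_pos one_pos (by fun_prop)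
          (fun _ _ => Finset.sum_nonneg fun _ _ => sq_nonneg _)
          ⟨s, hs, Finset.sum_pos' (fun _ _ => sq_nonneg _)
            ⟨k, Finset.mem_univ _, by positivity⟩⟩
      exact hpos.ne' h0
    let D : (Fin d → ℝ) →L[ℝ] ℝ := LinearMap.toContinuousLinearMap (dotProductBilin ℝ ℝ z)
    -- A function that vanishes on the interval has derivative zero within it, also at the end
    -- points, where derivatives within the interval are still unique.
    have hall : ∀ k n, ∀ s ∈ Set.Icc (0:ℝ) 1, D (Φ (-s) ((L ^ n) (col k))) = 0 := by
      intro k n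
      induction n with
      | zero => intro s hs; exact hu0 s hs k
      | succ n ih =>
        intro s hs
        let F : ((Fin d → ℝ) →L[ℝ] (Fin d → ℝ)) →L[ℝ] ℝ :=
          D.comp (ContinuousLinearMap.apply ℝ (Fin d → ℝ) ((L ^ n) (col k)))
        have h1 : HasDerivAt (fun s => F (Φ (-s))) (F (-(Φ (-s) * L))) s := by
          have h3 : HasDerivAt (fun s => Φ (-s)) (-(Φ (-s) * L)) s := by
            have := (hΦ' (-s)).scomp s (hasDerivAt_neg s)
            rwa [neg_one_smul] at this
          exact F.hasFDerivAt.comp_hasDerivAt s h3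
        have h2 : HasDerivWithinAt (fun s => F (Φ (-s))) 0 (Set.Icc 0 1) s :=
          (hasDerivWithinAt_const s _ (0:ℝ)).congr (fun s hs => ih s hs) (ih s hs)
        have h3 := (uniqueDiffOn_Icc (one_pos (α := ℝ)) s hs).eq_deriv _ h1.hasDerivWithinAt h2
        have h4 : F (-(Φ (-s) * L)) = -D (Φ (-s) ((L ^ (n+1)) (col k))) := by
          simp [F, pow_succ']
        rw [h4] at h3
        linarith
    refine h z fun n => ?_
    have hLn : ∀ y, (L ^ n) y = A ^ n *ᵥ y := by
      induction n with
      | zero => simp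
      | succ n ih =>
        intro y
        rw [pow_succ', pow_succ', ← Matrix.mulVec_mulVec, ← ih]; rfl
    ext k
    have h1 := hall k n 0 ⟨le_rfl, zero_le_one⟩
    rw [neg_zero, hΦ0, one_apply_eq_self, hLn] at h1
    have h2 : D (A ^ n *ᵥ col k) = (z ᵥ* (A ^ n * B)) k := by
      have h3 : D (A ^ n *ᵥ col k) = z ⬝ᵥ (A ^ n *ᵥ (B *ᵥ Pi.single k 1)) := rfl
      rw [h3, Matrix.mulVec_mulVec, Matrix.dotProduct_mulVec]
      simp
    rw [← h2, h1, Pi.zero_apply]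
  intro x₀ x₁
  obtain ⟨z, hz⟩ := (LinearMap.injective_iff_surjective.1 hW) (Φ (-1) x₁ - x₀)
  refine ⟨1, one_pos, u z, fun t => Φ t (x₀ + ∫ s in (0:ℝ)..t, g z s), (huc z).continuousOn,
    by simp [hΦ0], ?_, ?_⟩
  · have h1 : ∫ s in (0:ℝ)..1, g z s = Φ (-1) x₁ - x₀ := hz
    simp only [h1, add_sub_cancel]
    change (Φ 1 * Φ (-1)) x₁ = x₁
    rw [hΦn]; rfl
  · intro t _
    apply HasDerivAt.hasDerivWithinAt
    have h1 : HasDerivAt (fun t => x₀ + ∫ s in (0:ℝ)..t, g z s) (g z t) t :=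
      (intervalIntegral.integral_hasDerivAt_right ((hgc z).intervalIntegrable _ _)
        ((hgc z).stronglyMeasurableAtFilter _ _) (hgc z).continuousAt).const_add x₀
    convert (hΦ t).clm_apply h1 using 1
    have h2 : Φ t (g z t) = B *ᵥ u z t := by
      change (Φ t * Φ (-t)) (b (u z t)) = _
      rw [hΦn]; rfl
    rw [h2]; rfl

end Kalman

end StructuralControl

namespace StructuralControl

/-! ### The Hautus test and the zeros of transfer functions. -/

section Hautus

variable {d m : ℕ}

/-- The Hautus test for the subsystem on the set `X` of states. -/
def HautusOn (X : Set (Fin d)) (A : Matrix (Fin d) (Fin d) ℂ) (B : Matrix (Fin d) (Fin m) ℂ) :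
    Prop :=
  ∀ (z : ℂ) (q : Fin d → ℂ), (∀ i ∉ X, q i = 0) → q ᵥ* A = z • q → q ᵥ* B = 0 → q = 0

variable {X : Set (Fin d)} {A : Matrix (Fin d) (Fin d) ℂ} {B : Matrix (Fin d) (Fin m) ℂ}

/-- The vectors supported on `X` and annihilated by all `A ^ n * B` form a subspace invariant under
`A`: the support condition persists because the columns of `A` outside `X` vanish. Were it nonzero,
it would contain a complex eigenvector, which the Hautus test excludes. -/
theorem HautusOn.exists_vecMul_ne_zero (h : HautusOn X A B) (hA : ∀ i, ∀ j ∉ X, A i j = 0)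
    {q₀ : Fin d → ℂ} (hq₀ : ∀ i ∉ X, q₀ i = 0) (hne : q₀ ≠ 0) : ∃ n, q₀ ᵥ* (A ^ n * B) ≠ 0 := by
  by_contra! hall
  let W : Submodule ℂ (Fin d → ℂ) :=
    { carrier := {q | (∀ i ∉ X, q i = 0) ∧ ∀ n, q ᵥ* (A ^ n * B) = 0}
      add_mem' := fun {a b} ha hb =>
        ⟨fun i hi => by simp [ha.1 i hi, hb.1 i hi],
          fun n => by rw [Matrix.add_vecMul, ha.2, hb.2, add_zero]⟩
      zero_mem' := ⟨fun _ _ => rfl, fun n => Matrix.zero_vecMul _⟩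
      smul_mem' := fun c a ha =>
        ⟨fun i hi => by simp [ha.1 i hi], fun n => by rw [Matrix.smul_vecMul, ha.2, smul_zero]⟩ }
  have hinv : ∀ q ∈ W, Matrix.vecMulLinear A q ∈ W := by
    rintro q ⟨-, hq2⟩
    refine ⟨fun j hj => ?_, fun n => ?_⟩
    · simp [Matrix.vecMul, dotProduct, hA _ j hj]
    · rw [Matrix.vecMulLinear_apply, Matrix.vecMul_vecMul, ← Matrix.mul_assoc, ← pow_succ']
      exact hq2 _
  have : Nontrivial W := ⟨⟨⟨q₀, hq₀, hall⟩, 0, fun h0 => hne (congrArg Subtype.val h0)⟩⟩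
  obtain ⟨z, hz⟩ := Module.End.exists_eigenvalue ((Matrix.vecMulLinear A).restrict hinv)
  obtain ⟨q, hq⟩ := hz.exists_hasEigenvector
  have hq1 := hq.apply_eq_smul
  refine hq.2 (Subtype.ext (h z q q.2.1 (congrArg Subtype.val hq1) ?_))
  simpa using q.2.2 0

theorem controllable_of_hautus {A : Matrix (Fin d) (Fin d) ℝ} {B : Matrix (Fin d) (Fin m) ℝ}
    (h : HautusOn Set.univ (A.map Complex.ofReal) (B.map Complex.ofReal)) : Controllable A B := by
  refine controllable_of_kalman fun q hq => ?_
  by_contra hne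
  obtain ⟨n, hn⟩ := h.exists_vecMul_ne_zero (by simp) (q₀ := fun i => (q i : ℂ)) (by simp)
    (fun h0 => hne (funext fun i => Complex.ofReal_eq_zero.1 (congrFun h0 i)))
  refine hn ?_
  have h1 : (A.map Complex.ofReal) ^ n * B.map Complex.ofReal = (A ^ n * B).map Complex.ofReal := by
    have h2 := Matrix.map_mul (L := A ^ n) (M := B) (f := Complex.ofRealHom)
    have h3 := Matrix.map_pow (M := A) (f := Complex.ofRealHom) n
    exact (h2.trans (by rw [h3]; rfl)).symm
  rw [h1]
  ext k
  have h2 := congrArg Complex.ofReal (congrFun (hq n) k)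
  simpa [Matrix.vecMul, dotProduct] using h2

theorem norm_vecMul_apply_le {k : ℕ} (C : Matrix (Fin d) (Fin k) ℂ) (p : Fin d → ℂ) (j : Fin k) :
    ‖(p ᵥ* C) j‖ ≤ ∑ i, ‖p i‖ * ‖C i j‖ := by
  simp only [← norm_mul]
  exact norm_sum_le Finset.univ fun i => p i * C i j

theorem norm_vecMul_sum_le (A : Matrix (Fin d) (Fin d) ℂ) (p : Fin d → ℂ) :
    ∑ j, ‖(p ᵥ* A) j‖ ≤ (∑ i, ∑ j, ‖A i j‖) * ∑ i, ‖p i‖ := by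
  calc ∑ j, ‖(p ᵥ* A) j‖ ≤ ∑ j, ∑ i, ‖p i‖ * ‖A i j‖ :=
        Finset.sum_le_sum fun j _ => norm_vecMul_apply_le A p j
    _ = ∑ i, ‖p i‖ * ∑ j, ‖A i j‖ := by
        rw [Finset.sum_comm]; simp [Finset.mul_sum]
    _ ≤ ∑ i, ‖p i‖ * ∑ i, ∑ j, ‖A i j‖ := by
        refine Finset.sum_le_sum fun i _ => mul_le_mul_of_nonneg_left ?_ (norm_nonneg _)
        exact Finset.single_le_sum (f := fun i => ∑ j, ‖A i j‖)
          (fun i _ => Finset.sum_nonneg fun _ _ => norm_nonneg _) (Finset.mem_univ i)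
    _ = _ := by rw [← Finset.sum_mul, mul_comm]

/-- In the `ℓ¹` norm, multiplication by `A` expands at most by the sum of the moduli of all entries,
so no eigenvalue exceeds that sum in modulus. -/
theorem eq_zero_of_vecMul_eq_smul {p : Fin d → ℂ} {z : ℂ} (hz : ∑ i, ∑ j, ‖A i j‖ < ‖z‖)
    (hp : p ᵥ* A = z • p) : p = 0 := by
  have h1 := norm_vecMul_sum_le A p
  rw [hp] at h1
  simp only [Pi.smul_apply, smul_eq_mul, norm_mul, ← Finset.mul_sum] at h1
  have h2 : 0 ≤ ∑ i, ‖p i‖ := Finset.sum_nonneg fun _ _ => norm_nonneg _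
  have h3 : ∑ i, ‖p i‖ = 0 := by nlinarith
  ext i
  exact norm_eq_zero.1 ((Finset.sum_eq_zero_iff_of_nonneg fun _ _ => norm_nonneg _).1 h3 i
    (Finset.mem_univ i))

/-- The inequality that ends `HautusOn.exists_radius`. There `c` and `z` are moduli, `S` and `M` are
the entrywise `ℓ¹` norms of `p` and `A`, and `δ` is the modulus of an entry of the leading Markov
parameter. -/
theorem transfer_bound_absurd {c δ N M z S : ℝ} (hc : 0 < c) (hδ : 0 < δ) (hN : 0 ≤ N)
    (hz : M + N / δ < z) (h1 : c * δ ≤ N * S) (h2 : z * S ≤ M * S + c) : False := by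
  have h3 : N < (z - M) * δ := (div_lt_iff₀ hδ).1 (by linarith)
  have h4 : 0 ≤ N / δ := by positivity
  have h5 : (z - M) * (c * δ) ≤ (z - M) * (N * S) :=
    mul_le_mul_of_nonneg_left h1 (by linarith)
  have h6 : N * ((z - M) * S) ≤ N * c := mul_le_mul_of_nonneg_left (by linarith) hN
  have h7 : N * c < (z - M) * δ * c := mul_lt_mul_of_pos_right h3 hc
  linarith

/-- The transfer function from the inputs to a state has no zeros of large modulus. -/
theorem HautusOn.exists_radius (h : HautusOn X A B) (hA : ∀ i, ∀ j ∉ X, A i j = 0)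
    {j₀ : Fin d} (hj₀ : j₀ ∈ X) :
    ∃ R : ℝ, ∀ z : ℂ, R < ‖z‖ → ∀ (p : Fin d → ℂ) (c : ℂ),
      p ᵥ* A + c • Pi.single j₀ 1 = z • p → p ᵥ* B = 0 → c = 0 := by
  classical
  -- Formally `p = c • e (z - A)⁻¹` with `e` the unit vector at `j₀`, so `p ᵥ* B` is `c` times the
  -- series of the `e A ^ l B / z ^ (l + 1)`. For large `z` its first nonzero term, here with index
  -- `n`, dominates.
  obtain ⟨n, hn, hmin⟩ : ∃ n, (Pi.single j₀ (1:ℂ) : Fin d → ℂ) ᵥ* (A ^ n * B) ≠ 0 ∧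
      ∀ k < n, (Pi.single j₀ (1:ℂ) : Fin d → ℂ) ᵥ* (A ^ k * B) = 0 := by
    have hex := h.exists_vecMul_ne_zero hA (q₀ := Pi.single j₀ 1)
      (fun i hi => Pi.single_eq_of_ne (ne_of_mem_of_not_mem hj₀ hi).symm _) (by simp)
    exact ⟨Nat.find hex, Nat.find_spec hex, fun k hk => not_not.1 (Nat.find_min hex hk)⟩
  obtain ⟨k, hk⟩ := Function.ne_iff.1 hn
  set δ := ‖((Pi.single j₀ (1:ℂ) : Fin d → ℂ) ᵥ* (A ^ n * B)) k‖ with hδ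
  have hδ0 : 0 < δ := norm_pos_iff.2 hk
  set M := ∑ i, ∑ j, ‖A i j‖ with hM
  set N := ∑ i, ‖(A ^ (n + 1) * B) i k‖ with hN
  have hN0 : 0 ≤ N := Finset.sum_nonneg fun _ _ => norm_nonneg _
  refine ⟨M + N / δ, fun z hz p c hp hpB => ?_⟩
  have hstep : ∀ l, z • (p ᵥ* (A ^ l * B)) =
      p ᵥ* (A ^ (l + 1) * B) + c • (Pi.single j₀ (1:ℂ) : Fin d → ℂ) ᵥ* (A ^ l * B) := by
    intro l
    rw [← Matrix.smul_vecMul, ← hp, Matrix.add_vecMul, Matrix.vecMul_vecMul, ← Matrix.mul_assoc,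
      ← pow_succ', Matrix.smul_vecMul]
  -- Below the leading index the recursion `hstep` propagates zeros. At `n` it bounds `c` by a
  -- multiple of `p`, while the eigenvalue equation bounds `p` by `c` divided by roughly `‖z‖`.
  have hzero : ∀ l ≤ n, p ᵥ* (A ^ l * B) = 0 := by
    intro l
    induction l with
    | zero => intro _; simpa using hpB
    | succ l ih =>
      intro hl
      have := hstep l
      rw [ih (by omega), hmin l (by omega), smul_zero, smul_zero, add_zero] at this
      exact this.symm
  have h1 := congrFun (hstep n) k
  rw [hzero n le_rfl] at h1
  rw [smul_zero, Pi.zero_apply, Pi.add_apply, Pi.smul_apply, smul_eq_mul] at h1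
  set S := ∑ i, ‖p i‖ with hS
  have hS0 : 0 ≤ S := Finset.sum_nonneg fun _ _ => norm_nonneg _
  have h2 : ‖c‖ * δ ≤ N * S := by
    have h3 : c * ((Pi.single j₀ (1:ℂ) : Fin d → ℂ) ᵥ* (A ^ n * B)) k =
        -(p ᵥ* (A ^ (n + 1) * B)) k := by linear_combination -h1
    rw [hδ, ← norm_mul, h3, norm_neg]
    calc _ ≤ ∑ i, ‖p i‖ * ‖(A ^ (n + 1) * B) i k‖ := norm_vecMul_apply_le _ _ _
      _ ≤ ∑ i, ‖p i‖ * N := by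
        refine Finset.sum_le_sum fun i _ => mul_le_mul_of_nonneg_left ?_ (norm_nonneg _)
        exact Finset.single_le_sum (f := fun i => ‖(A ^ (n + 1) * B) i k‖)
          (fun i _ => norm_nonneg _) (Finset.mem_univ i)
      _ = _ := by rw [← Finset.sum_mul, mul_comm]
  have h4 : ‖z‖ * S ≤ M * S + ‖c‖ := by
    calc ‖z‖ * S = ∑ j, ‖(z • p) j‖ := by simp [hS, Finset.mul_sum]
      _ ≤ ∑ j, (‖(p ᵥ* A) j‖ + ‖c‖ * (Pi.single j₀ (1:ℝ) : Fin d → ℝ) j) := by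
        rw [← hp]
        refine Finset.sum_le_sum fun j _ => (norm_add_le _ _).trans ?_
        by_cases hj : j = j₀
        · subst hj; simp
        · simp [hj]
      _ ≤ _ := by
        rw [Finset.sum_add_distrib, ← Finset.mul_sum]
        simpa using norm_vecMul_sum_le A p
  by_contra hc
  exact transfer_bound_absurd (norm_pos_iff.2 hc) hδ0 hN0 hz h2 h4

end Hautus

end StructuralControl

namespace StructuralControl

/-! ### Building a controllable realization from stems and cycles. -/

section Realization

variable {d m : ℕ}

/-- The states from which the successor chain of `f` ends in an input. -/
inductive Stem (f : Fin d → Fin d ⊕ Fin m) : Fin d → Prop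
  | root {i : Fin d} {k : Fin m} (h : f i = Sum.inr k) : Stem f i
  | step {i j : Fin d} (h : f i = Sum.inl j) (hj : Stem f j) : Stem f i

theorem Stem.of_inl {f : Fin d → Fin d ⊕ Fin m} {i j : Fin d} (hi : Stem f i)
    (h : f i = Sum.inl j) : Stem f j := by
  cases hi with
  | root h' => rw [h] at h'; cases h'
  | step h' hj => rw [h] at h'; cases h'; exact hj

/-- The sets of states on which some realization of the sparsity pattern passes the Hautus test. -/
def RealizableOn (A : SparsityMatrix d d) (B : SparsityMatrix d m) (X : Set (Fin d)) : Prop :=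
  ∃ (A' : Matrix (Fin d) (Fin d) ℝ) (B' : Matrix (Fin d) (Fin m) ℝ),
    IsRealization A A' ∧ IsRealization B B' ∧ (∀ i ∉ X, ∀ j, A' i j = 0) ∧
    (∀ i, ∀ j ∉ X, A' i j = 0) ∧ (∀ i ∉ X, ∀ k, B' i k = 0) ∧
    HautusOn X (A'.map Complex.ofReal) (B'.map Complex.ofReal)

variable {A : SparsityMatrix d d} {B : SparsityMatrix d m} {f : Fin d → Fin d ⊕ Fin m}

/-- With unit weights on the stems, injectivity of `f` leaves at most one nonzero entry in each
column. A vector passing through the Hautus equations is therefore zero at the states fed by inputs,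
and from there zero at each further state of the stem. -/
theorem realizableOn_stem (hf : Function.Injective f)
    (hAB : ∀ i, Sum.elim (A i) (B i) (f i) = true) : RealizableOn A B {i | Stem f i} := by
  classical
  refine ⟨Matrix.of fun i j => if Stem f i ∧ f i = Sum.inl j then 1 else 0,
    Matrix.of fun i k => if f i = Sum.inr k then 1 else 0, ?_, ?_, ?_, ?_, ?_, ?_⟩
  · intro i j h
    refine if_neg fun h' => ?_
    have := hAB i
    rw [h'.2, Sum.elim_inl, h] at this
    cases this
  · intro i j h
    refine if_neg fun h' => ?_
    have := hAB i
    rw [h', Sum.elim_inr, h] at this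
    cases this
  · intro i hi j
    exact if_neg fun h' => hi h'.1
  · intro i j hj
    exact if_neg fun h' => hj (h'.1.of_inl h'.2)
  · intro i hi k
    exact if_neg fun h' => hi (Stem.root h')
  · intro z q hq h1 h2
    have key : ∀ i, Stem f i → q i = 0 := by
      intro i hi
      induction hi with
      | @root i k h =>
        have := congrFun h2 k
        simp only [Matrix.vecMul, dotProduct, Matrix.map_apply, Matrix.of_apply,
          Pi.zero_apply] at this
        rw [Finset.sum_eq_single i] at this
        · simpa [h] using this
        · intro i' _ hne
          rw [if_neg fun h' => hne (hf (h'.trans h.symm))]; simp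
        · simp
      | @step i j h hj ih =>
        have := congrFun h1 j
        simp only [Matrix.vecMul, dotProduct, Matrix.map_apply, Matrix.of_apply,
          Pi.smul_apply, ih, smul_zero]
          at this
        rw [Finset.sum_eq_single i] at this
        · simpa [h, Stem.step h hj] using this
        · intro i' _ hne
          rw [if_neg fun h' => hne (hf (h'.2.trans h.symm))]; simp
        · simp
    ext i
    by_cases hi : Stem f i
    · exact key i hi
    · exact hq i hi

/-- The successor function of `f`. -/
def succState (f : Fin d → Fin d ⊕ Fin m) (i : Fin d) : Fin d := Sum.elim id (fun _ => i) (f i)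

theorem eq_inl_succState {i : Fin d} (hi : ¬ Stem f i) : f i = Sum.inl (succState f i) := by
  unfold succState
  cases h : f i with
  | inl j => rfl
  | inr k => exact absurd (Stem.root h) hi

theorem not_stem_succState {i : Fin d} (hi : ¬ Stem f i) : ¬ Stem f (succState f i) := fun h =>
  hi (Stem.step (eq_inl_succState hi) h)

theorem not_stem_iterate {i : Fin d} (hi : ¬ Stem f i) (n : ℕ) :
    ¬ Stem f ((succState f)^[n] i) := by
  induction n with
  | zero => exact hi
  | succ n ih => rw [Function.iterate_succ_apply']; exact not_stem_succState ih

/-- Outside the stems the successor function is an injective self-map of a finite set, so every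
point is periodic. -/
theorem exists_period (hf : Function.Injective f) {i : Fin d} (hi : ¬ Stem f i) :
    ∃ l > 0, (succState f)^[l] i = i := by
  let g : {i // ¬ Stem f i} → {i // ¬ Stem f i} := fun i => ⟨succState f i, not_stem_succState i.2⟩
  have hg : Function.Injective g := by
    intro a b hab
    refine Subtype.ext (hf ?_)
    rw [eq_inl_succState a.2, eq_inl_succState b.2]
    exact congrArg (fun x => Sum.inl x.1) hab
  obtain ⟨l, hl, h⟩ := Function.mem_periodicPts.1 (hg.mem_periodicPts ⟨i, hi⟩)
  refine ⟨l, hl, ?_⟩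
  have h1 : Function.Semiconj Subtype.val g (succState f) := fun _ => rfl
  have h2 := (h1.iterate_right l) ⟨i, hi⟩
  rw [← h2, h.eq]

/-- Attaches to `X` the cycle through `i₀`, with entering weights `a` from states of `X` and `b`
from inputs. The bound `R` is kept abstract so that one argument covers entry from a state and entry
from an input.

An eigenvector that is nonzero at `i₀` forces `z ^ l = r ^ l` around a cycle of length `l`, hence
`‖z‖ = r > R`, and then `hR` makes its value at `i₀` zero. So it vanishes on the whole cycle, and
what remains is an eigenvector on `X`. -/
theorem RealizableOn.extend (hf : Function.Injective f)
    (hAB : ∀ i, Sum.elim (A i) (B i) (f i) = true) {X : Set (Fin d)}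
    (hstem : ∀ i, Stem f i → i ∈ X) (hX : ∀ i ∈ X, ∀ j, f i = Sum.inl j → j ∈ X)
    {A' : Matrix (Fin d) (Fin d) ℝ} {B' : Matrix (Fin d) (Fin m) ℝ}
    (hA' : IsRealization A A') (hB' : IsRealization B B') (hrow : ∀ i ∉ X, ∀ j, A' i j = 0)
    (hcol : ∀ i, ∀ j ∉ X, A' i j = 0) (hBrow : ∀ i ∉ X, ∀ k, B' i k = 0)
    (hH : HautusOn X (A'.map Complex.ofReal) (B'.map Complex.ofReal))
    {i₀ : Fin d} (hi₀ : i₀ ∉ X) (a : Fin d → ℝ) (b : Fin m → ℝ) (ha : ∀ j ∉ X, a j = 0)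
    (haA : ∀ j, A i₀ j = false → a j = 0) (hbB : ∀ k, B i₀ k = false → b k = 0) {R : ℝ}
    (hR : ∀ z : ℂ, R < ‖z‖ → ∀ (p : Fin d → ℂ) (c : ℂ), (∀ i ∉ X, p i = 0) →
      p ᵥ* A'.map Complex.ofReal + c • (fun j => (a j : ℂ)) = z • p →
      p ᵥ* B'.map Complex.ofReal + c • (fun k => (b k : ℂ)) = 0 → c = 0) :
    ∃ X', X ⊂ X' ∧ (∀ i ∈ X', ∀ j, f i = Sum.inl j → j ∈ X') ∧ RealizableOn A B X' := by
  classical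
  set g := succState f with hg
  have hns : ¬ Stem f i₀ := fun h => hi₀ (hstem _ h)
  obtain ⟨l, hl, hper⟩ := exists_period hf hns
  have hback : ∀ n, ∃ n', g^[n'] (g^[n] i₀) = i₀ := by
    intro n
    -- Completes the `n` steps already made to `l * n`, a multiple of the period.
    refine ⟨l * n - n, ?_⟩
    rw [← Function.iterate_add_apply, Nat.sub_add_cancel (Nat.le_mul_of_pos_left n hl)]
    have : Function.IsPeriodicPt g l i₀ := hper
    exact this.mul_const n
  have hfwd : ∀ n i, i ∈ X → g^[n] i ∈ X := by
    intro n
    induction n with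
    | zero => exact fun i hi => hi
    | succ n ih =>
      intro i hi
      rw [Function.iterate_succ_apply]
      refine ih _ ?_
      by_cases hs : Stem f i
      · change Sum.elim id (fun _ => i) (f i) ∈ X
        cases h : f i with
        | inl j => exact hX i hi j h
        | inr k => exact hi
      · exact hX i hi _ (eq_inl_succState hs)
  have hXY : ∀ n, g^[n] i₀ ∉ X := by
    intro n hn
    obtain ⟨n', h⟩ := hback n
    exact hi₀ (h ▸ hfwd n' _ hn)
  let Y : Set (Fin d) := {y | ∃ n, g^[n] i₀ = y}
  have hYX : ∀ y ∈ Y, y ∉ X := by rintro _ ⟨n, rfl⟩; exact hXY n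
  have hYf : ∀ y ∈ Y, f y = Sum.inl (g y) := by
    rintro _ ⟨n, rfl⟩; exact eq_inl_succState (not_stem_iterate hns n)
  have hYg : ∀ y ∈ Y, g y ∈ Y := by
    rintro _ ⟨n, rfl⟩; exact ⟨n + 1, Function.iterate_succ_apply' g n i₀⟩
  have hi₀Y : i₀ ∈ Y := ⟨0, rfl⟩
  set r : ℝ := max R 0 + 1 with hr
  have hr0 : 0 < r := by positivity
  have hRr : R < r := by
    have := le_max_left R 0
    linarith
  let A'' : Matrix (Fin d) (Fin d) ℝ := Matrix.of fun i j =>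
    A' i j + (if i ∈ Y ∧ f i = Sum.inl j then r else 0) + (if i = i₀ then a j else 0)
  let B'' : Matrix (Fin d) (Fin m) ℝ :=
    Matrix.of fun i k => B' i k + (if i = i₀ then b k else 0)
  have hvA : ∀ (q : Fin d → ℂ) j, (q ᵥ* A''.map Complex.ofReal) j =
      (q ᵥ* A'.map Complex.ofReal) j +
        (∑ i, if i ∈ Y ∧ f i = Sum.inl j then q i * r else 0) + q i₀ * a j := by
    intro q j
    simp only [Matrix.vecMul, dotProduct, Matrix.map_apply, Matrix.of_apply, A'',
      Complex.ofReal_add, mul_add,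
      Finset.sum_add_distrib]
    congr 1
    · congr 1
      refine Finset.sum_congr rfl fun i _ => ?_
      split_ifs <;> simp
    · rw [Finset.sum_eq_single i₀] <;> simp +contextual
  have hvB : ∀ (q : Fin d → ℂ) k, (q ᵥ* B''.map Complex.ofReal) k =
      (q ᵥ* B'.map Complex.ofReal) k + q i₀ * b k := by
    intro q k
    simp only [Matrix.vecMul, dotProduct, Matrix.map_apply, Matrix.of_apply, B'',
      Complex.ofReal_add, mul_add,
      Finset.sum_add_distrib]
    congr 1
    rw [Finset.sum_eq_single i₀] <;> simp +contextual
  refine ⟨X ∪ Y, ⟨Set.subset_union_left, fun h => hi₀ (h (Or.inr hi₀Y))⟩, ?_,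
    A'', B'', ?_, ?_, ?_, ?_, ?_, ?_⟩
  · rintro i (hi | hi) j hj
    · exact Or.inl (hX i hi j hj)
    · rw [hYf i hi] at hj
      cases hj
      exact Or.inr (hYg i hi)
  · intro i j h
    have h1 : ¬ (i ∈ Y ∧ f i = Sum.inl j) := by
      intro h'
      have := hAB i
      rw [h'.2, Sum.elim_inl, h] at this
      cases this
    simp only [A'', Matrix.of_apply, hA' i j h, if_neg h1]
    split_ifs with h2
    · subst h2; simp [haA j h]
    · simp
  · intro i k h
    simp only [B'', Matrix.of_apply, hB' i k h]
    split_ifs with h2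
    · subst h2; simp [hbB k h]
    · simp
  · intro i hi j
    have h1 : i ∉ X := fun h => hi (Or.inl h)
    have h2 : i ∉ Y := fun h => hi (Or.inr h)
    have h3 : i ≠ i₀ := fun h => h2 (h ▸ hi₀Y)
    simp [A'', hrow i h1 j, h2, h3]
  · intro i j hj
    have h1 : j ∉ X := fun h => hj (Or.inl h)
    have h2 : ¬ (i ∈ Y ∧ f i = Sum.inl j) := by
      rintro ⟨hi, h⟩
      rw [hYf i hi] at h
      cases h
      exact hj (Or.inr (hYg i hi))
    simp [A'', hcol i j h1, if_neg h2, ha j h1]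
  · intro i hi k
    have h1 : i ∉ X := fun h => hi (Or.inl h)
    have h3 : i ≠ i₀ := fun h => hi (Or.inr (h ▸ hi₀Y))
    simp [B'', hBrow i h1 k, h3]
  · intro z q hq hqA hqB
    -- The column of a cycle state has a single nonzero entry, since `A'` and `a` vanish on columns
    -- outside `X`.
    have hcyc : ∀ y ∈ Y, r * q y = z * q (g y) := by
      intro y hy
      have h1 := congrFun hqA (g y)
      rw [hvA, ha _ (hYX _ (hYg y hy)), Finset.sum_eq_single y] at h1
      · rw [if_pos ⟨hy, hYf y hy⟩] at h1
        have h2 : (q ᵥ* A'.map Complex.ofReal) (g y) = 0 := by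
          simp [Matrix.vecMul, dotProduct, hcol _ _ (hYX _ (hYg y hy))]
        rw [h2] at h1
        simp only [Complex.ofReal_zero, mul_zero, add_zero, zero_add, Pi.smul_apply,
          smul_eq_mul] at h1
        rw [mul_comm, h1]
      · rintro i - hne
        exact if_neg fun h => hne (hf (h.2.trans (hYf y hy).symm))
      · simp
    have hcycn : ∀ n, ∀ y ∈ Y, (r : ℂ) ^ n * q y = z ^ n * q (g^[n] y) := by
      intro n
      induction n with
      | zero => simp
      | succ n ih =>
        intro y hy
        rw [Function.iterate_succ_apply, pow_succ, mul_assoc, hcyc y hy, mul_left_comm,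
          ih _ (hYg y hy)]
        ring
    let p : Fin d → ℂ := fun i => if i ∈ X then q i else 0
    have hpX : ∀ i ∉ X, p i = 0 := fun i hi => if_neg hi
    have hpA : p ᵥ* A'.map Complex.ofReal = q ᵥ* A'.map Complex.ofReal := by
      ext j
      simp only [Matrix.vecMul, dotProduct]
      refine Finset.sum_congr rfl fun i _ => ?_
      by_cases hi : i ∈ X
      · simp [p, hi]
      · simp [hrow i hi j]
    have hpB : p ᵥ* B'.map Complex.ofReal = q ᵥ* B'.map Complex.ofReal := by
      ext j
      simp only [Matrix.vecMul, dotProduct]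
      refine Finset.sum_congr rfl fun i _ => ?_
      by_cases hi : i ∈ X
      · simp [p, hi]
      · simp [hBrow i hi j]
    -- The cycle acts on `X` only through its entering row, so the restriction `p` of `q` satisfies
    -- the equation of `hR` with `c = q i₀`.
    have h1 : p ᵥ* A'.map Complex.ofReal + q i₀ • (fun j => (a j : ℂ)) = z • p := by
      ext j
      by_cases hj : j ∈ X
      · have h2 := congrFun hqA j
        rw [hvA, Finset.sum_eq_zero] at h2
        · simpa [hpA, p, hj] using h2
        · intro i _
          refine if_neg fun h => ?_
          have := hYf i h.1
          rw [h.2] at this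
          cases this
          exact hYX _ (hYg i h.1) hj
      · have : (p ᵥ* A'.map Complex.ofReal) j = 0 := by
          simp [Matrix.vecMul, dotProduct, hcol _ j hj]
        simp [this, p, hj, ha j hj]
    have h2 : p ᵥ* B'.map Complex.ofReal + q i₀ • (fun k => (b k : ℂ)) = 0 := by
      ext k
      have := congrFun hqB k
      rw [hvB] at this
      simpa [hpB] using this
    have hc : q i₀ = 0 := by
      by_contra hne
      have h3 := hcycn l i₀ hi₀Y
      rw [hper] at h3
      have h4 := congrArg norm (mul_right_cancel₀ hne h3)
      rw [norm_pow, norm_pow] at h4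
      have h5 := (pow_left_inj₀ (norm_nonneg _) (norm_nonneg _) hl.ne').1 h4
      rw [Complex.norm_real, Real.norm_of_nonneg hr0.le] at h5
      exact hne (hR z (h5 ▸ hRr) p _ hpX h1 h2)
    have hY0 : ∀ y ∈ Y, q y = 0 := by
      rintro _ ⟨n, rfl⟩
      obtain ⟨n', h⟩ := hback n
      have h3 := hcycn n' (g^[n] i₀) ⟨n, rfl⟩
      rw [h, hc, mul_zero] at h3
      refine (mul_eq_zero.1 h3).resolve_left (pow_ne_zero _ ?_)
      exact_mod_cast hr0.ne'
    have hpq : p = q := by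
      ext i
      by_cases hi : i ∈ X
      · simp [p, hi]
      · rw [hpX i hi]
        by_cases hi' : i ∈ Y
        · exact (hY0 i hi').symm
        · exact (hq i fun h => h.elim hi hi').symm
    rw [hc, zero_smul, add_zero, hpq] at h1 h2
    exact hH z q (hpq ▸ hpX) h1 h2

/-- Accessibility is assumed in the form that every proper set of states is left by an edge or
bypassed by an input. A maximal realizable set that contains the stems and is closed under `f` must
then be everything, since otherwise a cycle could be attached to it. -/
theorem structurallyControllable_of_matching (hf : Function.Injective f)
    (hAB : ∀ i, Sum.elim (A i) (B i) (f i) = true)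
    (hacc : ∀ X : Set (Fin d), X ≠ Set.univ →
      ∃ i ∉ X, (∃ j ∈ X, A i j = true) ∨ ∃ k, B i k = true) :
    StructurallyControllable A B := by
  classical
  let P : Set (Fin d) → Prop := fun X =>
    (∀ i, Stem f i → i ∈ X) ∧ (∀ i ∈ X, ∀ j, f i = Sum.inl j → j ∈ X) ∧ RealizableOn A B X
  obtain ⟨X, hX⟩ := (Set.toFinite {X | P X}).exists_maximal
    ⟨{i | Stem f i}, fun _ h => h, fun _ hi _ h => Stem.of_inl hi h, realizableOn_stem hf hAB⟩
  obtain ⟨hstem, hcl, A', B', hA', hB', hrow, hcol, hBrow, hH⟩ := hX.prop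
  by_cases huniv : X = Set.univ
  · subst huniv
    exact ⟨A', B', hA', hB', controllable_of_hautus hH⟩
  exfalso
  obtain ⟨i₀, hi₀, h⟩ := hacc X huniv
  have hcol' : ∀ i, ∀ j ∉ X, (A'.map Complex.ofReal) i j = 0 := fun i j hj => by
    simp [hcol i j hj]
  obtain ⟨X', hlt, hX'c, hX'⟩ : ∃ X', X ⊂ X' ∧ (∀ i ∈ X', ∀ j, f i = Sum.inl j → j ∈ X') ∧
      RealizableOn A B X' := by
    obtain ⟨j₀, hj₀, hA₀⟩ | ⟨k₀, hk₀⟩ := h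
    · obtain ⟨R, hR⟩ := hH.exists_radius hcol' hj₀
      refine RealizableOn.extend hf hAB hstem hcl hA' hB' hrow hcol hBrow hH hi₀ (Pi.single j₀ 1) 0
        ?_ ?_ (fun _ _ => rfl) (R := R) ?_
      · exact fun j hj => Pi.single_eq_of_ne (ne_of_mem_of_not_mem hj₀ hj).symm _
      · intro j hj
        refine Pi.single_eq_of_ne ?_ _
        rintro rfl
        rw [hA₀] at hj
        cases hj
      · intro z hz p c _ h1 h2
        refine hR z hz p c ?_ ?_
        · rw [← h1]
          congr 2
          ext j
          by_cases hj : j = j₀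
          · subst hj; simp
          · simp [hj]
        · ext k
          simpa using congrFun h2 k
    -- For entry from an input it suffices that `r` exceeds all eigenvalues of `A'`: then `p = 0`,
    -- and `c` is read off from column `k₀`.
    · refine RealizableOn.extend hf hAB hstem hcl hA' hB' hrow hcol hBrow hH hi₀ 0 (Pi.single k₀ 1)
        (fun _ _ => rfl) (fun _ _ => rfl) ?_
        (R := ∑ i, ∑ j, ‖(A'.map Complex.ofReal) i j‖) ?_
      · intro k hk
        refine Pi.single_eq_of_ne ?_ _
        rintro rfl
        rw [hk₀] at hk
        cases hk
      · intro z hz p c _ h1 h2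
        have hp : p = 0 := eq_zero_of_vecMul_eq_smul hz (by
          rw [← h1]; ext j; simp)
        simpa [hp] using congrFun h2 k₀
  exact hlt.2 (hX.le_of_ge ⟨fun i hi => hlt.1 (hstem i hi), hX'c, hX'⟩ hlt.1)

end Realization

/-! ### Source components and Lin's theorem. -/

section Lin

variable {d m : ℕ} {A : SparsityMatrix d d} {B : SparsityMatrix d m}

theorem reaches_of_mem_isSCC {S : Set (Fin d)} (hS : IsSCC A S) {i j : Fin d} (hi : i ∈ S)
    (hj : j ∈ S) : Reaches A i j := by
  obtain ⟨v, rfl⟩ := hS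
  exact hi.2.trans hj.1

theorem mem_of_reaches_mem {S : Set (Fin d)} (hS : IsSourceSCC A S) {i j : Fin d}
    (h : Reaches A i j) (hj : j ∈ S) : i ∈ S := by
  induction h using Relation.ReflTransGen.head_induction_on with
  | refl => exact hj
  | head h _ ih => exact hS.2 _ _ h ih

theorem isSourceSCC_of_forall {v : Fin d} (hv : ∀ u, Reaches A u v → Reaches A v u) :
    IsSourceSCC A {u | Reaches A u v} := by
  refine ⟨⟨v, Set.ext fun u => ⟨fun h => ⟨hv u h, h⟩, fun h => h.2⟩⟩, fun u u' h hu' => ?_⟩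
  exact Relation.ReflTransGen.head h hu'

theorem IsSourceSCC.eq_setOf {S : Set (Fin d)} (hS : IsSourceSCC A S) {v : Fin d} (hv : v ∈ S) :
    S = {u | Reaches A u v} :=
  Set.ext fun _ => ⟨fun hu => reaches_of_mem_isSCC hS.1 hu hv, fun h => mem_of_reaches_mem hS h hv⟩

theorem IsSourceSCC.nonempty {S : Set (Fin d)} (hS : IsSourceSCC A S) : S.Nonempty := by
  obtain ⟨⟨v, rfl⟩, -⟩ := hS
  exact ⟨v, Relation.ReflTransGen.refl, Relation.ReflTransGen.refl⟩

/-- Among the states that reach `v`, one with the fewest ancestors is reached back from each of its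
ancestors, so its ancestors form a source component. -/
theorem exists_source_reaches (v : Fin d) :
    ∃ S, IsSourceSCC A S ∧ ∃ u ∈ S, Reaches A u v := by
  obtain ⟨u, hu, hmin⟩ := Set.exists_min_image {u | Reaches A u v}
    (fun u => Set.ncard {u' | Reaches A u' u}) (Set.toFinite _) ⟨v, Relation.ReflTransGen.refl⟩
  refine ⟨_, isSourceSCC_of_forall (v := u) fun u' hu' => ?_, u, Relation.ReflTransGen.refl, hu⟩
  have hsub : {x | Reaches A x u'} ⊆ {x | Reaches A x u} := fun x hx => hx.trans hu'
  have := Set.eq_of_subset_of_ncard_le hsub (hmin u' (hu'.trans hu)) (Set.toFinite _)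
  have h : u ∈ {x | Reaches A x u} := Relation.ReflTransGen.refl
  rw [← this] at h
  exact h

/-- Lin's characterization of structural controllability: an input enters every source component,
and the bipartite graph has a matching that covers all right vertices. -/
theorem structurallyControllable_iff : StructurallyControllable A B ↔
    (∀ S, IsSourceSCC A S → ∃ i ∈ S, ∃ k, B i k = true) ∧
    ∃ f : Fin d → Fin d ⊕ Fin m, Function.Injective f ∧
      ∀ i, Sum.elim (A i) (B i) (f i) = true := by
  constructor
  · rintro ⟨A', B', hA', hB', hC⟩
    constructor
    · intro S hS
      obtain ⟨i, hi, k, hk⟩ := hC.exists_input hS.nonempty fun i hi j hj => by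
        refine hA' i j (Bool.eq_false_iff.2 fun h => hj (hS.2 j i h hi))
      exact ⟨i, hi, k, by by_contra h; exact hk (hB' i k (Bool.eq_false_iff.2 h))⟩
    · obtain ⟨f, hf, hf'⟩ := exists_injective_of_vecMul_injective
        (M := Matrix.fromCols A' B') fun q hq => by
          rw [Matrix.vecMul_fromCols] at hq
          exact hC.eq_zero_of_vecMul (funext fun j => congrFun hq (Sum.inl j))
            (funext fun j => congrFun hq (Sum.inr j))
      refine ⟨f, hf, fun i => ?_⟩
      have := hf' i
      cases h : f i with
      | inl j =>
        rw [h] at this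
        by_contra h'
        exact this (hA' i j (Bool.eq_false_iff.2 h'))
      | inr k =>
        rw [h] at this
        by_contra h'
        exact this (hB' i k (Bool.eq_false_iff.2 h'))
  · rintro ⟨hS, f, hf, hAB⟩
    -- If neither an edge from `X` nor an input entered the complement of `X`, then `X` would
    -- contain every state that an input enters and all its descendants. By the source condition
    -- these are all states.
    refine structurallyControllable_of_matching hf hAB fun X hX => ?_
    by_contra! hno
    obtain ⟨v, hv⟩ := (Set.ne_univ_iff_exists_notMem X).1 hX
    obtain ⟨S, hSS, u, hu, huv⟩ := exists_source_reaches (A := A) v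
    obtain ⟨i, hi, k, hk⟩ := hS S hSS
    have hiX : i ∈ X := by
      by_contra h
      exact (hno i h).2 k hk
    have hcl : ∀ x y, Reaches A x y → x ∈ X → y ∈ X := by
      intro x y hxy hx
      induction hxy with
      | refl => exact hx
      | tail _ h ih =>
        by_contra h'
        exact (hno _ h').1 _ ih h
    exact hv (hcl _ _ ((reaches_of_mem_isSCC hSS.1 hi hu).trans huv) hiX)

end Lin

end StructuralControl

namespace StructuralControl

/-! ### Existence, admissibility and the factor 2. -/

section Approximation

variable {d m : ℕ} {A : SparsityMatrix d d} {B : SparsityMatrix d m} {w : Fin d → Fin m → ℝ}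

theorem IsMatching.card_le {M : Finset (BipEdge d m)} (hM : IsMatching A B M) : M.card ≤ d := by
  classical
  have h : Set.InjOn Prod.snd (M : Set (BipEdge d m)) := fun e he e' he' h => by
    by_contra hne
    exact (hM.2 e he e' he' hne).2 h
  rw [← Finset.card_image_of_injOn h]
  simpa using Finset.card_le_univ (M.image Prod.snd)

theorem IsMatching.exists_injective {M : Finset (BipEdge d m)} (hM : IsMatching A B M)
    (hcard : M.card = d) : ∃ f : Fin d → Fin d ⊕ Fin m, Function.Injective f ∧
      ∀ i, (f i, i) ∈ M := by
  classical
  have h : Set.InjOn Prod.snd (M : Set (BipEdge d m)) := fun e he e' he' h => by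
    by_contra hne
    exact (hM.2 e he e' he' hne).2 h
  have huniv : M.image Prod.snd = Finset.univ := by
    refine Finset.eq_univ_of_card _ ?_
    rw [Finset.card_image_of_injOn h, hcard, Fintype.card_fin]
  have hex : ∀ i, ∃ x, (x, i) ∈ M := by
    intro i
    have : i ∈ M.image Prod.snd := huniv ▸ Finset.mem_univ i
    obtain ⟨⟨x, i'⟩, hx, rfl⟩ := Finset.mem_image.1 this
    exact ⟨x, hx⟩
  choose f hf using hex
  refine ⟨f, fun i j hij => ?_, hf⟩
  by_contra hne
  exact (hM.2 _ (hf i) _ (hf j) fun h => hne (congrArg Prod.snd h)).1 hij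

theorem isMatching_image {f : Fin d → Fin d ⊕ Fin m} (hf : Function.Injective f)
    (hAB : ∀ i, Sum.elim (A i) (B i) (f i) = true) :
    IsMatching A B (Finset.univ.image fun i => (f i, i)) ∧
      (Finset.univ.image fun i => (f i, i)).card = d := by
  refine ⟨⟨?_, ?_⟩, ?_⟩
  · intro e he
    obtain ⟨i, -, rfl⟩ := Finset.mem_image.1 he
    have := hAB i
    simp only [bipartiteEdges, Set.mem_ofPred_eq]
    cases h : f i <;> simpa [h] using this
  · intro e he e' he' hne
    obtain ⟨i, -, rfl⟩ := Finset.mem_image.1 he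
    obtain ⟨j, -, rfl⟩ := Finset.mem_image.1 he'
    have hij : i ≠ j := fun h => hne (by rw [h])
    exact ⟨fun h => hij (hf h), hij⟩
  · rw [Finset.card_image_of_injective _ fun i j h => congrArg Prod.snd h, Finset.card_univ,
      Fintype.card_fin]

theorem edge_of_mem {M : Finset (BipEdge d m)} (hM : IsMatching A B M) {x : Fin d ⊕ Fin m}
    {i : Fin d} (h : (x, i) ∈ M) : Sum.elim (A i) (B i) x = true := by
  have := hM.1 _ h
  cases x <;> exact this

/-- No matching exceeds the `d` right vertices, and Lin's theorem provides one that attains this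
size. -/
theorem isMaximumMatching_iff (hSC : StructurallyControllable A B) {M : Finset (BipEdge d m)} :
    IsMaximumMatching A B M ↔ IsMatching A B M ∧ M.card = d := by
  obtain ⟨-, f, hf, hAB⟩ := structurallyControllable_iff.1 hSC
  have h := isMatching_image hf hAB
  constructor
  · rintro ⟨h1, h2⟩
    exact ⟨h1, h1.card_le.antisymm (h.2.ge.trans (h2 _ h.1))⟩
  · rintro ⟨h1, h2⟩
    exact ⟨h1, fun M' h' => h'.card_le.trans h2.ge⟩

theorem exists_isMCMM (hSC : StructurallyControllable A B) (w : Fin d → Fin m → ℝ) :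
    ∃ M, IsMCMM A B w M := by
  obtain ⟨-, f, hf, hAB⟩ := structurallyControllable_iff.1 hSC
  obtain ⟨M, hM, hmin⟩ := Set.exists_min_image {M | IsMaximumMatching A B M}
    (fun M => ∑ e ∈ M, edgeCost w e) (Set.toFinite _)
    ⟨_, (isMaximumMatching_iff hSC).2 (isMatching_image hf hAB)⟩
  exact ⟨M, hM, hmin⟩

theorem sum_edgeCost (M : Finset (BipEdge d m)) :
    ∑ e ∈ M, edgeCost w e = ∑ i, ∑ k, if (Sum.inr k, i) ∈ M then w i k else 0 := by
  classical
  have h : ∑ e ∈ M, edgeCost w e = ∑ e, if e ∈ M then edgeCost w e else 0 := by simp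
  rw [h, Fintype.sum_prod_type, Fintype.sum_sum_type]
  simp only [edgeCost, Sum.elim_inl, Sum.elim_inr, ite_self, Finset.sum_const_zero, zero_add]
  exact Finset.sum_comm

theorem weightedNorm_eq_sum_edgeCost {M : Finset (BipEdge d m)} {Bt : SparsityMatrix d m}
    (h : ∀ i k, Bt i k = true ↔ (Sum.inr k, i) ∈ M) :
    weightedNorm w Bt = ∑ e ∈ M, edgeCost w e := by
  rw [sum_edgeCost]
  simp only [weightedNorm, h]

/-- By Lin's theorem `B'` supports a matching of size `d`. It is a maximum matching of the graph of
`B` as well, and it pays only for stars of `B'`. -/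
theorem IsMatchingOutput.weightedNorm_le (hSC : StructurallyControllable A B)
    (hw : ∀ i j, B i j = true → 0 ≤ w i j) {Bt B' : SparsityMatrix d m}
    (hBt : IsMatchingOutput A B w Bt) (hB' : B' ∈ admissible A B) :
    weightedNorm w Bt ≤ weightedNorm w B' := by
  classical
  obtain ⟨M, hM, hMB⟩ := hBt
  obtain ⟨-, f, hf, hAB⟩ := structurallyControllable_iff.1 hB'.2
  have hsub : ∀ i k, B' i k = true → B i k = true := fun i k h => by
    by_contra h'
    rw [hB'.1 i k (Bool.eq_false_iff.2 h')] at h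
    cases h
  obtain ⟨h1, h2⟩ := isMatching_image hf hAB
  set M' : Finset (BipEdge d m) := Finset.univ.image fun i => (f i, i)
  have h3 : IsMatching A B M' := by
    refine ⟨fun e he => ?_, h1.2⟩
    have := h1.1 e he
    obtain ⟨x | k, i⟩ := e
    · exact this
    · exact hsub _ _ this
  rw [weightedNorm_eq_sum_edgeCost hMB]
  refine (hM.2 M' ((isMaximumMatching_iff hSC).2 ⟨h3, h2⟩)).trans ?_
  rw [sum_edgeCost]
  refine Finset.sum_le_sum fun i _ => Finset.sum_le_sum fun k _ => ?_
  by_cases hk : (Sum.inr k, i) ∈ M'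
  · rw [if_pos hk, if_pos (show B' i k = true from edge_of_mem h1 hk)]
  · rw [if_neg hk]
    split_ifs with h
    · exact hw i k (hsub i k h)
    · exact le_rfl

theorem weightedNorm_eq_sum_filter (N : SparsityMatrix d m) :
    weightedNorm w N = ∑ x ∈ Finset.univ.filter (fun x : Fin d × Fin m => N x.1 x.2 = true),
      w x.1 x.2 := by
  rw [Finset.sum_filter, Fintype.sum_prod_type]
  rfl

theorem connection_le {i i' : Fin d} {k k' : Fin m}
    (h : connectionCost B w i k ≤ connectionCost B w i' k') (hB : B i' k' = true) :
    B i k = true ∧ w i k ≤ w i' k' := by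
  unfold connectionCost at h
  rw [if_pos hB] at h
  split_ifs at h with h1
  · exact ⟨h1, WithTop.coe_le_coe.1 h⟩
  · exact absurd h (by simp)

/-- Each source component contains a star of `B'` that costs at least as much as the chosen cheapest
connection; summing needs these stars to be distinct. -/
theorem IsAccessibilityOutput.weightedNorm_le
    (hw : ∀ i j, B i j = true → 0 ≤ w i j) {B₁ B' : SparsityMatrix d m}
    (hB₁ : IsAccessibilityOutput A B w B₁) (hB' : B' ∈ admissible A B) :
    weightedNorm w B₁ ≤ weightedNorm w B' := by
  classical
  obtain ⟨f, hf, hfB⟩ := hB₁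
  obtain ⟨hacc, -⟩ := structurallyControllable_iff.1 hB'.2
  have hsub : ∀ i k, B' i k = true → B i k = true := fun i k h => by
    by_contra h'
    rw [hB'.1 i k (Bool.eq_false_iff.2 h')] at h
    cases h
  have hex : ∀ S : {S : Set (Fin d) // IsSourceSCC A S}, ∃ x : Fin d × Fin m,
      x.1 ∈ S.1 ∧ B' x.1 x.2 = true := fun S => by
    obtain ⟨i, hi, k, hk⟩ := hacc S.1 S.2
    exact ⟨(i, k), hi, hk⟩
  choose g hg hgB using hex
  -- A source component is determined by any of its states, so choosing one connection per component
  -- is injective.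
  have hinj : ∀ h : {S : Set (Fin d) // IsSourceSCC A S} → Fin d × Fin m,
      (∀ S, (h S).1 ∈ S.1) → Function.Injective h := by
    intro h hh S S' heq
    refine Subtype.ext ?_
    rw [S.2.eq_setOf (hh S), S'.2.eq_setOf (hh S'), heq]
  have : Fintype {S : Set (Fin d) // IsSourceSCC A S} := Fintype.ofFinite _
  have h1 : Finset.univ.filter (fun x : Fin d × Fin m => B₁ x.1 x.2 = true) =
      Finset.univ.image f := by
    ext x
    simp [hfB]
  rw [weightedNorm_eq_sum_filter, weightedNorm_eq_sum_filter, h1,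
    Finset.sum_image fun _ _ _ _ h => hinj f (fun S => (hf S).1) h]
  calc ∑ S, w (f S).1 (f S).2 ≤ ∑ S, w (g S).1 (g S).2 :=
        Finset.sum_le_sum fun S _ =>
          (connection_le ((hf S).2 _ (hg S) _) (hsub _ _ (hgB S))).2
    _ = ∑ x ∈ Finset.univ.image g, w x.1 x.2 := by
        rw [Finset.sum_image fun _ _ _ _ h => hinj g hg h]
    _ ≤ _ := by
        refine Finset.sum_le_sum_of_subset_of_nonneg ?_ ?_
        · intro x hx
          obtain ⟨S, -, rfl⟩ := Finset.mem_image.1 hx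
          simpa using hgB S
        · intro x hx _
          exact hw _ _ (hsub _ _ (by simpa using hx))

theorem IsAccessibilityOutput.le (hSC : StructurallyControllable A B) {B₁ : SparsityMatrix d m}
    (hB₁ : IsAccessibilityOutput A B w B₁) {i : Fin d} {k : Fin m} (h : B₁ i k = true) :
    B i k = true := by
  obtain ⟨f, hf, hfB⟩ := hB₁
  obtain ⟨S, hS⟩ := (hfB i k).1 h
  obtain ⟨i', hi', k', hk'⟩ := (structurallyControllable_iff.1 hSC).1 S.1 S.2
  have := (connection_le ((hf S).2 _ hi' k') hk').1
  rwa [hS] at this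

theorem exists_isAccessibilityOutput (hSC : StructurallyControllable A B)
    (w : Fin d → Fin m → ℝ) : ∃ B₁, IsAccessibilityOutput A B w B₁ := by
  classical
  have hex : ∀ S : {S : Set (Fin d) // IsSourceSCC A S}, ∃ x : Fin d × Fin m, x.1 ∈ S.1 ∧
      ∀ i ∈ S.1, ∀ k, connectionCost B w x.1 x.2 ≤ connectionCost B w i k := fun S => by
    obtain ⟨i, hi, k, -⟩ := (structurallyControllable_iff.1 hSC).1 S.1 S.2
    obtain ⟨x, hx, hmin⟩ := Set.exists_min_image {x : Fin d × Fin m | x.1 ∈ S.1}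
      (fun x => connectionCost B w x.1 x.2) (Set.toFinite _) ⟨(i, k), hi⟩
    exact ⟨x, hx, fun i hi k => hmin (i, k) hi⟩
  choose f hf using hex
  exact ⟨fun i k => decide (∃ S, f S = (i, k)), f, hf, fun i k => by simp⟩

theorem exists_isCombinedOutput (hSC : StructurallyControllable A B) (w : Fin d → Fin m → ℝ) :
    ∃ Bs, IsCombinedOutput A B w Bs := by
  classical
  obtain ⟨B₁, hB₁⟩ := exists_isAccessibilityOutput hSC w
  obtain ⟨M, hM⟩ := exists_isMCMM hSC w
  let Bt : SparsityMatrix d m := fun i k => decide ((Sum.inr k, i) ∈ M)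
  refine ⟨fun i k => decide ((B₁ i k = true ∧ ¬ AlreadyServed A Bt i) ∨ Bt i k = true),
    B₁, Bt, hB₁, ⟨M, hM, fun i k => by simp [Bt]⟩, fun i k => by simp⟩

theorem exists_solvesMinCost (hSC : StructurallyControllable A B) (w : Fin d → Fin m → ℝ) :
    ∃ Bhat, SolvesMinCost A B w Bhat := by
  obtain ⟨Bhat, h, hmin⟩ := Set.exists_min_image (admissible A B) (weightedNorm w)
    (Set.toFinite _) ⟨B, fun _ _ h => h, hSC⟩
  exact ⟨Bhat, h, hmin⟩

theorem IsMatchingOutput.le {Bt : SparsityMatrix d m} (hBt : IsMatchingOutput A B w Bt) {i : Fin d}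
    {k : Fin m} (h : Bt i k = true) : B i k = true := by
  obtain ⟨M, hM, hMB⟩ := hBt
  exact edge_of_mem hM.1.1 ((hMB i k).1 h)

/-- The matching part alone meets the matching condition of Lin's theorem. A source component is
entered either by the matching part or by its accessibility connection, which is deleted only in the
former case. -/
theorem IsCombinedOutput.mem_admissible (hSC : StructurallyControllable A B)
    {Bs : SparsityMatrix d m} (h : IsCombinedOutput A B w Bs) : Bs ∈ admissible A B := by
  obtain ⟨B₁, Bt, hB₁, hBt, hBs⟩ := h
  refine ⟨fun i j hij => Bool.eq_false_iff.2 fun h' => ?_, structurallyControllable_iff.2 ⟨?_, ?_⟩⟩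
  · have : B i j = true := by
      rcases (hBs i j).1 h' with h' | h'
      · exact hB₁.le hSC h'.1
      · exact hBt.le h'
    rw [hij] at this
    cases this
  · intro S hS
    by_cases hserved : ∃ l ∈ S, ∃ k, Bt l k = true
    · obtain ⟨l, hl, k, hk⟩ := hserved
      exact ⟨l, hl, k, (hBs l k).2 (Or.inr hk)⟩
    · obtain ⟨f, hf, hfB⟩ := hB₁
      have h1 := (hf ⟨S, hS⟩).1
      refine ⟨_, h1, _, (hBs _ _).2 (Or.inl ⟨(hfB _ _).2 ⟨⟨S, hS⟩, rfl⟩, ?_⟩)⟩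
      rintro ⟨S', hS', hi, hl⟩
      rw [hS'.eq_setOf hi, ← hS.eq_setOf h1] at hl
      exact hserved hl
  · obtain ⟨M, hM, hMB⟩ := hBt
    obtain ⟨h1, h2⟩ := (isMaximumMatching_iff hSC).1 hM.1
    obtain ⟨f, hf, hfM⟩ := h1.exists_injective h2
    refine ⟨f, hf, fun i => ?_⟩
    have h3 := edge_of_mem h1 (hfM i)
    have h4 := hfM i
    cases h : f i with
    | inl j => rwa [h] at h3
    | inr k =>
      rw [h] at h4
      exact (hBs i k).2 (Or.inr ((hMB i k).2 h4))

theorem IsCombinedOutput.weightedNorm_le (hSC : StructurallyControllable A B)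
    (hw : ∀ i j, B i j = true → 0 ≤ w i j) {Bs Bhat : SparsityMatrix d m}
    (h : IsCombinedOutput A B w Bs) (hBhat : Bhat ∈ admissible A B) :
    weightedNorm w Bs ≤ 2 * weightedNorm w Bhat := by
  obtain ⟨B₁, Bt, hB₁, hBt, hBs⟩ := h
  have h1 := hB₁.weightedNorm_le hw hBhat
  have h2 := hBt.weightedNorm_le hSC hw hBhat
  have h3 : weightedNorm w Bs ≤ weightedNorm w B₁ + weightedNorm w Bt := by
    simp only [weightedNorm, ← Finset.sum_add_distrib]
    refine Finset.sum_le_sum fun i _ => Finset.sum_le_sum fun k _ => ?_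
    have hn1 : B₁ i k = true → 0 ≤ w i k := fun h => hw i k (hB₁.le hSC h)
    have hn2 : Bt i k = true → 0 ≤ w i k := fun h => hw i k (hBt.le h)
    have := hBs i k
    by_cases e1 : B₁ i k = true <;> by_cases e2 : Bt i k = true <;> by_cases e3 : Bs i k = true <;>
      simp_all
  linarith

end Approximation

end StructuralControl

namespace StructuralControl

/-! ### Timed Hoare triples for the machine. -/

section TimedTriples

@[simp] theorem Memory.setNat_nat (s : Memory) (a i j v a' i' j' : ℕ) :
    (s.setNat a i j v).nat a' i' j' = if a' = a ∧ i' = i ∧ j' = j then v else s.nat a' i' j' := rfl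

@[simp] theorem Memory.setNat_real (s : Memory) (a i j v : ℕ) :
    (s.setNat a i j v).real = s.real := rfl

@[simp] theorem Memory.setReal_real (s : Memory) (a i j : ℕ) (v : ℝ) (a' i' j' : ℕ) :
    (s.setReal a i j v).real a' i' j' =
      if a' = a ∧ i' = i ∧ j' = j then v else s.real a' i' j' := rfl

@[simp] theorem Memory.setReal_nat (s : Memory) (a i j : ℕ) (v : ℝ) :
    (s.setReal a i j v).nat = s.nat := rfl

/-- Started in `s`, the program halts within `T` steps in a memory that satisfies `Q`. -/
def Run (p : Program) (s : Memory) (T : ℕ) (Q : Memory → Prop) : Prop :=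
  ∃ t s', Runs p s t s' ∧ t ≤ T ∧ Q s'

theorem Run.mono {p : Program} {s : Memory} {T T' : ℕ} {Q Q' : Memory → Prop} (h : Run p s T Q)
    (hT : T ≤ T') (hQ : ∀ s', Q s' → Q' s') : Run p s T' Q' := by
  obtain ⟨t, s', h1, h2, h3⟩ := h
  exact ⟨t, s', h1, h2.trans hT, hQ _ h3⟩

theorem Run.seq {p q : Program} {s : Memory} {T₁ T₂ : ℕ} {Q : Memory → Prop}
    (h : Run p s T₁ fun s₁ => Run q s₁ T₂ Q) : Run (.seq p q) s (T₁ + T₂) Q := by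
  obtain ⟨t₁, s₁, h1, ht1, t₂, s₂, h2, ht2, h3⟩ := h
  exact ⟨t₁ + t₂, s₂, .seq h1 h2, by omega, h3⟩

open Classical in
/-- The effect of a program without loops. -/
noncomputable def Program.exec : Program → Memory → Memory
  | .skip, s => s
  | .setNat a i j e, s => s.setNat a (i.eval s) (j.eval s) (e.eval s)
  | .setReal a i j e, s => s.setReal a (i.eval s) (j.eval s) (e.eval s)
  | .seq p q, s => q.exec (p.exec s)
  | .branch b p q, s => if b.eval s then p.exec s else q.exec s
  | .loop _ _, s => s

def Program.LoopFree : Program → Prop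
  | .skip => True
  | .setNat _ _ _ _ => True
  | .setReal _ _ _ _ => True
  | .seq p q => p.LoopFree ∧ q.LoopFree
  | .branch _ p q => p.LoopFree ∧ q.LoopFree
  | .loop _ _ => False

/-- A bound for the running time of a program without loops. -/
def Program.bound : Program → ℕ
  | .skip => 1
  | .setNat _ i j e => i.cost + j.cost + e.cost + 1
  | .setReal _ i j e => i.cost + j.cost + e.cost + 1
  | .seq p q => p.bound + q.bound
  | .branch b p q => b.cost + 1 + (p.bound + q.bound)
  | .loop _ _ => 0

theorem Program.LoopFree.runs {p : Program} (hp : p.LoopFree) (s : Memory) :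
    ∃ t ≤ p.bound, Runs p s t (p.exec s) := by
  induction p generalizing s with
  | skip => exact ⟨1, le_rfl, .skip s⟩
  | setNat a i j e => exact ⟨_, le_rfl, .setNat a i j e s⟩
  | setReal a i j e => exact ⟨_, le_rfl, .setReal a i j e s⟩
  | seq p q ihp ihq =>
    obtain ⟨t, ht, h⟩ := ihp hp.1 s
    obtain ⟨t', ht', h'⟩ := ihq hp.2 (p.exec s)
    exact ⟨t + t', by simp only [bound]; omega, .seq h h'⟩
  | branch b p q ihp ihq =>
    obtain ⟨t, ht, h⟩ := ihp hp.1 s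
    obtain ⟨t', ht', h'⟩ := ihq hp.2 s
    by_cases hb : b.eval s
    · refine ⟨b.cost + 1 + t, by simp only [bound]; omega, ?_⟩
      rw [exec, if_pos hb]
      exact .branchTrue hb h
    · refine ⟨b.cost + 1 + t', by simp only [bound]; omega, ?_⟩
      rw [exec, if_neg hb]
      exact .branchFalse hb h'
  | loop b p _ => exact hp.elim

theorem Run.of_loopFree {p : Program} (hp : p.LoopFree) {s : Memory} {T : ℕ} {Q : Memory → Prop}
    (hT : p.bound ≤ T) (hQ : Q (p.exec s)) : Run p s T Q := by
  obtain ⟨t, ht, h⟩ := hp.runs s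
  exact ⟨t, _, h, ht.trans hT, hQ⟩

/-- A loop-free block followed by a program. -/
theorem Run.seq_loopFree {p q : Program} (hp : p.LoopFree) {s : Memory} {T : ℕ}
    {Q : Memory → Prop} (h : Run q (p.exec s) T Q) : Run (.seq p q) s (p.bound + T) Q :=
  Run.seq (Run.of_loopFree hp le_rfl h)

/-- `I k` is the invariant after `k` rounds. The claim `k < N` under the guard serves as the
termination proof, so `N` may be any bound that the invariant implies. -/
theorem Run.loop {b : BoolExpr} {p : Program} {N T : ℕ} (I : ℕ → Memory → Prop)
    (hstep : ∀ k s, I k s → b.eval s → k < N ∧ Run p s T (I (k + 1))) {s : Memory} (h : I 0 s) :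
    Run (.loop b p) s ((N + 1) * (T + b.cost + 1)) fun s' => (∃ k, I k s') ∧ ¬ b.eval s' := by
  suffices hgen : ∀ l k s, N - k = l → I k s → Run (.loop b p) s ((l + 1) * (T + b.cost + 1))
      fun s' => (∃ k, I k s') ∧ ¬ b.eval s' from hgen N 0 s (by omega) h
  intro l
  induction l with
  | zero =>
    intro k s hl hs
    by_cases hb : b.eval s
    · exact absurd (hstep k s hs hb).1 (by omega)
    · exact ⟨_, s, .loopFalse hb, by omega, ⟨k, hs⟩, hb⟩
  | succ l ih =>
    intro k s hl hs
    by_cases hb : b.eval s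
    · obtain ⟨-, t₁, s₁, h1, ht1, h2⟩ := hstep k s hs hb
      obtain ⟨t₂, s₂, h3, ht2, h4⟩ := ih (k + 1) s₁ (by omega) h2
      refine ⟨_, s₂, .loopTrue hb h1 h3, ?_, h4⟩
      calc b.cost + 1 + t₁ + t₂ ≤ (T + b.cost + 1) + (l + 1) * (T + b.cost + 1) := by omega
        _ = _ := by ring
    · refine ⟨_, s, .loopFalse hb, ?_, ⟨k, hs⟩, hb⟩
      calc b.cost + 1 ≤ 1 * (T + b.cost + 1) := by omega
        _ ≤ _ := Nat.mul_le_mul_right _ (by omega)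

/-- Repeat `p` with the counter in cell `(0, 0)` of array `x` running through the numbers below
the value of `e`. -/
def forLoop (x : ℕ) (e : NatExpr) (p : Program) : Program :=
  .seq (.setNat x (.const 0) (.const 0) (.const 0))
    (.loop (.natLt (.get x (.const 0) (.const 0)) e)
      (.seq p (.setNat x (.const 0) (.const 0)
        (.add (.get x (.const 0) (.const 0)) (.const 1)))))

/-- The invariant for `k + 1` is required only after the counter has been advanced, so that it may
constrain the counter's array. The limit `e` is evaluated anew in each round and must keep its
value. -/
theorem Run.forLoop {x : ℕ} {e : NatExpr} {p : Program} {N T : ℕ} (I : ℕ → Memory → Prop)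
    {s : Memory} {Q : Memory → Prop} (h0 : I 0 (s.setNat x 0 0 0))
    (he : ∀ k s, I k s → e.eval s = N)
    (hstep : ∀ k s, k < N → I k s → s.nat x 0 0 = k →
      Run p s T fun s' => s'.nat x 0 0 = k ∧ I (k + 1) (s'.setNat x 0 0 (k + 1)))
    (hQ : ∀ s, I N s → Q s) :
    Run (StructuralControl.forLoop x e p) s ((N + 1) * (T + e.cost + 20)) Q := by
  let J : ℕ → Memory → Prop := fun k s => I k s ∧ s.nat x 0 0 = k ∧ k ≤ N
  have hloop := Run.loop (b := .natLt (.get x (.const 0) (.const 0)) e)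
    (p := .seq p (.setNat x (.const 0) (.const 0) (.add (.get x (.const 0) (.const 0)) (.const 1))))
    -- The 8 steps are the cost of advancing the counter.
    (N := N) (T := T + 8) J (fun k s hs hb => by
      obtain ⟨h1, h2, h3⟩ := hs
      simp only [BoolExpr.eval, NatExpr.eval, he k s h1, h2] at hb
      refine ⟨hb, Run.seq ((hstep k s hb h1 h2).mono le_rfl fun s' h => ?_)⟩
      refine Run.of_loopFree (p := .setNat x (.const 0) (.const 0)
        (.add (.get x (.const 0) (.const 0)) (.const 1))) trivial
        (by simp [Program.bound, NatExpr.cost]) ?_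
      simp only [Program.exec, NatExpr.eval, h.1]
      exact ⟨h.2, by simp, hb⟩) (s := s.setNat x 0 0 0) ⟨h0, by simp, Nat.zero_le N⟩
  refine (Run.seq (Run.of_loopFree (p := .setNat x (.const 0) (.const 0) (.const 0)) trivial le_rfl
    hloop)).mono ?_ ?_
  · simp only [Program.bound, NatExpr.cost, BoolExpr.cost]
    nlinarith [Nat.zero_le N]
  · rintro s' ⟨⟨k, h1, h2, h3⟩, h4⟩
    simp only [BoolExpr.eval, NatExpr.eval, he k s' h1, h2] at h4
    obtain rfl : k = N := by omega
    exact hQ s' h1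

end TimedTriples

end StructuralControl

namespace StructuralControl

/-! ### The Hungarian method, independent of the machine. -/

section Hungarian

/-- Rows are numbered from `1` to `d` and columns from `0` to `n - 1`, `E i j = 1` marks an edge of
cost `c i j`, and `p j` is the row matched to column `j`, or `0`. The matching `p` of the rows up
to `r` is tight for the feasible potentials `u` and `v`. -/
structure TightMatching (n d r : ℕ) (E : ℕ → ℕ → ℕ) (c : ℕ → ℕ → ℝ) (p : ℕ → ℕ) (u v : ℕ → ℝ) :
    Prop where
  feasible : ∀ i j, 1 ≤ i → i ≤ d → j < n → E i j = 1 → u i + v j ≤ c i j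
  nonpos : ∀ j < n, v j ≤ 0
  free : ∀ j < n, p j = 0 → v j = 0
  inj : ∀ j < n, ∀ j' < n, p j = p j' → p j ≠ 0 → j = j'
  range : ∀ j < n, p j ≤ r
  tight : ∀ j < n, p j ≠ 0 → E (p j) j = 1 ∧ u (p j) + v j = c (p j) j
  surj : ∀ i, 1 ≤ i → i ≤ r → ∃ j < n, p j = i

/-- A tree of alternating paths from the row `r`, which is formally matched to the column `n`.
The columns in the tree are those with `used j ≠ 0`, numbered in the order in which they were
added, and `way j` is the column before `j`; the other columns with `fin j = 1` are adjacent to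
the tree, and `minv j` is the least slack of an edge from the tree to `j`. -/
structure AlternatingTree (n d r : ℕ) (E : ℕ → ℕ → ℕ) (c : ℕ → ℕ → ℝ) (p : ℕ → ℕ)
    (used way fin : ℕ → ℕ) (u v minv : ℕ → ℝ) (k : ℕ) : Prop where
  feasible : ∀ i j, 1 ≤ i → i ≤ d → j < n → E i j = 1 → u i + v j ≤ c i j
  nonpos : ∀ j < n, v j ≤ 0
  free : ∀ j < n, p j = 0 → v j = 0
  inj : ∀ j ≤ n, ∀ j' ≤ n, p j = p j' → p j ≠ 0 → j = j'
  range : ∀ j ≤ n, p j ≤ r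
  le : r ≤ d
  rootRow : p n ≠ 0
  tight : ∀ j < n, p j ≠ 0 → E (p j) j = 1 ∧ u (p j) + v j = c (p j) j
  surj : ∀ i, 1 ≤ i → i ≤ r → ∃ j ≤ n, p j = i
  rank : ∀ j ≤ n, used j ≤ k
  card : ((Finset.range (n + 1)).filter fun j => used j ≠ 0).card = k
  root : k ≠ 0 → used n ≠ 0
  matched : ∀ j ≤ n, used j ≠ 0 → p j ≠ 0
  parent : ∀ j < n, used j ≠ 0 → way j ≤ n ∧ used (way j) ≠ 0 ∧ used (way j) < used j ∧
    E (p (way j)) j = 1 ∧ u (p (way j)) + v j = c (p (way j)) j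
  fringe : ∀ j < n, used j = 0 → fin j = 1 → way j ≤ n ∧ used (way j) ≠ 0 ∧
    E (p (way j)) j = 1 ∧ c (p (way j)) j - u (p (way j)) - v j = minv j
  slack : ∀ s ≤ n, used s ≠ 0 → ∀ j < n, used j = 0 → E (p s) j = 1 →
    fin j = 1 ∧ minv j ≤ c (p s) j - u (p s) - v j

variable {n d r : ℕ} {E : ℕ → ℕ → ℕ} {c : ℕ → ℕ → ℝ} {p p' used used' way way' fin fin' : ℕ → ℕ}
  {u u' v v' minv minv' : ℕ → ℝ} {k j₀ : ℕ}

theorem AlternatingTree.count_le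
    (h : AlternatingTree n d r E c p used way fin u v minv k) : k ≤ n + 1 := by
  rw [← h.card]
  exact (Finset.card_filter_le _ _).trans (Finset.card_range _).le

/-- A phase starts with the new row `r + 1` placed in the extra column `n`. As `n` is not a genuine
column, tightness is not demanded there, and the previous matching becomes an alternating tree
without columns. -/
theorem TightMatching.alternatingTree (h : TightMatching n d r E c p u v) (hr : r + 1 ≤ d)
    (hp : ∀ j < n, p' j = p j) (hpn : p' n = r + 1) (hused : ∀ j ≤ n, used j = 0)
    (hfin : ∀ j < n, fin j = 0) :
    AlternatingTree n d (r + 1) E c p' used way fin u v minv 0 where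
  feasible := h.feasible
  nonpos := h.nonpos
  free j hj hj' := h.free j hj (by rw [← hp j hj, hj'])
  inj := by
    have aux : ∀ j < n, p' j ≠ r + 1 := fun j hj hj' => by
      have := h.range j hj
      rw [hp j hj] at hj'
      omega
    intro j hj j' hj' h1 h2
    rcases hj.lt_or_eq with hlt | rfl <;> rcases hj'.lt_or_eq with hlt' | rfl
    · exact h.inj j hlt j' hlt' (by rw [← hp j hlt, ← hp j' hlt', h1]) (by rwa [← hp j hlt])
    · exact absurd (h1.trans hpn) (aux j hlt)
    · exact absurd (h1.symm.trans hpn) (aux j' hlt')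
    · rfl
  range j hj := by
    rcases hj.lt_or_eq with hlt | rfl
    · rw [hp j hlt]
      exact (h.range j hlt).trans (Nat.le_succ r)
    · exact hpn.le
  le := hr
  rootRow := by rw [hpn]; exact Nat.succ_ne_zero r
  tight j hj hj' := by
    rw [hp j hj] at hj' ⊢
    exact h.tight j hj hj'
  surj i hi hir := by
    rcases hir.lt_or_eq with hlt | rfl
    · obtain ⟨j, hj, hj'⟩ := h.surj i hi (by omega)
      exact ⟨j, hj.le, (hp j hj).trans hj'⟩
    · exact ⟨n, le_rfl, hpn⟩
  rank j hj := (hused j hj).le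
  card := by
    rw [Finset.card_eq_zero, Finset.filter_eq_empty_iff]
    intro j hj
    simpa using hused j (Nat.lt_succ_iff.1 (Finset.mem_range.1 hj))
  root h := absurd rfl h
  matched j hj h' := absurd (hused j hj) h'
  parent j hj h' := absurd (hused j hj.le) h'
  fringe j hj _ h' := by rw [hfin j hj] at h'; omega
  slack s hs h' := absurd (hused s hs) h'

/-- Adding the column `j₀` to the tree. -/
theorem AlternatingTree.addColumn (h : AlternatingTree n d r E c p used way fin u v minv k)
    (hj₀ : j₀ ≤ n) (hu₀ : used j₀ = 0) (hp₀ : p j₀ ≠ 0)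
    (hfr : j₀ = n ∨ (fin j₀ = 1 ∧ minv j₀ = 0)) (hk : k = 0 → j₀ = n)
    (hused : ∀ j ≤ n, used' j = if j = j₀ then k + 1 else used j) (P : ℕ → Prop)
    [DecidablePred P]
    (hP : ∀ j < n, P j ↔ (used' j = 0 ∧ E (p j₀) j = 1 ∧
      ¬ (fin j = 1 ∧ ¬ c (p j₀) j - u (p j₀) - v j < minv j)))
    (hway : ∀ j ≤ n, way' j = if j < n ∧ P j then j₀ else way j)
    (hfin : ∀ j < n, fin' j = if P j then 1 else fin j)
    (hminv : ∀ j < n, minv' j = if P j then c (p j₀) j - u (p j₀) - v j else minv j) :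
    AlternatingTree n d r E c p used' way' fin' u v minv' (k + 1) where
  feasible := h.feasible
  nonpos := h.nonpos
  free := h.free
  inj := h.inj
  range := h.range
  le := h.le
  rootRow := h.rootRow
  tight := h.tight
  surj := h.surj
  rank j hj := by
    rw [hused j hj]
    have := h.rank j hj
    split_ifs <;> omega
  card := by
    have : (Finset.range (n + 1)).filter (fun j => used' j ≠ 0) =
        insert j₀ ((Finset.range (n + 1)).filter fun j => used j ≠ 0) := by
      ext j
      simp only [Finset.mem_filter, Finset.mem_range, Finset.mem_insert]
      constructor
      · rintro ⟨hj, hj'⟩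
        rw [hused j (by omega)] at hj'
        split_ifs at hj' with h1
        · exact Or.inl h1
        · exact Or.inr ⟨hj, hj'⟩
      · rintro (rfl | ⟨hj, hj'⟩)
        · exact ⟨by omega, by rw [hused j hj₀, if_pos rfl]; omega⟩
        · refine ⟨hj, ?_⟩
          rw [hused j (by omega)]
          split_ifs <;> omega
    rw [this, Finset.card_insert_of_notMem (by simp [hu₀]), h.card]
  root _ := by
    rw [hused n le_rfl]
    split_ifs with h1
    · omega
    · exact h.root fun hk0 => h1 (hk hk0).symm
  matched j hj hj' := by
    rw [hused j hj] at hj'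
    split_ifs at hj' with h1
    · rwa [h1]
    · exact h.matched j hj hj'
  parent j hj hj' := by
    -- Relaxation concerns only columns outside the new tree, so parents within the tree are final.
    have hnP : ¬ (j < n ∧ P j) := fun hP' => hj' ((hP j hj).1 hP'.2).1
    rw [hway j hj.le, if_neg hnP]
    by_cases h1 : j = j₀
    · subst h1
      obtain ⟨hf, hm⟩ := hfr.resolve_left hj.ne
      obtain ⟨h2, h3, h4, h5⟩ := h.fringe j hj hu₀ hf
      have hne : way j ≠ j := fun he => h3 (by rw [he, hu₀])
      rw [hused _ h2, hused j hj.le, if_neg hne, if_pos rfl]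
      have := h.rank _ h2
      exact ⟨h2, h3, by omega, h4, by linarith⟩
    · rw [hused j hj.le, if_neg h1] at hj' ⊢
      obtain ⟨h2, h3, h4, h5⟩ := h.parent j hj hj'
      have hne : way j ≠ j₀ := fun he => h3 (by rw [he, hu₀])
      rw [hused _ h2, if_neg hne]
      exact ⟨h2, h3, h4, h5⟩
  fringe j hj hj' hf := by
    have hjne : j ≠ j₀ := fun he => by
      rw [he, hused j₀ hj₀, if_pos rfl] at hj'
      omega
    rw [hway j hj.le, hminv j hj]
    rw [hfin j hj] at hf
    by_cases hPj : P j
    · rw [if_pos ⟨hj, hPj⟩, if_pos hPj]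
      refine ⟨hj₀, ?_, ((hP j hj).1 hPj).2.1, rfl⟩
      rw [hused j₀ hj₀, if_pos rfl]
      omega
    · rw [if_neg hPj] at hf
      rw [if_neg fun h' => hPj h'.2, if_neg hPj]
      rw [hused j hj.le, if_neg hjne] at hj'
      obtain ⟨h2, h3, h4, h5⟩ := h.fringe j hj hj' hf
      refine ⟨h2, ?_, h4, h5⟩
      rw [hused _ h2]
      split_ifs <;> omega
  slack s hs hs' j hj hj' hE := by
    have hjne : j ≠ j₀ := fun he => by
      rw [he, hused j₀ hj₀, if_pos rfl] at hj'
      omega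
    rw [hfin j hj, hminv j hj]
    by_cases hs₀ : s = j₀
    · subst hs₀
      by_cases hPj : P j
      · rw [if_pos hPj, if_pos hPj]
        exact ⟨rfl, le_rfl⟩
      · rw [if_neg hPj, if_neg hPj]
        rw [hP j hj] at hPj
        have : fin j = 1 ∧ ¬ c (p s) j - u (p s) - v j < minv j := by
          by_contra h'
          exact hPj ⟨hj', hE, h'⟩
        exact ⟨this.1, not_lt.1 this.2⟩
    · rw [hused s hs, if_neg hs₀] at hs'
      have hj'' := hj'
      rw [hused j hj.le, if_neg hjne] at hj'
      obtain ⟨h1, h2⟩ := h.slack s hs hs' j hj hj' hE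
      by_cases hPj : P j
      · rw [if_pos hPj, if_pos hPj]
        have h3 := ((hP j hj).1 hPj).2.2
        have h4 : c (p j₀) j - u (p j₀) - v j < minv j := by
          by_contra h'
          exact h3 ⟨h1, h'⟩
        exact ⟨rfl, h4.le.trans h2⟩
      · rw [if_neg hPj, if_neg hPj]
        exact ⟨h1, h2⟩

/-- Hall's condition: a tree that cannot be extended contradicts a matching of all rows. -/
theorem AlternatingTree.exists_fringe (h : AlternatingTree n d r E c p used way fin u v minv k)
    (hk : k ≠ 0) {f : ℕ → ℕ} (hf : ∀ i, 1 ≤ i → i ≤ d → f i < n ∧ E i (f i) = 1)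
    (hfinj : ∀ i, 1 ≤ i → i ≤ d → ∀ i', 1 ≤ i' → i' ≤ d → f i = f i' → i = i') :
    ∃ j < n, used j = 0 ∧ fin j = 1 := by
  by_contra! hno
  have hrow : ∀ j ≤ n, used j ≠ 0 → 1 ≤ p j ∧ p j ≤ d := fun j hj hj' =>
    ⟨Nat.one_le_iff_ne_zero.2 (h.matched j hj hj'), (h.range j hj).trans h.le⟩
  set S := (Finset.range (n + 1)).filter fun j => used j ≠ 0 with hS
  have hmem : ∀ j, j ∈ S ↔ j ≤ n ∧ used j ≠ 0 := fun j => by simp [hS]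
  -- Without a fringe, the columns that `f` assigns to the tree rows lie in the tree. They are
  -- genuine columns, so the root column `n` is not among them, and there is one too few.
  have hmaps : ∀ j ∈ S, f (p j) ∈ S.erase n := by
    intro j hj
    obtain ⟨h1, h2⟩ := (hmem j).1 hj
    obtain ⟨h3, h4⟩ := hrow j h1 h2
    obtain ⟨h5, h6⟩ := hf _ h3 h4
    refine Finset.mem_erase.2 ⟨h5.ne, (hmem _).2 ⟨h5.le, fun h0 => ?_⟩⟩
    exact hno _ h5 h0 (h.slack j h1 h2 _ h5 h0 h6).1
  have hinj : Set.InjOn (fun j => f (p j)) (S : Set ℕ) := by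
    intro a ha b hb hab
    obtain ⟨h1, h2⟩ := (hmem a).1 ha
    obtain ⟨h3, h4⟩ := (hmem b).1 hb
    obtain ⟨h5, h6⟩ := hrow a h1 h2
    obtain ⟨h7, h8⟩ := hrow b h3 h4
    exact h.inj a h1 b h3 (hfinj _ h5 h6 _ h7 h8 hab) (h.matched a h1 h2)
  have h1 := Finset.card_le_card_of_injOn _ hmaps hinj
  have h2 := Finset.card_erase_lt_of_mem ((hmem n).2 ⟨le_rfl, h.root hk⟩)
  omega

theorem AlternatingTree.minv_nonneg (h : AlternatingTree n d r E c p used way fin u v minv k)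
    {j : ℕ} (hj : j < n) (hj' : used j = 0) (hf : fin j = 1) : 0 ≤ minv j := by
  obtain ⟨h1, h2, h3, h4⟩ := h.fringe j hj hj' hf
  have := h.feasible (p (way j)) j (Nat.one_le_iff_ne_zero.2 (h.matched _ h1 h2))
    ((h.range _ h1).trans h.le) hj h3
  linarith

/-- Changing the potentials along the tree by an amount `δ` that is at most the least slack. -/
theorem AlternatingTree.adjust (h : AlternatingTree n d r E c p used way fin u v minv k) {δ : ℝ}
    (hδ : 0 ≤ δ) (hmin : ∀ j < n, used j = 0 → fin j = 1 → δ ≤ minv j)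
    (hv : ∀ j ≤ n, v' j = if used j ≠ 0 then v j - δ else v j)
    (hu : ∀ j ≤ n, used j ≠ 0 → u' (p j) = u (p j) + δ)
    (hu' : ∀ i, (∀ j ≤ n, used j ≠ 0 → p j ≠ i) → u' i = u i)
    (hminv : ∀ j ≤ n, used j = 0 → minv' j = minv j - δ) :
    AlternatingTree n d r E c p used way fin u' v' minv' k where
  feasible i j hi hid hj hE := by
    have h0 := h.feasible i j hi hid hj hE
    rw [hv j hj.le]
    by_cases hex : ∃ s ≤ n, used s ≠ 0 ∧ p s = i
    · obtain ⟨s, hs, hs', rfl⟩ := hex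
      rw [hu s hs hs']
      by_cases hj' : used j = 0
      · rw [if_neg (not_not.2 hj')]
        obtain ⟨h1, h2⟩ := h.slack s hs hs' j hj hj' hE
        have := hmin j hj hj' h1
        linarith
      · rw [if_pos hj']
        linarith
    · push Not at hex
      rw [hu' i hex]
      split_ifs <;> linarith
  nonpos j hj := by
    have := h.nonpos j hj
    rw [hv j hj.le]
    split_ifs <;> linarith
  free j hj hj' := by
    rw [hv j hj.le, if_neg fun h' => h.matched j hj.le h' hj']
    exact h.free j hj hj'
  inj := h.inj
  range := h.range
  le := h.le
  rootRow := h.rootRow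
  tight j hj hj' := by
    obtain ⟨h1, h2⟩ := h.tight j hj hj'
    refine ⟨h1, ?_⟩
    rw [hv j hj.le]
    -- A matched column outside the tree has its row outside as well, so neither potential changes;
    -- inside the tree the changes `δ` and `-δ` cancel.
    by_cases hs : used j = 0
    · rw [if_neg (not_not.2 hs), hu' (p j), h2]
      intro s hs' hs'' he
      have := h.inj s hs' j hj.le he (h.matched s hs' hs'')
      rw [this] at hs''
      exact hs'' hs
    · rw [if_pos hs, hu j hj.le hs]
      linarith
  surj := h.surj
  rank := h.rank
  card := h.card
  root := h.root
  matched := h.matched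
  parent j hj hj' := by
    obtain ⟨h1, h2, h3, h4, h5⟩ := h.parent j hj hj'
    refine ⟨h1, h2, h3, h4, ?_⟩
    rw [hv j hj.le, if_pos hj', hu _ h1 h2]
    linarith
  fringe j hj hj' hf := by
    obtain ⟨h1, h2, h3, h4⟩ := h.fringe j hj hj' hf
    refine ⟨h1, h2, h3, ?_⟩
    rw [hv j hj.le, if_neg (not_not.2 hj'), hu _ h1 h2, hminv j hj.le hj']
    linarith
  slack s hs hs' j hj hj' hE := by
    obtain ⟨h1, h2⟩ := h.slack s hs hs' j hj hj' hE
    refine ⟨h1, ?_⟩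
    rw [hv j hj.le, if_neg (not_not.2 hj'), hu _ hs hs', hminv j hj.le hj']
    linarith

/-- The matching `p` while the alternating path that ends in the column `h` is being flipped. The
column `h` is formally free. -/
structure Flipping (n d r : ℕ) (E : ℕ → ℕ → ℕ) (c : ℕ → ℕ → ℝ) (p₀ used way : ℕ → ℕ)
    (u v : ℕ → ℝ) (p : ℕ → ℕ) (h : ℕ) : Prop where
  hole : h ≤ n
  inj : ∀ j ≤ n, ∀ j' ≤ n, j ≠ h → j' ≠ h → p j = p j' → p j ≠ 0 → j = j'
  range : ∀ j ≤ n, p j ≤ r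
  tight : ∀ j < n, j ≠ h → p j ≠ 0 → E (p j) j = 1 ∧ u (p j) + v j = c (p j) j
  free : ∀ j < n, j ≠ h → p j = 0 → v j = 0
  surj : ∀ i, 1 ≤ i → i ≤ r → ∃ j ≤ n, j ≠ h ∧ p j = i
  next : h < n → way h ≤ n ∧ used (way h) ≠ 0 ∧ (used h ≠ 0 → used (way h) < used h) ∧
    E (p₀ (way h)) h = 1 ∧ u (p₀ (way h)) + v h = c (p₀ (way h)) h
  unchanged : ∀ j ≤ n, used j ≠ 0 → (used h = 0 ∨ used j ≤ used h) → p j = p₀ j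

theorem AlternatingTree.flipping (h : AlternatingTree n d r E c p used way fin u v minv k)
    (hj₀ : j₀ ≤ n) (hu₀ : used j₀ = 0) (hp₀ : p j₀ = 0)
    (hfr : j₀ = n ∨ (fin j₀ = 1 ∧ minv j₀ = 0)) :
    Flipping n d r E c p used way u v p j₀ where
  hole := hj₀
  inj j hj j' hj' _ _ := h.inj j hj j' hj'
  range := h.range
  tight j hj _ := h.tight j hj
  free j hj _ := h.free j hj
  surj i hi hir := by
    obtain ⟨j, hj, hj'⟩ := h.surj i hi hir
    refine ⟨j, hj, ?_, hj'⟩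
    rintro rfl
    omega
  next hlt := by
    obtain ⟨h1, h2⟩ := hfr.resolve_left hlt.ne
    obtain ⟨h3, h4, h5, h6⟩ := h.fringe _ hlt hu₀ h1
    exact ⟨h3, h4, fun h' => absurd hu₀ h', h5, by linarith⟩
  unchanged _ _ _ _ := rfl

/-- The hole moves from `h` to its parent, whose row is handed to `h`. Ranks decrease towards the
root, so the parent still holds its original row and the edge to `h` is tight. -/
theorem Flipping.step {p₀ : ℕ → ℕ} {h : ℕ}
    (ht : AlternatingTree n d r E c p₀ used way fin u v minv k)
    (hF : Flipping n d r E c p₀ used way u v p h) (hlt : h < n)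
    (hp' : ∀ j ≤ n, p' j = if j = h then p (way h) else p j) :
    Flipping n d r E c p₀ used way u v p' (way h) := by
  obtain ⟨hw1, hw2, hw3, hw4, hw5⟩ := hF.next hlt
  have hne : way h ≠ h := fun he => by
    by_cases h0 : used h = 0
    · rw [he] at hw2
      exact hw2 h0
    · have := hw3 h0
      rw [he] at this
      omega
  have hpw : p (way h) = p₀ (way h) := hF.unchanged _ hw1 hw2 (by
    by_cases h0 : used h = 0
    · exact Or.inl h0
    · exact Or.inr (hw3 h0).le)
  have hpw0 : p (way h) ≠ 0 := hpw ▸ ht.matched _ hw1 hw2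
  have hp'h : p' h = p (way h) := by rw [hp' h hlt.le, if_pos rfl]
  have hp'n : ∀ j ≤ n, j ≠ h → p' j = p j := fun j hj hjh => by rw [hp' j hj, if_neg hjh]
  exact
    { hole := hw1
      inj := by
        intro j hj j' hj' hjw hjw' he h0
        by_cases e1 : j = h <;> by_cases e2 : j' = h
        · rw [e1, e2]
        · subst e1
          rw [hp'h, hp'n j' hj' e2] at he
          exact absurd (hF.inj _ hw1 j' hj' hne e2 he hpw0).symm hjw'
        · subst e2
          rw [hp'h, hp'n j hj e1] at he
          exact absurd (hF.inj _ hw1 j hj hne e1 he.symm hpw0).symm hjw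
        · rw [hp'n j hj e1, hp'n j' hj' e2] at he
          rw [hp'n j hj e1] at h0
          exact hF.inj j hj j' hj' e1 e2 he h0
      range := by
        intro j hj
        rw [hp' j hj]
        split_ifs
        · exact hF.range _ hw1
        · exact hF.range j hj
      tight := by
        intro j hj hjw h0
        by_cases e1 : j = h
        · subst e1
          rw [hp'h, hpw]
          exact ⟨hw4, hw5⟩
        · rw [hp'n j hj.le e1] at h0 ⊢
          exact hF.tight j hj e1 h0
      free := by
        intro j hj hjw h0
        by_cases e1 : j = h
        · subst e1
          rw [hp'h] at h0
          exact absurd h0 hpw0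
        · rw [hp'n j hj.le e1] at h0
          exact hF.free j hj e1 h0
      surj := by
        intro i hi hir
        obtain ⟨j, hj, hjh, hji⟩ := hF.surj i hi hir
        by_cases e1 : j = way h
        · exact ⟨h, hlt.le, hne.symm, by rw [hp'h, ← e1, hji]⟩
        · exact ⟨j, hj, e1, by rw [hp'n j hj hjh, hji]⟩
      next := by
        intro hlt'
        obtain ⟨h1, h2, h3, h4, h5⟩ := ht.parent _ hlt' hw2
        exact ⟨h1, h2, fun _ => h3, h4, h5⟩
      unchanged := by
        intro j hj hj0 hor
        have hle : used j ≤ used (way h) := hor.resolve_left hw2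
        have e1 : j ≠ h := by
          rintro rfl
          have := hw3 hj0
          omega
        rw [hp'n j hj e1]
        refine hF.unchanged j hj hj0 ?_
        by_cases h0 : used h = 0
        · exact Or.inl h0
        · exact Or.inr (hle.trans (hw3 h0).le) }

theorem Flipping.tightMatching {p₀ : ℕ → ℕ}
    (ht : AlternatingTree n d r E c p₀ used way fin u v minv k)
    (hF : Flipping n d r E c p₀ used way u v p n) : TightMatching n d r E c p u v where
  feasible := ht.feasible
  nonpos := ht.nonpos
  free j hj := hF.free j hj hj.ne
  inj j hj j' hj' := hF.inj j hj.le j' hj'.le hj.ne hj'.ne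
  range j hj := hF.range j hj.le
  tight j hj := hF.tight j hj hj.ne
  surj i hi hir := by
    obtain ⟨j, hj, hjn, hji⟩ := hF.surj i hi hir
    exact ⟨j, lt_of_le_of_ne hj hjn, hji⟩

end Hungarian

end StructuralControl

namespace StructuralControl

/-! ### Notation for programs and for the arrays they leave unchanged. -/

section ProgramNotation

/-- The cell `(0, 0)` of the array `a`. -/
def var (a : ℕ) : NatExpr := .get a (.const 0) (.const 0)

def cell (a : ℕ) (j : NatExpr) : NatExpr := .get a j (.const 0)

def realCell (a : ℕ) (j : NatExpr) : RealExpr := .get a j (.const 0)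

def setVar (a : ℕ) (e : NatExpr) : Program := .setNat a (.const 0) (.const 0) e

def setCell (a : ℕ) (j e : NatExpr) : Program := .setNat a j (.const 0) e

def setRealCell (a : ℕ) (j : NatExpr) (e : RealExpr) : Program := .setReal a j (.const 0) e

@[simp] theorem eval_var (s : Memory) (a : ℕ) : (var a).eval s = s.nat a 0 0 := rfl

@[simp] theorem eval_cell (s : Memory) (a : ℕ) (j : NatExpr) :
    (cell a j).eval s = s.nat a (j.eval s) 0 := rfl

@[simp] theorem eval_realCell (s : Memory) (a : ℕ) (j : NatExpr) :
    (realCell a j).eval s = s.real a (j.eval s) 0 := rfl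

@[simp] theorem exec_setVar (s : Memory) (a : ℕ) (e : NatExpr) :
    (setVar a e).exec s = s.setNat a 0 0 (e.eval s) := rfl

@[simp] theorem exec_setCell (s : Memory) (a : ℕ) (j e : NatExpr) :
    (setCell a j e).exec s = s.setNat a (j.eval s) 0 (e.eval s) := rfl

@[simp] theorem exec_setRealCell (s : Memory) (a : ℕ) (j : NatExpr) (e : RealExpr) :
    (setRealCell a j e).exec s = s.setReal a (j.eval s) 0 (e.eval s) := rfl

attribute [simp] NatExpr.eval RealExpr.eval BoolExpr.eval Program.exec

/-- All arrays of natural numbers outside `L` and all arrays of reals outside `L'` agree. -/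
def Memory.AgreeOff (L L' : List ℕ) (s s' : Memory) : Prop :=
  (∀ a ∉ L, s'.nat a = s.nat a) ∧ ∀ a ∉ L', s'.real a = s.real a

theorem Memory.AgreeOff.refl (L L' : List ℕ) (s : Memory) : Memory.AgreeOff L L' s s :=
  ⟨fun _ _ => rfl, fun _ _ => rfl⟩

theorem Memory.AgreeOff.trans {L L' : List ℕ} {s₁ s₂ s₃ : Memory} (h : AgreeOff L L' s₁ s₂)
    (h' : AgreeOff L L' s₂ s₃) : AgreeOff L L' s₁ s₃ :=
  ⟨fun a ha => (h'.1 a ha).trans (h.1 a ha), fun a ha => (h'.2 a ha).trans (h.2 a ha)⟩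

theorem Memory.AgreeOff.mono {L L' M M' : List ℕ} {s s' : Memory} (h : AgreeOff L L' s s')
    (hL : L ⊆ M) (hL' : L' ⊆ M') : AgreeOff M M' s s' :=
  ⟨fun a ha => h.1 a fun h' => ha (hL h'), fun a ha => h.2 a fun h' => ha (hL' h')⟩

theorem Memory.AgreeOff.setNat {L L' : List ℕ} {s s' : Memory} (h : AgreeOff L L' s s') {a : ℕ}
    (ha : a ∈ L) (i j v : ℕ) : AgreeOff L L' s (s'.setNat a i j v) := by
  refine ⟨fun b hb => ?_, h.2⟩
  rw [← h.1 b hb]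
  ext i' j'
  rw [Memory.setNat_nat, if_neg]
  rintro ⟨rfl, -⟩
  exact hb ha

theorem Memory.AgreeOff.setReal {L L' : List ℕ} {s s' : Memory} (h : AgreeOff L L' s s') {a : ℕ}
    (ha : a ∈ L') (i j : ℕ) (v : ℝ) : AgreeOff L L' s (s'.setReal a i j v) := by
  refine ⟨h.1, fun b hb => ?_⟩
  rw [← h.2 b hb]
  ext i' j'
  rw [Memory.setReal_real, if_neg]
  rintro ⟨rfl, -⟩
  exact hb ha

end ProgramNotation

/-! ### The program of the Hungarian method: relaxing edges. -/

section HungarianProgram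

/-- The slack of the edge from the row in `13` to the column in `14`. -/
def slackExpr : RealExpr :=
  .sub (.sub (.get 1 (var 13) (var 14)) (realCell 2 (var 13))) (realCell 3 (var 14))

/-- Layout of the natural number arrays: `4` edges, `5` matching `p`, `6` ranks `used`, `7` parents
`way`, `8` marks `fin`, `10` number of matched rows, `11` current column, `12` tree size, `13`
current row, `14` loop counter, `15` flag for a minimum found, `16` its column, `17` number of
columns. Layout of the real arrays: `1` costs, `2` and `3` potentials `u` and `v`, `4` least slacks
`minv`, `5` the minimum `δ`.

A slack counts as infinite while the mark in `8` is not set, which replaces a comparison with `∞`.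
-/
def relaxBody : Program :=
  .branch (.and (.natEq (cell 6 (var 14)) (.const 0))
      (.and (.natEq (.get 4 (var 13) (var 14)) (.const 1))
        (.not (.and (.natEq (cell 8 (var 14)) (.const 1))
          (.not (.realLt slackExpr (realCell 4 (var 14))))))))
    (.seq (setRealCell 4 (var 14) slackExpr)
      (.seq (setCell 7 (var 14) (var 11)) (setCell 8 (var 14) (.const 1)))) .skip

def slackAt (s : Memory) (j : ℕ) : ℝ :=
  s.real 1 (s.nat 13 0 0) j - s.real 2 (s.nat 13 0 0) 0 - s.real 3 j 0

def RelaxCond (s : Memory) (j : ℕ) : Prop :=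
  s.nat 6 j 0 = 0 ∧ s.nat 4 (s.nat 13 0 0) j = 1 ∧
    ¬ (s.nat 8 j 0 = 1 ∧ ¬ slackAt s j < s.real 4 j 0)

open Classical in
theorem run_relax {n : ℕ} {s : Memory} (hn : s.nat 17 0 0 = n) :
    Run (forLoop 14 (var 17) relaxBody) s ((n + 1) * 200) fun s' =>
      Memory.AgreeOff [7, 8, 14] [4] s s' ∧
      (∀ j, s'.nat 7 j 0 = if j < n ∧ RelaxCond s j then s.nat 11 0 0 else s.nat 7 j 0) ∧
      (∀ j, s'.nat 8 j 0 = if j < n ∧ RelaxCond s j then 1 else s.nat 8 j 0) ∧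
      (∀ j, s'.real 4 j 0 = if j < n ∧ RelaxCond s j then slackAt s j else s.real 4 j 0) := by
  refine (Run.forLoop (N := n) (T := 150) (fun k s' =>
      Memory.AgreeOff [7, 8, 14] [4] s s' ∧
      (∀ j, s'.nat 7 j 0 = if j < k ∧ RelaxCond s j then s.nat 11 0 0 else s.nat 7 j 0) ∧
      (∀ j, s'.nat 8 j 0 = if j < k ∧ RelaxCond s j then 1 else s.nat 8 j 0) ∧
      (∀ j, s'.real 4 j 0 = if j < k ∧ RelaxCond s j then slackAt s j else s.real 4 j 0))
    ?_ ?_ ?_ ?_).mono (Nat.mul_le_mul_left _ (by decide)) fun _ h => h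
  · refine ⟨(Memory.AgreeOff.refl _ _ _).setNat (by decide) _ _ _, ?_, ?_, ?_⟩ <;> simp
  · rintro k t ⟨hA, -⟩
    simp [hA.1 17 (by decide), hn]
  · rintro k t hk ⟨hA, h7, h8, h4⟩ hx
    refine Run.of_loopFree (by simp [relaxBody, Program.LoopFree, setCell, setRealCell])
      (by decide) ?_
    have e7 := h7 k
    have e8 := h8 k
    have e4 := h4 k
    simp only [lt_irrefl, false_and, if_false] at e7 e8 e4
    have hsl : slackExpr.eval t = slackAt s k := by
      simp [slackExpr, slackAt, hx, hA.1 13 (by decide), hA.2 1 (by decide), hA.2 2 (by decide),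
        hA.2 3 (by decide)]
    have hcond : (BoolExpr.and (.natEq (cell 6 (var 14)) (.const 0))
      (.and (.natEq (.get 4 (var 13) (var 14)) (.const 1))
        (.not (.and (.natEq (cell 8 (var 14)) (.const 1))
          (.not (.realLt slackExpr (realCell 4 (var 14)))))))).eval t ↔ RelaxCond s k := by
      simp [hx, RelaxCond, hsl, e8, e4, hA.1 6 (by decide), hA.1 4 (by decide),
        hA.1 13 (by decide)]
    rw [relaxBody, Program.exec]
    split_ifs with hc
    · rw [hcond] at hc
      refine ⟨by simp [hx], ?_, ?_, ?_, ?_⟩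
      · exact (((hA.setReal (by decide) _ _ _).setNat (by decide) _ _ _).setNat
          (by decide) _ _ _).setNat (by decide) _ _ _
      · intro j
        simp only [Program.exec, exec_setCell, exec_setRealCell, eval_var]
        simp [hx, h7, hA.1 11 (by decide)]
        grind
      · intro j
        simp [hx, h8]
        grind
      · intro j
        simp [hx, h4, hsl]
        grind
    · rw [hcond] at hc
      refine ⟨by simp [hx], ?_, ?_, ?_, ?_⟩
      · exact hA.setNat (by decide) _ _ _
      · intro j
        simp [h7]
        grind
      · intro j
        simp [h8]
        grind
      · intro j
        simp [h4]
        grind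
  · exact fun _ h => h

end HungarianProgram

end StructuralControl

namespace StructuralControl

/-! ### Minimum slack, change of potentials, and clearing. -/

section HungarianLoops

def findMinBody : Program :=
  .branch (.and (.natEq (cell 6 (var 14)) (.const 0))
      (.and (.natEq (cell 8 (var 14)) (.const 1))
        (.not (.and (.natEq (var 15) (.const 1))
          (.not (.realLt (realCell 4 (var 14)) (realCell 5 (.const 0))))))))
    (.seq (setRealCell 5 (.const 0) (realCell 4 (var 14)))
      (.seq (setVar 16 (var 14)) (setVar 15 (.const 1)))) .skip

theorem run_findMin {n : ℕ} {s : Memory} (hn : s.nat 17 0 0 = n) (hf : s.nat 15 0 0 = 0) :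
    Run (forLoop 14 (var 17) findMinBody) s ((n + 1) * 200) fun s' =>
      Memory.AgreeOff [14, 15, 16] [5] s s' ∧
      (∀ j < n, s.nat 6 j 0 = 0 → s.nat 8 j 0 = 1 →
        s'.nat 15 0 0 = 1 ∧ s'.real 5 0 0 ≤ s.real 4 j 0) ∧
      (s'.nat 15 0 0 = 1 → s'.nat 16 0 0 < n ∧ s.nat 6 (s'.nat 16 0 0) 0 = 0 ∧
        s.nat 8 (s'.nat 16 0 0) 0 = 1 ∧ s.real 4 (s'.nat 16 0 0) 0 = s'.real 5 0 0) := by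
  refine (Run.forLoop (N := n) (T := 150) (fun k s' =>
      Memory.AgreeOff [14, 15, 16] [5] s s' ∧
      (∀ j < k, s.nat 6 j 0 = 0 → s.nat 8 j 0 = 1 →
        s'.nat 15 0 0 = 1 ∧ s'.real 5 0 0 ≤ s.real 4 j 0) ∧
      (s'.nat 15 0 0 = 1 → s'.nat 16 0 0 < k ∧ s.nat 6 (s'.nat 16 0 0) 0 = 0 ∧
        s.nat 8 (s'.nat 16 0 0) 0 = 1 ∧ s.real 4 (s'.nat 16 0 0) 0 = s'.real 5 0 0))
    ?_ ?_ ?_ ?_).mono (Nat.mul_le_mul_left _ (by decide)) fun _ h => h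
  · refine ⟨(Memory.AgreeOff.refl _ _ _).setNat (by decide) _ _ _, ?_, ?_⟩ <;> simp [hf]
  · rintro k t ⟨hA, -⟩
    simp [hA.1 17 (by decide), hn]
  · rintro k t hk ⟨hA, h1, h2⟩ hx
    refine Run.of_loopFree (by simp [findMinBody, Program.LoopFree, setVar, setRealCell])
      (by decide) ?_
    rw [findMinBody, Program.exec]
    have e6 := hA.1 6 (by decide)
    have e8 := hA.1 8 (by decide)
    have e4 := hA.2 4 (by decide)
    split_ifs with hc
    · simp only [BoolExpr.eval, eval_cell, eval_realCell, eval_var, NatExpr.eval, hx, e6, e8, e4]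
        at hc
      refine ⟨by simp [hx], ?_, ?_, ?_⟩
      · exact (((hA.setReal (by decide) _ _ _).setNat (by decide) _ _ _).setNat
          (by decide) _ _ _).setNat (by decide) _ _ _
      · intro j hj hj6 hj8
        simp only [Program.exec, exec_setVar, exec_setRealCell]
        simp [hx, e4]
        rcases Nat.lt_succ_iff_lt_or_eq.1 hj with hlt | rfl
        · obtain ⟨h3, h4⟩ := h1 j hlt hj6 hj8
          have : s.real 4 k 0 < t.real 5 0 0 := by
            by_contra h'
            exact hc.2.2 ⟨h3, h'⟩
          exact this.le.trans h4
        · exact le_rfl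
      · intro _
        simp [hx, e4, hc.1, hc.2.1]
    · simp only [BoolExpr.eval, eval_cell, eval_realCell, eval_var, NatExpr.eval, hx, e6, e8, e4]
        at hc
      refine ⟨by simp [hx], hA.setNat (by decide) _ _ _, ?_, ?_⟩
      · intro j hj hj6 hj8
        simp only [Program.exec]
        simp
        rcases Nat.lt_succ_iff_lt_or_eq.1 hj with hlt | rfl
        · exact h1 j hlt hj6 hj8
        · by_contra h'
          exact hc ⟨hj6, hj8, fun h'' => h' ⟨h''.1, not_lt.1 h''.2⟩⟩
      · simp only [Program.exec]
        simp
        intro h3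
        obtain ⟨h4, h5⟩ := h2 h3
        exact ⟨by omega, h5⟩
  · exact fun _ h => h

/-- The slacks of unmarked columns are lowered too, which is harmless because they are overwritten
before they are read. -/
def adjustBody : Program :=
  .branch (.natEq (cell 6 (var 14)) (.const 0))
    (setRealCell 4 (var 14) (.sub (realCell 4 (var 14)) (realCell 5 (.const 0))))
    (.seq (setRealCell 2 (cell 5 (var 14))
        (.add (realCell 2 (cell 5 (var 14))) (realCell 5 (.const 0))))
      (setRealCell 3 (var 14) (.sub (realCell 3 (var 14)) (realCell 5 (.const 0)))))

open Classical in
-- Row potentials are addressed through their columns, so injectivity of the matching on the tree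
-- guarantees that none is raised twice. The loop includes column `n`, since the root row has to be
-- raised with the others.
theorem run_adjust {n : ℕ} {s : Memory} (hn : s.nat 17 0 0 = n)
    (hinj : ∀ j ≤ n, ∀ j' ≤ n, s.nat 6 j 0 ≠ 0 → s.nat 6 j' 0 ≠ 0 →
      s.nat 5 j 0 = s.nat 5 j' 0 → j = j') :
    Run (forLoop 14 (.add (var 17) (.const 1)) adjustBody) s ((n + 2) * 200) fun s' =>
      Memory.AgreeOff [14] [2, 3, 4] s s' ∧
      (∀ j ≤ n, s'.real 3 j 0 =
        if s.nat 6 j 0 ≠ 0 then s.real 3 j 0 - s.real 5 0 0 else s.real 3 j 0) ∧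
      (∀ j ≤ n, s.nat 6 j 0 = 0 → s'.real 4 j 0 = s.real 4 j 0 - s.real 5 0 0) ∧
      (∀ j ≤ n, s.nat 6 j 0 ≠ 0 →
        s'.real 2 (s.nat 5 j 0) 0 = s.real 2 (s.nat 5 j 0) 0 + s.real 5 0 0) ∧
      (∀ i, (∀ j ≤ n, s.nat 6 j 0 ≠ 0 → s.nat 5 j 0 ≠ i) → s'.real 2 i 0 = s.real 2 i 0) := by
  refine (Run.forLoop (N := n + 1) (T := 150) (fun k s' =>
      Memory.AgreeOff [14] [2, 3, 4] s s' ∧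
      (∀ j, s'.real 3 j 0 =
        if j < k ∧ s.nat 6 j 0 ≠ 0 then s.real 3 j 0 - s.real 5 0 0 else s.real 3 j 0) ∧
      (∀ j, s'.real 4 j 0 =
        if j < k ∧ s.nat 6 j 0 = 0 then s.real 4 j 0 - s.real 5 0 0 else s.real 4 j 0) ∧
      (∀ i, s'.real 2 i 0 = if ∃ j < k, s.nat 6 j 0 ≠ 0 ∧ s.nat 5 j 0 = i
        then s.real 2 i 0 + s.real 5 0 0 else s.real 2 i 0))
    ?_ ?_ ?_ ?_).mono (Nat.mul_le_mul_left _ (by decide)) fun _ h => h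
  · refine ⟨(Memory.AgreeOff.refl _ _ _).setNat (by decide) _ _ _, ?_, ?_, ?_⟩ <;> simp
  · rintro k t ⟨hA, -⟩
    simp [hA.1 17 (by decide), hn]
  · rintro k t hk ⟨hA, h3, h4, h2⟩ hx
    refine Run.of_loopFree (by simp [adjustBody, Program.LoopFree, setRealCell]) (by decide) ?_
    rw [adjustBody, Program.exec]
    have e6 := hA.1 6 (by decide)
    have e5 := hA.1 5 (by decide)
    have r5 := hA.2 5 (by decide)
    have e3 := h3 k
    have e4 := h4 k
    have e2 := h2 (s.nat 5 k 0)
    simp only [lt_irrefl, false_and, if_false] at e3 e4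
    split_ifs with hc
    · simp only [BoolExpr.eval, eval_cell, eval_var, NatExpr.eval, hx, e6] at hc
      refine ⟨by simp [hx], (hA.setReal (by decide) _ _ _).setNat (by decide) _ _ _, ?_, ?_, ?_⟩
      · intro j
        simp [h3]
        grind
      · intro j
        simp [h4, hx, r5]
        grind
      · intro i
        simp [h2]
        refine if_congr ⟨?_, ?_⟩ rfl rfl
        · rintro ⟨j, hj, h⟩
          exact ⟨j, by omega, h⟩
        · rintro ⟨j, hj, h⟩
          refine ⟨j, lt_of_le_of_ne (by omega) ?_, h⟩
          rintro rfl
          exact h.1 hc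
    · simp only [BoolExpr.eval, eval_cell, eval_var, NatExpr.eval, hx, e6] at hc
      refine ⟨by simp [hx], ((hA.setReal (by decide) _ _ _).setReal (by decide) _ _ _).setNat
        (by decide) _ _ _, ?_, ?_, ?_⟩
      · intro j
        simp [h3, hx, r5]
        grind
      · intro j
        simp [h4, hx, r5]
        grind
      · intro i
        rw [if_neg] at e2
        · simp [h2, hx, r5, e5]
          by_cases hi : i = s.nat 5 k 0
          · subst hi
            rw [if_pos rfl, ← h2, e2, if_pos ⟨k, le_rfl, hc, rfl⟩]
          · rw [if_neg hi]
            refine if_congr ⟨?_, ?_⟩ rfl rfl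
            · rintro ⟨j, hj, h⟩
              exact ⟨j, by omega, h⟩
            · rintro ⟨j, hj, h⟩
              refine ⟨j, lt_of_le_of_ne (by omega) ?_, h⟩
              rintro rfl
              exact hi h.2.symm
        · rintro ⟨j, hj, h6, h5⟩
          exact hj.ne (hinj j (by omega) k (by omega) h6 hc h5)
  · rintro t ⟨hA, h3, h4, h2⟩
    refine ⟨hA, fun j hj => ?_, fun j hj hj' => ?_, fun j hj hj' => ?_, fun i hi => ?_⟩
    · rw [h3]
      exact if_congr (and_iff_right (by omega)) rfl rfl
    · rw [h4, if_pos ⟨by omega, hj'⟩]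
    · rw [h2, if_pos ⟨j, by omega, hj', rfl⟩]
    · rw [h2, if_neg]
      rintro ⟨j, hj, hj', h⟩
      exact hi j (by omega) hj' h

/-- Parents and slacks need no clearing, since they have no meaning until a mark in `8` or a rank in
`6` is set. -/
def clearBody : Program :=
  .seq (setCell 6 (var 14) (.const 0)) (setCell 8 (var 14) (.const 0))

theorem run_clear {n : ℕ} {s : Memory} (hn : s.nat 17 0 0 = n) :
    Run (forLoop 14 (.add (var 17) (.const 1)) clearBody) s ((n + 2) * 200) fun s' =>
      Memory.AgreeOff [6, 8, 14] [] s s' ∧ ∀ j ≤ n, s'.nat 6 j 0 = 0 ∧ s'.nat 8 j 0 = 0 := by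
  refine (Run.forLoop (N := n + 1) (T := 150) (fun k s' =>
      Memory.AgreeOff [6, 8, 14] [] s s' ∧ ∀ j < k, s'.nat 6 j 0 = 0 ∧ s'.nat 8 j 0 = 0)
    ?_ ?_ ?_ ?_).mono (Nat.mul_le_mul_left _ (by decide)) fun _ h => h
  · exact ⟨(Memory.AgreeOff.refl _ _ _).setNat (by decide) _ _ _, by simp⟩
  · rintro k t ⟨hA, -⟩
    simp [hA.1 17 (by decide), hn]
  · rintro k t hk ⟨hA, h⟩ hx
    refine Run.of_loopFree (by simp [clearBody, Program.LoopFree, setCell]) (by decide) ?_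
    refine ⟨by simp [clearBody, hx], ((hA.setNat (by decide) _ _ _).setNat (by decide) _ _ _).setNat
      (by decide) _ _ _, fun j hj => ?_⟩
    simp [clearBody, hx]
    grind
  · rintro t ⟨hA, h⟩
    exact ⟨hA, fun j hj => h j (by omega)⟩

end HungarianLoops

end StructuralControl

namespace StructuralControl

/-! ### Tree growth, augmentation and phases. -/

section HungarianMain

def treeStart : Program :=
  .seq (setVar 12 (.add (var 12) (.const 1)))
    (.seq (setCell 6 (var 11) (var 12)) (setVar 13 (cell 5 (var 11))))

def treeBody : Program :=
  .seq treeStart (.seq (forLoop 14 (var 17) relaxBody) (.seq (setVar 15 (.const 0))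
    (.seq (forLoop 14 (var 17) findMinBody)
      (.seq (forLoop 14 (.add (var 17) (.const 1)) adjustBody) (setVar 11 (var 16))))))

/-- The alternating tree held in the memory. -/
def TreeAt (n d r : ℕ) (s : Memory) (k : ℕ) : Prop :=
  AlternatingTree n d r (s.nat 4) (s.real 1) (fun j => s.nat 5 j 0) (fun j => s.nat 6 j 0)
    (fun j => s.nat 7 j 0) (fun j => s.nat 8 j 0) (fun j => s.real 2 j 0) (fun j => s.real 3 j 0)
    (fun j => s.real 4 j 0) k

/-- The column in `11` is the next one to be added to the tree. -/
def HeadAt (n : ℕ) (s : Memory) (k : ℕ) : Prop :=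
  s.nat 12 0 0 = k ∧ s.nat 11 0 0 ≤ n ∧ s.nat 6 (s.nat 11 0 0) 0 = 0 ∧
    (s.nat 11 0 0 = n ∨ (s.nat 8 (s.nat 11 0 0) 0 = 1 ∧ s.real 4 (s.nat 11 0 0) 0 = 0)) ∧
    (k = 0 → s.nat 11 0 0 = n)

/-- All rows can be matched. -/
def HasRowMatching (n d : ℕ) (E : ℕ → ℕ → ℕ) : Prop :=
  ∃ f : ℕ → ℕ, (∀ i, 1 ≤ i → i ≤ d → f i < n ∧ E i (f i) = 1) ∧
    ∀ i, 1 ≤ i → i ≤ d → ∀ i', 1 ≤ i' → i' ≤ d → f i = f i' → i = i'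

/-- Subtracting the least slack makes an edge to a fringe column tight, and that column is the next
head. A fringe exists by Hall's condition. All three loops are linear in `n`, because slacks are
maintained rather than recomputed. -/
theorem run_treeBody {n d r k : ℕ} {s : Memory} (hn : s.nat 17 0 0 = n) (hT : TreeAt n d r s k)
    (hH : HeadAt n s k) (hp : s.nat 5 (s.nat 11 0 0) 0 ≠ 0) (hM : HasRowMatching n d (s.nat 4)) :
    Run treeBody s ((n + 2) * 700) fun s' =>
      Memory.AgreeOff [6, 7, 8, 11, 12, 13, 14, 15, 16] [2, 3, 4, 5] s s' ∧
      TreeAt n d r s' (k + 1) ∧ HeadAt n s' (k + 1) := by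
  classical
  obtain ⟨h12, hle, hu0, hfr, hk⟩ := hH
  refine (Run.seq_loopFree (by simp [treeStart, Program.LoopFree, setVar, setCell])
    (T := (n + 1) * 200 + (10 + ((n + 1) * 200 + ((n + 2) * 200 + 10)))) (Run.seq ?_)).mono
    (by
      have : treeStart.bound ≤ 40 := by decide
      omega) fun _ h => h
  set s₁ := treeStart.exec s with hs₁
  have A1 : Memory.AgreeOff [6, 12, 13] [] s s₁ :=
    (((Memory.AgreeOff.refl _ _ _).setNat (by decide) _ _ _).setNat (by decide) _ _ _).setNat
      (by decide) _ _ _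
  have u1 : ∀ j, s₁.nat 6 j 0 = if j = s.nat 11 0 0 then k + 1 else s.nat 6 j 0 := by
    intro j
    simp [hs₁, treeStart, h12]
  have v12 : s₁.nat 12 0 0 = k + 1 := by simp [hs₁, treeStart, h12]
  have v13 : s₁.nat 13 0 0 = s.nat 5 (s.nat 11 0 0) 0 := by simp [hs₁, treeStart]
  refine (run_relax (n := n) (by rw [A1.1 17 (by decide), hn])).mono le_rfl ?_
  rintro s₂ ⟨A2, w2, f2, m2⟩
  have A12 : Memory.AgreeOff [6, 7, 8, 11, 12, 13, 14, 15, 16] [2, 3, 4, 5] s s₂ :=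
    (A1.mono (by decide) (by decide)).trans (A2.mono (by decide) (by decide))
  have T2 : TreeAt n d r s₂ (k + 1) := by
    unfold TreeAt at hT ⊢
    rw [A12.1 4 (by decide), A12.1 5 (by decide), A12.2 1 (by decide), A2.2 2 (by decide),
      A2.2 3 (by decide), A1.2 2 (by decide), A1.2 3 (by decide)]
    have hsl : ∀ j, slackAt s₁ j = s.real 1 (s.nat 5 (s.nat 11 0 0) 0) j -
        s.real 2 (s.nat 5 (s.nat 11 0 0) 0) 0 - s.real 3 j 0 := by
      intro j
      rw [slackAt, v13, A1.2 1 (by decide), A1.2 2 (by decide), A1.2 3 (by decide)]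
    refine hT.addColumn hle hu0 hp hfr hk ?_ (RelaxCond s₁) ?_ ?_ ?_ ?_
    · intro j _
      simp only [A2.1 6 (by decide), u1]
    · intro j _
      rw [RelaxCond, hsl, v13, A1.1 4 (by decide), A1.1 8 (by decide), A1.2 4 (by decide),
        A2.1 6 (by decide)]
    · intro j _
      rw [w2, A1.1 11 (by decide), A1.1 7 (by decide)]
    · intro j hj
      rw [f2, A1.1 8 (by decide)]
      exact if_congr (and_iff_right hj) rfl rfl
    · intro j hj
      rw [m2, A1.2 4 (by decide), hsl]
      exact if_congr (and_iff_right hj) rfl rfl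
  refine (Run.seq_loopFree (by simp [Program.LoopFree, setVar]) (Run.seq ?_)).mono
    (Nat.add_le_add_right (m := 10) (by decide) _) fun _ h => h
  set s₃ := (setVar 15 (.const 0)).exec s₂ with hs₃
  have A3 : Memory.AgreeOff [15] [] s₂ s₃ := (Memory.AgreeOff.refl _ _ _).setNat (by decide) _ _ _
  have A13 : Memory.AgreeOff [6, 7, 8, 11, 12, 13, 14, 15, 16] [2, 3, 4, 5] s s₃ :=
    A12.trans (A3.mono (by decide) (by decide))
  refine (run_findMin (n := n) (by rw [A13.1 17 (by decide), hn]) (by simp [hs₃])).mono le_rfl ?_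
  rintro s₄ ⟨A4, hmin, hfound⟩
  rw [A3.1 6 (by decide), A3.1 8 (by decide), A3.2 4 (by decide)] at hmin hfound
  have A24 : Memory.AgreeOff [14, 15, 16] [5] s₂ s₄ :=
    (A3.mono (by decide) (by decide)).trans A4
  have A14 : Memory.AgreeOff [6, 7, 8, 11, 12, 13, 14, 15, 16] [2, 3, 4, 5] s s₄ :=
    A12.trans (A24.mono (by decide) (by decide))
  obtain ⟨f, hf, hfinj⟩ := hM
  have hex : s₄.nat 15 0 0 = 1 := by
    rw [← A12.1 4 (by decide)] at hf
    obtain ⟨j, hj, hj6, hj8⟩ := AlternatingTree.exists_fringe T2 (Nat.succ_ne_zero k) hf hfinj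
    exact (hmin j hj hj6 hj8).1
  obtain ⟨hj1, hj6, hj8, hjm⟩ := hfound hex
  refine Run.seq ((run_adjust (n := n) (by rw [A14.1 17 (by decide), hn]) ?_).mono le_rfl ?_)
  · rw [A24.1 6 (by decide), A24.1 5 (by decide)]
    exact fun j hj j' hj' h1 _ h2 => T2.inj j hj j' hj' h2 (T2.matched j hj h1)
  rintro s₅ ⟨A5, v3, v4, v2, v2'⟩
  rw [A24.1 6 (by decide)] at v3 v4 v2 v2'
  rw [A24.1 5 (by decide)] at v2 v2'
  rw [A24.2 4 (by decide)] at v4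
  rw [A24.2 3 (by decide)] at v3
  rw [A24.2 2 (by decide)] at v2 v2'
  have A25 : Memory.AgreeOff [14, 15, 16] [2, 3, 4, 5] s₂ s₅ :=
    (A24.mono (by decide) (by decide)).trans (A5.mono (by decide) (by decide))
  have A15 : Memory.AgreeOff [6, 7, 8, 11, 12, 13, 14, 15, 16] [2, 3, 4, 5] s s₅ :=
    A12.trans (A25.mono (by decide) (by decide))
  have T5 : TreeAt n d r s₅ (k + 1) := by
    have hδ : 0 ≤ s₄.real 5 0 0 := by
      rw [← hjm]
      exact AlternatingTree.minv_nonneg T2 hj1 hj6 hj8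
    unfold TreeAt at T2 ⊢
    rw [A25.1 4 (by decide), A25.1 5 (by decide), A25.1 6 (by decide), A25.1 7 (by decide),
      A25.1 8 (by decide), A25.2 1 (by decide)]
    exact T2.adjust hδ (fun j hj h1 h2 => (hmin j hj h1 h2).2) v3 v2 v2' v4
  refine Run.of_loopFree (by simp [Program.LoopFree, setVar]) (by decide) ?_
  rw [exec_setVar, eval_var]
  refine ⟨A15.setNat (by decide) _ _ _, T5, ?_, ?_, ?_, ?_, ?_⟩
  · simp [A25.1 12 (by decide), A2.1 12 (by decide), v12]
  · simpa [A5.1 16 (by decide)] using hj1.le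
  · simpa [A5.1 16 (by decide), A25.1 6 (by decide)] using hj6
  · refine Or.inr ⟨?_, ?_⟩
    · simpa [A5.1 16 (by decide), A25.1 8 (by decide)] using hj8
    · simp [A5.1 16 (by decide), v4 _ hj1.le hj6, hjm]
  · intro h
    omega

def flipBody : Program :=
  .seq (setCell 5 (var 11) (cell 5 (cell 7 (var 11)))) (setVar 11 (cell 7 (var 11)))

/-- The partial matching and the potentials held in the memory. -/
def MatchingAt (n d r : ℕ) (s : Memory) : Prop :=
  TightMatching n d r (s.nat 4) (s.real 1) (fun j => s.nat 5 j 0) (fun j => s.real 2 j 0)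
    (fun j => s.real 3 j 0)

/-- The rank of the hole drops at every step, which bounds the number of steps by the tree size.
Only the first hole, a free column outside the tree, has rank `0`, and the invariant treats it
separately. -/
theorem run_flip {n d r k : ℕ} {s : Memory} (hn : s.nat 17 0 0 = n) (hT : TreeAt n d r s k)
    (hH : HeadAt n s k) (hp : s.nat 5 (s.nat 11 0 0) 0 = 0) :
    Run (.loop (.not (.natEq (var 11) (var 17))) flipBody) s ((n + 2) * 200) fun s' =>
      Memory.AgreeOff [5, 11] [] s s' ∧ MatchingAt n d r s' := by
  obtain ⟨-, hle, hu0, hfr, -⟩ := hH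
  let I : ℕ → Memory → Prop := fun l t => Memory.AgreeOff [5, 11] [] s t ∧
    Flipping n d r (s.nat 4) (s.real 1) (fun j => s.nat 5 j 0) (fun j => s.nat 6 j 0)
      (fun j => s.nat 7 j 0) (fun j => s.real 2 j 0) (fun j => s.real 3 j 0)
      (fun j => t.nat 5 j 0) (t.nat 11 0 0) ∧
    ((l = 0 ∧ s.nat 6 (t.nat 11 0 0) 0 = 0) ∨
      (s.nat 6 (t.nat 11 0 0) 0 ≠ 0 ∧ s.nat 6 (t.nat 11 0 0) 0 + l ≤ k + 1))
  have hk : k ≤ n + 1 := AlternatingTree.count_le hT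
  refine (Run.loop (N := n + 3) (T := 40) I ?_
    ⟨.refl _ _ _, AlternatingTree.flipping hT hle hu0 hp hfr, Or.inl ⟨rfl, hu0⟩⟩).mono ?_ ?_
  · rintro l t ⟨A, hF, hl⟩ hb
    simp only [BoolExpr.eval, eval_var, A.1 17 (by decide), hn] at hb
    have hlt : t.nat 11 0 0 < n := lt_of_le_of_ne hF.hole hb
    obtain ⟨hw1, hw2, hw3, -⟩ := hF.next hlt
    have hrank := hT.rank _ hw1
    refine ⟨by omega, ?_⟩
    refine Run.of_loopFree (by simp [flipBody, Program.LoopFree, setVar, setCell]) (by decide) ?_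
    have e11 : (flipBody.exec t).nat 11 0 0 = s.nat 7 (t.nat 11 0 0) 0 := by
      simp [flipBody, A.1 7 (by decide)]
    refine ⟨(A.setNat (by decide) _ _ _).setNat (by decide) _ _ _, ?_, ?_⟩
    · rw [e11]
      refine Flipping.step hT hF hlt fun j _ => ?_
      simp [flipBody, A.1 7 (by decide)]
    · rw [e11]
      refine Or.inr ⟨hw2, ?_⟩
      rcases hl with ⟨rfl, h0⟩ | ⟨h0, h1⟩
      · omega
      · have := hw3 h0
        omega
  · simp only [BoolExpr.cost, var, NatExpr.cost]
    omega
  · rintro t ⟨⟨l, A, hF, -⟩, hb⟩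
    simp only [BoolExpr.eval, eval_var, A.1 17 (by decide), hn, not_not] at hb
    rw [hb] at hF
    refine ⟨A, ?_⟩
    unfold MatchingAt
    rw [A.1 4 (by decide), A.2 1 (by decide), A.2 2 (by decide), A.2 3 (by decide)]
    exact Flipping.tightMatching hT hF

def phaseStart : Program :=
  .seq (setVar 11 (var 17)) (setVar 12 (.const 0))

def phaseBody : Program :=
  .seq (setCell 5 (var 17) (.add (var 10) (.const 1)))
    (.seq (forLoop 14 (.add (var 17) (.const 1)) clearBody) (.seq phaseStart
      (.seq (.loop (.not (.natEq (cell 5 (var 11)) (.const 0))) treeBody)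
        (.loop (.not (.natEq (var 11) (var 17))) flipBody))))

theorem run_phase {n d r : ℕ} {s : Memory} (hn : s.nat 17 0 0 = n) (hr : s.nat 10 0 0 = r)
    (hrd : r < d) (hs : MatchingAt n d r s) (hM : HasRowMatching n d (s.nat 4)) :
    Run phaseBody s ((n + 2) * (n + 2) * 2000) fun s' =>
      Memory.AgreeOff [5, 6, 7, 8, 11, 12, 13, 14, 15, 16] [2, 3, 4, 5] s s' ∧
      MatchingAt n d (r + 1) s' := by
  refine (Run.seq_loopFree (by simp [Program.LoopFree, setCell]) (T := (n + 2) * 200 +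
    (20 + ((n + 3) * ((n + 2) * 700 + 20) + (n + 2) * 200))) (Run.seq ?_)).mono ?_ fun _ h => h
  swap
  · have : (setCell 5 (var 17) (.add (var 10) (.const 1))).bound ≤ 20 := by decide
    nlinarith
  set s₁ := (setCell 5 (var 17) (.add (var 10) (.const 1))).exec s with hs₁
  have A1 : Memory.AgreeOff [5] [] s s₁ := (Memory.AgreeOff.refl _ _ _).setNat (by decide) _ _ _
  refine (run_clear (n := n) (by rw [A1.1 17 (by decide), hn])).mono le_rfl ?_
  rintro s₂ ⟨A2, hclear⟩
  refine (Run.seq_loopFree (by simp [phaseStart, Program.LoopFree, setVar]) (Run.seq ?_)).mono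
    (Nat.add_le_add_right (m := 20) (by decide) _) fun _ h => h
  set s₃ := phaseStart.exec s₂ with hs₃
  have A3 : Memory.AgreeOff [11, 12] [] s₂ s₃ :=
    ((Memory.AgreeOff.refl _ _ _).setNat (by decide) _ _ _).setNat (by decide) _ _ _
  have A23 : Memory.AgreeOff [6, 8, 11, 12, 14] [] s₁ s₃ :=
    (A2.mono (by decide) (by decide)).trans (A3.mono (by decide) (by decide))
  have A13 : Memory.AgreeOff [5, 6, 8, 11, 12, 14] [] s s₃ :=
    (A1.mono (by decide) (by decide)).trans (A23.mono (by decide) (by decide))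
  have n3 : s₃.nat 17 0 0 = n := by rw [A13.1 17 (by decide), hn]
  have e11 : s₃.nat 11 0 0 = n := by
    have : s₂.nat 17 0 0 = n := by rw [A2.1 17 (by decide), A1.1 17 (by decide), hn]
    simp [hs₃, phaseStart, this]
  have T3 : TreeAt n d (r + 1) s₃ 0 := by
    unfold TreeAt
    unfold MatchingAt at hs
    rw [A13.1 4 (by decide), A13.2 1 (by decide), A13.2 2 (by decide), A13.2 3 (by decide)]
    refine hs.alternatingTree hrd ?_ ?_ ?_ ?_
    · intro j hj
      rw [A23.1 5 (by decide)]
      simp [hs₁, hn, hj.ne]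
    · rw [A23.1 5 (by decide)]
      simp [hs₁, hn, hr]
    · intro j hj
      rw [A3.1 6 (by decide)]
      exact (hclear j hj).1
    · intro j hj
      rw [A3.1 8 (by decide)]
      exact (hclear j hj.le).2
  have H3 : HeadAt n s₃ 0 := by
    refine ⟨by simp [hs₃, phaseStart], e11.le, ?_, Or.inl e11, fun _ => e11⟩
    rw [e11, A3.1 6 (by decide)]
    exact (hclear n le_rfl).1
  -- The tree has at most `n + 1` columns, the root included, so `n + 2` bounds the number of
  -- rounds.
  refine (Run.loop (N := n + 2) (T := (n + 2) * 700) (fun k t =>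
    Memory.AgreeOff [6, 7, 8, 11, 12, 13, 14, 15, 16] [2, 3, 4, 5] s₃ t ∧
      TreeAt n d (r + 1) t k ∧ HeadAt n t k) ?_ ⟨.refl _ _ _, T3, H3⟩).mono ?_ ?_
  · rintro k t ⟨A, hT, hH⟩ hb
    have hk := AlternatingTree.count_le hT
    refine ⟨by omega, (run_treeBody (by rw [A.1 17 (by decide), n3]) hT hH ?_ ?_).mono le_rfl ?_⟩
    · simpa using hb
    · rw [A.1 4 (by decide), A13.1 4 (by decide)]
      exact hM
    · rintro t' ⟨A', h⟩
      exact ⟨A.trans A', h⟩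
  · have : (BoolExpr.not (.natEq (cell 5 (var 11)) (.const 0))).cost + 1 ≤ 20 := by decide
    exact Nat.mul_le_mul_left _ (by omega)
  · rintro t ⟨⟨k, A, hT, hH⟩, hb⟩
    refine (run_flip (by rw [A.1 17 (by decide), n3]) hT hH ?_).mono le_rfl ?_
    · simpa using hb
    · rintro t' ⟨A', h⟩
      exact ⟨((A13.mono (by decide) (by decide)).trans (A.mono (by decide) (by decide))).trans
        (A'.mono (by decide) (by decide)), h⟩

def hungarian : Program := forLoop 10 (var 0) phaseBody

theorem run_hungarian {n d : ℕ} {s : Memory} (hn : s.nat 17 0 0 = n) (hd : s.nat 0 0 0 = d)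
    (hs : MatchingAt n d 0 s) (hM : HasRowMatching n d (s.nat 4)) :
    Run hungarian s ((d + 1) * ((n + 2) * (n + 2) * 2100)) fun s' =>
      Memory.AgreeOff [5, 6, 7, 8, 10, 11, 12, 13, 14, 15, 16] [2, 3, 4, 5] s s' ∧
      MatchingAt n d d s' := by
  refine (Run.forLoop (N := d) (T := (n + 2) * (n + 2) * 2000) (fun k t =>
    Memory.AgreeOff [5, 6, 7, 8, 10, 11, 12, 13, 14, 15, 16] [2, 3, 4, 5] s t ∧ MatchingAt n d k t)
    ?_ ?_ ?_ (fun _ h => h)).mono ?_ fun _ h => h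
  · exact ⟨(Memory.AgreeOff.refl _ _ _).setNat (by decide) _ _ _, hs⟩
  · rintro k t ⟨A, -⟩
    simp [A.1 0 (by decide), hd]
  · rintro k t hk ⟨A, h⟩ hx
    refine (run_phase (by rw [A.1 17 (by decide), hn]) hx hk h ?_).mono le_rfl ?_
    · rw [A.1 4 (by decide)]
      exact hM
    · rintro t' ⟨A', h'⟩
      refine ⟨by rw [A'.1 10 (by decide), hx], ?_, h'⟩
      exact (A.trans (A'.mono (by decide) (by decide))).setNat (by decide) _ _ _
  · refine Nat.mul_le_mul_left _ ?_
    have : (var 0).cost ≤ 3 := by decide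
    nlinarith

end HungarianMain

end StructuralControl

namespace StructuralControl

/-! ### Writing down the bipartite graph. -/

section CopyProgram

/-- The number of inputs. -/
def inputCount : NatExpr := .get 0 (.const 0) (.const 1)

@[simp] theorem eval_inputCount (s : Memory) : inputCount.eval s = s.nat 0 0 1 := rfl

def copyStates : Program :=
  forLoop 14 (var 0) (.setNat 4 (.add (var 18) (.const 1)) (var 14) (.get 1 (var 18) (var 14)))

theorem run_copyStates {d i : ℕ} {s : Memory} (hd : s.nat 0 0 0 = d) (hi : s.nat 18 0 0 = i) :
    Run copyStates s ((d + 1) * 60) fun s' => Memory.AgreeOff [4, 14] [] s s' ∧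
      ∀ i' j, s'.nat 4 i' j = if i' = i + 1 ∧ j < d then s.nat 1 i j else s.nat 4 i' j := by
  refine (Run.forLoop (N := d) (T := 30) (fun k t => Memory.AgreeOff [4, 14] [] s t ∧
      ∀ i' j, t.nat 4 i' j = if i' = i + 1 ∧ j < k then s.nat 1 i j else s.nat 4 i' j)
    ?_ ?_ ?_ ?_).mono (Nat.mul_le_mul_left _ (by decide)) fun _ h => h
  · exact ⟨(Memory.AgreeOff.refl _ _ _).setNat (by decide) _ _ _, by simp⟩
  · rintro k t ⟨A, -⟩
    simp [A.1 0 (by decide), hd]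
  · rintro k t hk ⟨A, h⟩ hx
    refine Run.of_loopFree (by exact trivial) (by decide) ⟨by simp [hx],
      (A.setNat (by decide) _ _ _).setNat (by decide) _ _ _, fun i' j => ?_⟩
    simp [hx, A.1 18 (by decide), A.1 1 (by decide), hi, h]
    grind
  · exact fun _ h => h

def copyInputs : Program :=
  forLoop 14 inputCount
    (.seq (.setNat 4 (.add (var 18) (.const 1)) (.add (var 0) (var 14)) (.get 2 (var 18) (var 14)))
      (.setReal 1 (.add (var 18) (.const 1)) (.add (var 0) (var 14)) (.get 0 (var 18) (var 14))))

theorem run_copyInputs {d m i : ℕ} {s : Memory} (hd : s.nat 0 0 0 = d) (hm : s.nat 0 0 1 = m)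
    (hi : s.nat 18 0 0 = i) :
    Run copyInputs s ((m + 1) * 100) fun s' => Memory.AgreeOff [4, 14] [1] s s' ∧
      (∀ i' j, s'.nat 4 i' j =
        if i' = i + 1 ∧ d ≤ j ∧ j < d + m then s.nat 2 i (j - d) else s.nat 4 i' j) ∧
      (∀ i' j, s'.real 1 i' j =
        if i' = i + 1 ∧ d ≤ j ∧ j < d + m then s.real 0 i (j - d) else s.real 1 i' j) := by
  refine (Run.forLoop (N := m) (T := 70) (fun k t => Memory.AgreeOff [4, 14] [1] s t ∧
      (∀ i' j, t.nat 4 i' j =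
        if i' = i + 1 ∧ d ≤ j ∧ j < d + k then s.nat 2 i (j - d) else s.nat 4 i' j) ∧
      (∀ i' j, t.real 1 i' j =
        if i' = i + 1 ∧ d ≤ j ∧ j < d + k then s.real 0 i (j - d) else s.real 1 i' j))
    ?_ ?_ ?_ ?_).mono (Nat.mul_le_mul_left _ (by decide)) fun _ h => h
  · refine ⟨(Memory.AgreeOff.refl _ _ _).setNat (by decide) _ _ _, fun i' j => ?_, fun i' j => ?_⟩
    · rw [if_neg (by omega)]
      simp
    · rw [if_neg (by omega)]
      simp
  · rintro k t ⟨A, -⟩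
    simp [A.1 0 (by decide), hm]
  · rintro k t hk ⟨A, h, h'⟩ hx
    refine Run.of_loopFree (by exact ⟨trivial, trivial⟩) (by decide) ⟨by simp [hx],
      ((A.setNat (by decide) _ _ _).setReal (by decide) _ _ _).setNat (by decide) _ _ _,
      fun i' j => ?_, fun i' j => ?_⟩
    · simp [hx, A.1 18 (by decide), A.1 0 (by decide), A.1 2 (by decide), hi, hd, h]
      grind
    · simp [hx, A.1 18 (by decide), A.1 0 (by decide), A.2 0 (by decide), hi, hd, h']
      grind
  · exact fun _ h => h

/-- Rows are shifted by one because `p j = 0` means unmatched; inputs become the columns from `d`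
on. State edges get their cost `0` from untouched cells. -/
def copyProgram : Program := forLoop 18 (var 0) (.seq copyStates copyInputs)

theorem run_copyProgram {d m : ℕ} {s : Memory} (hd : s.nat 0 0 0 = d) (hm : s.nat 0 0 1 = m) :
    Run copyProgram s ((d + 1) * ((d + m + 2) * 130)) fun s' =>
      Memory.AgreeOff [4, 14, 18] [1] s s' ∧ ∀ i < d,
        (∀ j < d, s'.nat 4 (i + 1) j = s.nat 1 i j ∧ s'.real 1 (i + 1) j = s.real 1 (i + 1) j) ∧
        (∀ k < m, s'.nat 4 (i + 1) (d + k) = s.nat 2 i k ∧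
          s'.real 1 (i + 1) (d + k) = s.real 0 i k) := by
  refine (Run.forLoop (N := d) (T := (d + 1) * 60 + (m + 1) * 100) (fun l t =>
      Memory.AgreeOff [4, 14, 18] [1] s t ∧
      (∀ i, l ≤ i → t.real 1 (i + 1) = s.real 1 (i + 1)) ∧ ∀ i < l,
        (∀ j < d, t.nat 4 (i + 1) j = s.nat 1 i j ∧ t.real 1 (i + 1) j = s.real 1 (i + 1) j) ∧
        (∀ k < m, t.nat 4 (i + 1) (d + k) = s.nat 2 i k ∧
          t.real 1 (i + 1) (d + k) = s.real 0 i k)) ?_ ?_ ?_ ?_).mono ?_ fun _ h => h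
  · exact ⟨(Memory.AgreeOff.refl _ _ _).setNat (by decide) _ _ _, by simp, by simp⟩
  · rintro k t ⟨A, -⟩
    simp [A.1 0 (by decide), hd]
  · rintro l t hl ⟨A, h1, h2⟩ hx
    refine Run.seq ((run_copyStates (d := d) (by rw [A.1 0 (by decide), hd]) hx).mono le_rfl ?_)
    rintro t₁ ⟨A₁, h₁⟩
    refine (run_copyInputs (d := d) (m := m) (i := l)
      (by rw [A₁.1 0 (by decide), A.1 0 (by decide), hd])
      (by rw [A₁.1 0 (by decide), A.1 0 (by decide), hm])
      (by rw [A₁.1 18 (by decide), hx])).mono le_rfl ?_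
    rintro t₂ ⟨A₂, h₂, h₂'⟩
    rw [A₁.1 2 (by decide), A.1 2 (by decide)] at h₂
    rw [A₁.2 1 (by decide), A₁.2 0 (by decide), A.2 0 (by decide)] at h₂'
    rw [A.1 1 (by decide)] at h₁
    refine ⟨by rw [A₂.1 18 (by decide), A₁.1 18 (by decide), hx], ?_, ?_, ?_⟩
    · exact ((A.trans (A₁.mono (by decide) (by decide))).trans
        (A₂.mono (by decide) (by decide))).setNat (by decide) _ _ _
    · intro i hi
      ext j
      rw [Memory.setNat_real, h₂', if_neg (by omega), h1 i (by omega)]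
    · intro i hi
      simp only [Memory.setNat_real, Memory.setNat_nat, h₂, h₂', h₁]
      have hr : i = l → t.real 1 (i + 1) = s.real 1 (i + 1) := fun h => h1 i h.ge
      rcases Nat.lt_succ_iff_lt_or_eq.1 hi with hlt | rfl
      · obtain ⟨h3, h4⟩ := h2 i hlt
        refine ⟨fun j hj => ?_, fun k hk => ?_⟩
        · simpa [hlt.ne] using h3 j hj
        · simpa [hlt.ne] using h4 k hk
      · refine ⟨fun j hj => ?_, fun k hk => ?_⟩
        · simp [hj, hr rfl, not_le.2 hj]
        · simp [hk]
  · rintro t ⟨A, -, h⟩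
    exact ⟨A, h⟩
  · refine Nat.mul_le_mul_left _ ?_
    have : (var 0).cost = 3 := rfl
    omega

end CopyProgram

/-! ### Transitive closure by Warshall's algorithm, in place of `A`. -/

section ReachProgram

def reflProgram : Program := forLoop 14 (var 0) (.setNat 1 (var 14) (var 14) (.const 1))

theorem run_reflProgram {d : ℕ} {s : Memory} (hd : s.nat 0 0 0 = d) :
    Run reflProgram s ((d + 1) * 60) fun s' => Memory.AgreeOff [1, 14] [] s s' ∧
      ∀ i j, s'.nat 1 i j = if i = j ∧ j < d then 1 else s.nat 1 i j := by
  refine (Run.forLoop (N := d) (T := 30) (fun k t => Memory.AgreeOff [1, 14] [] s t ∧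
      ∀ i j, t.nat 1 i j = if i = j ∧ j < k then 1 else s.nat 1 i j)
    ?_ ?_ ?_ ?_).mono (Nat.mul_le_mul_left _ (by decide)) fun _ h => h
  · exact ⟨(Memory.AgreeOff.refl _ _ _).setNat (by decide) _ _ _, by simp⟩
  · rintro k t ⟨A, -⟩
    simp [A.1 0 (by decide), hd]
  · rintro k t hk ⟨A, h⟩ hx
    refine Run.of_loopFree (by exact trivial) (by decide) ⟨by simp [hx],
      (A.setNat (by decide) _ _ _).setNat (by decide) _ _ _, fun i' j => ?_⟩
    simp [hx, h]
    grind
  · exact fun _ h => h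

def closureRow : Program :=
  forLoop 14 (var 0)
    (.branch (.and (.natEq (.get 1 (var 18) (var 19)) (.const 1))
        (.natEq (.get 1 (var 19) (var 14)) (.const 1)))
      (.setNat 1 (var 18) (var 14) (.const 1)) .skip)

theorem run_closureRow {d i k : ℕ} {s : Memory} (hd : s.nat 0 0 0 = d) (hi : s.nat 18 0 0 = i)
    (hk : s.nat 19 0 0 = k) :
    Run closureRow s ((d + 1) * 100) fun s' => Memory.AgreeOff [1, 14] [] s s' ∧
      ∀ i' j, s'.nat 1 i' j = if i' = i ∧ j < d ∧ s.nat 1 i k = 1 ∧ s.nat 1 k j = 1 then 1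
        else s.nat 1 i' j := by
  refine (Run.forLoop (N := d) (T := 60) (fun l t => Memory.AgreeOff [1, 14] [] s t ∧
      ∀ i' j, t.nat 1 i' j = if i' = i ∧ j < l ∧ s.nat 1 i k = 1 ∧ s.nat 1 k j = 1 then 1
        else s.nat 1 i' j)
    ?_ ?_ ?_ ?_).mono (Nat.mul_le_mul_left _ (by decide)) fun _ h => h
  · exact ⟨(Memory.AgreeOff.refl _ _ _).setNat (by decide) _ _ _, by simp⟩
  · rintro k t ⟨A, -⟩
    simp [A.1 0 (by decide), hd]
  · rintro l t hl ⟨A, h⟩ hx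
    refine Run.of_loopFree (by exact ⟨trivial, trivial⟩) (by decide) ?_
    have e1 : t.nat 1 i k = 1 ↔ s.nat 1 i k = 1 := by
      rw [h]
      split_ifs with hc
      · simp [hc.2.2.1]
      · rfl
    have e2 : t.nat 1 k l = 1 ↔ s.nat 1 k l = 1 := by
      rw [h, if_neg (by omega)]
    rw [Program.exec]
    split_ifs with hc
    · simp only [BoolExpr.eval, NatExpr.eval, eval_var, A.1 18 (by decide), A.1 19 (by decide), hi,
        hk, hx, e1, e2] at hc
      refine ⟨by simp [hx], (A.setNat (by decide) _ _ _).setNat (by decide) _ _ _,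
        fun i' j => ?_⟩
      simp [hx, h, A.1 18 (by decide), hi]
      grind
    · simp only [BoolExpr.eval, NatExpr.eval, eval_var, A.1 18 (by decide), A.1 19 (by decide), hi,
        hk, hx, e1, e2] at hc
      refine ⟨by simp [hx], A.setNat (by decide) _ _ _, fun i' j => ?_⟩
      simp [h]
      grind
  · exact fun _ h => h

def closureStep : Program := forLoop 18 (var 0) closureRow

/-- Working in place is safe: the pass with midpoint `k` creates no new ones in row `k` or column
`k`, the only entries on which its tests depend. -/
theorem run_closureStep {d k : ℕ} {s : Memory} (hd : s.nat 0 0 0 = d) (hk : s.nat 19 0 0 = k) :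
    Run closureStep s ((d + 1) * ((d + 1) * 130)) fun s' => Memory.AgreeOff [1, 14, 18] [] s s' ∧
      ∀ i j, s'.nat 1 i j = if i < d ∧ j < d ∧ s.nat 1 i k = 1 ∧ s.nat 1 k j = 1 then 1
        else s.nat 1 i j := by
  refine (Run.forLoop (N := d) (T := (d + 1) * 100) (fun l t =>
      Memory.AgreeOff [1, 14, 18] [] s t ∧
      ∀ i j, t.nat 1 i j = if i < l ∧ j < d ∧ s.nat 1 i k = 1 ∧ s.nat 1 k j = 1 then 1
        else s.nat 1 i j)
    ?_ ?_ ?_ ?_).mono (Nat.mul_le_mul_left _ ?_) fun _ h => h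
  · exact ⟨(Memory.AgreeOff.refl _ _ _).setNat (by decide) _ _ _, by simp⟩
  · rintro k t ⟨A, -⟩
    simp [A.1 0 (by decide), hd]
  · rintro l t hl ⟨A, h⟩ hx
    refine (run_closureRow (d := d) (k := k) (by rw [A.1 0 (by decide), hd]) hx
      (by rw [A.1 19 (by decide), hk])).mono le_rfl ?_
    rintro t' ⟨A', h'⟩
    refine ⟨by rw [A'.1 18 (by decide), hx], (A.trans (A'.mono (by decide) (by decide))).setNat
      (by decide) _ _ _, fun i j => ?_⟩
    have e1 : t.nat 1 l k = s.nat 1 l k := by rw [h, if_neg (by omega)]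
    have e2 : t.nat 1 k j = 1 ↔ s.nat 1 k j = 1 := by
      rw [h]
      split_ifs with hc
      · simp [hc.2.2.2]
      · rfl
    simp only [Memory.setNat_nat, h', e1, h]
    grind
  · exact fun _ h => h
  · have : (var 0).cost = 3 := rfl
    omega

def closureProgram : Program := forLoop 19 (var 0) closureStep

/-- The invariant is transitivity through midpoints below `l`, together with containment in every
transitive relation above the initial one. The latter makes the result sound for reachability. -/
theorem run_closureProgram {d : ℕ} {s : Memory} (hd : s.nat 0 0 0 = d) :
    Run closureProgram s ((d + 1) * ((d + 1) * ((d + 1) * 160))) fun s' =>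
      Memory.AgreeOff [1, 14, 18, 19] [] s s' ∧
      (∀ i j, s.nat 1 i j = 1 → s'.nat 1 i j = 1) ∧
      (∀ k < d, ∀ i < d, ∀ j < d, s'.nat 1 i k = 1 → s'.nat 1 k j = 1 → s'.nat 1 i j = 1) ∧
      ∀ R : ℕ → ℕ → Prop, (∀ i j k, R i k → R k j → R i j) → (∀ i j, s.nat 1 i j = 1 → R i j) →
        ∀ i j, s'.nat 1 i j = 1 → R i j := by
  refine (Run.forLoop (N := d) (T := (d + 1) * ((d + 1) * 130)) (fun l t =>
      Memory.AgreeOff [1, 14, 18, 19] [] s t ∧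
      (∀ i j, s.nat 1 i j = 1 → t.nat 1 i j = 1) ∧
      (∀ k < l, ∀ i < d, ∀ j < d, t.nat 1 i k = 1 → t.nat 1 k j = 1 → t.nat 1 i j = 1) ∧
      ∀ R : ℕ → ℕ → Prop, (∀ i j k, R i k → R k j → R i j) → (∀ i j, s.nat 1 i j = 1 → R i j) →
        ∀ i j, t.nat 1 i j = 1 → R i j)
    ?_ ?_ ?_ ?_).mono (Nat.mul_le_mul_left _ ?_) fun _ h => h
  · refine ⟨(Memory.AgreeOff.refl _ _ _).setNat (by decide) _ _ _, by simp, by simp, ?_⟩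
    simp
  · rintro k t ⟨A, -⟩
    simp [A.1 0 (by decide), hd]
  · rintro l t hl ⟨A, h1, h2, h3⟩ hx
    refine (run_closureStep (d := d) (by rw [A.1 0 (by decide), hd]) hx).mono le_rfl ?_
    rintro t' ⟨A', h'⟩
    have hiff : ∀ i j, t'.nat 1 i j = 1 ↔
        ((i < d ∧ j < d ∧ t.nat 1 i l = 1 ∧ t.nat 1 l j = 1) ∨ t.nat 1 i j = 1) := by
      intro i j
      rw [h']
      split_ifs with hc <;> simp [hc]
    refine ⟨by rw [A'.1 19 (by decide), hx], (A.trans (A'.mono (by decide) (by decide))).setNat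
      (by decide) _ _ _, ?_, ?_, ?_⟩
    · intro i j hij
      exact (hiff i j).2 (Or.inr (h1 i j hij))
    · intro k hk i hi j hj
      change t'.nat 1 i k = 1 → t'.nat 1 k j = 1 → t'.nat 1 i j = 1
      rw [hiff, hiff, hiff]
      rcases Nat.lt_succ_iff_lt_or_eq.1 hk with hlt | rfl
      · rintro (h4 | h4) (h5 | h5)
        · exact Or.inl ⟨hi, hj, h4.2.2.1, h5.2.2.2⟩
        · exact Or.inl ⟨hi, hj, h4.2.2.1, h2 k hlt l hl j hj h4.2.2.2 h5⟩
        · exact Or.inl ⟨hi, hj, h2 k hlt i hi l hl h4 h5.2.2.1, h5.2.2.2⟩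
        · exact Or.inr (h2 k hlt i hi j hj h4 h5)
      · rintro (h4 | h4) (h5 | h5)
        · exact Or.inl ⟨hi, hj, h4.2.2.1, h5.2.2.2⟩
        · exact Or.inl ⟨hi, hj, h4.2.2.1, h5⟩
        · exact Or.inl ⟨hi, hj, h4, h5.2.2.2⟩
        · exact Or.inl ⟨hi, hj, h4, h5⟩
    · intro R hR hs i j hij
      rcases (hiff i j).1 hij with h4 | h4
      · exact hR i j l (h3 R hR hs _ _ h4.2.2.1) (h3 R hR hs _ _ h4.2.2.2)
      · exact h3 R hR hs _ _ h4
  · exact fun _ h => h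
  · have : (var 0).cost = 3 := rfl
    nlinarith

end ReachProgram

end StructuralControl

namespace StructuralControl

/-! ### Choosing cheapest connections into unserved source components. -/

section SourceProgram

def repLoop : Program :=
  forLoop 14 (var 0) (.branch (.and (.natEq (.get 1 (var 23) (var 14)) (.const 1))
    (.not (.and (.natEq (.get 1 (var 14) (var 23)) (.const 1))
      (.not (.natLt (var 14) (var 23)))))) (setVar 20 (.const 0)) .skip)

/-- The state `v` is the smallest state of a source component. -/
def IsRep (d : ℕ) (Q : ℕ → ℕ → ℕ) (v : ℕ) : Prop :=
  ∀ u < d, Q v u = 1 → Q u v = 1 ∧ v ≤ u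

theorem run_repLoop {d v : ℕ} {s : Memory} (hd : s.nat 0 0 0 = d) (hv : s.nat 23 0 0 = v) :
    Run repLoop s ((d + 1) * 100) fun s' => Memory.AgreeOff [14, 20] [] s s' ∧
      (s'.nat 20 0 0 = 1 ↔ s.nat 20 0 0 = 1 ∧ IsRep d (s.nat 1) v) := by
  refine (Run.forLoop (N := d) (T := 60) (fun l t => Memory.AgreeOff [14, 20] [] s t ∧
      (t.nat 20 0 0 = 1 ↔ s.nat 20 0 0 = 1 ∧
        ∀ u < l, s.nat 1 v u = 1 → s.nat 1 u v = 1 ∧ v ≤ u))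
    ?_ ?_ ?_ ?_).mono (Nat.mul_le_mul_left _ (by decide)) fun _ h => h
  · exact ⟨(Memory.AgreeOff.refl _ _ _).setNat (by decide) _ _ _, by simp⟩
  · rintro k t ⟨A, -⟩
    simp [A.1 0 (by decide), hd]
  · rintro l t hl ⟨A, h⟩ hx
    refine Run.of_loopFree (by exact ⟨trivial, trivial⟩) (by decide) ?_
    rw [Program.exec]
    split_ifs with hc
    · simp only [BoolExpr.eval, NatExpr.eval, eval_var, A.1 1 (by decide), A.1 23 (by decide), hv,
        hx] at hc
      refine ⟨by simp [hx], (A.setNat (by decide) _ _ _).setNat (by decide) _ _ _, ?_⟩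
      simp only [exec_setVar, NatExpr.eval, Memory.setNat_nat]
      norm_num
      intro _
      refine ⟨l, le_rfl, hc.1, fun h1 => ?_⟩
      by_contra h'
      exact hc.2 ⟨h1, by omega⟩
    · simp only [BoolExpr.eval, NatExpr.eval, eval_var, A.1 1 (by decide), A.1 23 (by decide), hv,
        hx] at hc
      refine ⟨by simp [hx], A.setNat (by decide) _ _ _, ?_⟩
      simp only [Program.exec, Memory.setNat_nat]
      norm_num
      rw [h]
      refine and_congr_right fun _ => ⟨fun h1 u hu hq => ?_, fun h1 u hu => h1 u (by omega)⟩
      rcases Nat.lt_or_eq_of_le hu with hlt | rfl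
      · exact h1 u hlt hq
      · by_contra h'
        exact hc ⟨hq, fun h'' => h' ⟨h''.1, not_lt.1 h''.2⟩⟩
  · exact fun _ h => h

def servedLoop : Program :=
  forLoop 14 inputCount (.branch (.and (.not (.natEq (cell 5 (.add (var 0) (var 14))) (.const 0)))
    (.natEq (.get 1 (var 23) (.sub (cell 5 (.add (var 0) (var 14))) (.const 1))) (.const 1)))
    (setVar 20 (.const 0)) .skip)

/-- No matched input enters a state from which `v` can be reached. -/
def Unserved (d m : ℕ) (Q : ℕ → ℕ → ℕ) (p : ℕ → ℕ) (v : ℕ) : Prop :=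
  ∀ k < m, p (d + k) ≠ 0 → Q v (p (d + k) - 1) ≠ 1

theorem run_servedLoop {d m v : ℕ} {s : Memory} (hd : s.nat 0 0 0 = d) (hm : s.nat 0 0 1 = m)
    (hv : s.nat 23 0 0 = v) :
    Run servedLoop s ((m + 1) * 100) fun s' => Memory.AgreeOff [14, 20] [] s s' ∧
      (s'.nat 20 0 0 = 1 ↔ s.nat 20 0 0 = 1 ∧
        Unserved d m (s.nat 1) (fun j => s.nat 5 j 0) v) := by
  refine (Run.forLoop (N := m) (T := 60) (fun l t => Memory.AgreeOff [14, 20] [] s t ∧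
      (t.nat 20 0 0 = 1 ↔ s.nat 20 0 0 = 1 ∧
        ∀ k < l, s.nat 5 (d + k) 0 ≠ 0 → s.nat 1 v (s.nat 5 (d + k) 0 - 1) ≠ 1))
    ?_ ?_ ?_ ?_).mono (Nat.mul_le_mul_left _ (by decide)) fun _ h => h
  · exact ⟨(Memory.AgreeOff.refl _ _ _).setNat (by decide) _ _ _, by simp⟩
  · rintro k t ⟨A, -⟩
    simp [A.1 0 (by decide), hm]
  · rintro l t hl ⟨A, h⟩ hx
    refine Run.of_loopFree (by exact ⟨trivial, trivial⟩) (by decide) ?_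
    rw [Program.exec]
    split_ifs with hc
    · simp only [BoolExpr.eval, NatExpr.eval, eval_var, eval_cell, A.1 1 (by decide),
        A.1 23 (by decide), A.1 5 (by decide), A.1 0 (by decide), hd, hv, hx] at hc
      refine ⟨by simp [hx], (A.setNat (by decide) _ _ _).setNat (by decide) _ _ _, ?_⟩
      simp only [exec_setVar, NatExpr.eval, Memory.setNat_nat]
      norm_num
      intro _
      exact ⟨l, le_rfl, hc.1, hc.2⟩
    · simp only [BoolExpr.eval, NatExpr.eval, eval_var, eval_cell, A.1 1 (by decide),
        A.1 23 (by decide), A.1 5 (by decide), A.1 0 (by decide), hd, hv, hx] at hc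
      refine ⟨by simp [hx], A.setNat (by decide) _ _ _, ?_⟩
      simp only [Program.exec, Memory.setNat_nat]
      norm_num
      rw [h]
      refine and_congr_right fun _ => ⟨fun h1 u hu hq h2 => ?_, fun h1 u hu => h1 u (by omega)⟩
      rcases Nat.lt_or_eq_of_le hu with hlt | rfl
      · exact h1 u hlt hq h2
      · exact hc ⟨hq, h2⟩
  · exact fun _ h => h

def bestRow : Program :=
  forLoop 14 inputCount (.branch (.and (.natEq (.get 1 (var 23) (var 18)) (.const 1))
    (.and (.natEq (.get 2 (var 18) (var 14)) (.const 1))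
      (.not (.and (.natEq (var 15) (.const 1))
        (.not (.realLt (.get 0 (var 18) (var 14)) (realCell 6 (.const 0))))))))
    (.seq (setRealCell 6 (.const 0) (.get 0 (var 18) (var 14)))
      (.seq (setVar 21 (var 18)) (.seq (setVar 22 (var 14)) (setVar 15 (.const 1))))) .skip)

/-- The memory holds a cheapest one among the connections in `C`, if there are any. -/
def BestOf (C : ℕ → ℕ → Prop) (s : Memory) : Prop :=
  (∀ i k, C i k → s.nat 15 0 0 = 1 ∧ s.real 6 0 0 ≤ s.real 0 i k) ∧
  (s.nat 15 0 0 = 1 → C (s.nat 21 0 0) (s.nat 22 0 0) ∧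
    s.real 0 (s.nat 21 0 0) (s.nat 22 0 0) = s.real 6 0 0)

theorem run_bestRow {m v i : ℕ} {s : Memory} (hm : s.nat 0 0 1 = m)
    (hv : s.nat 23 0 0 = v) (hi : s.nat 18 0 0 = i) {C : ℕ → ℕ → Prop} (hC : BestOf C s) :
    Run bestRow s ((m + 1) * 150) fun s' => Memory.AgreeOff [14, 15, 21, 22] [6] s s' ∧
      BestOf (fun i' k => C i' k ∨ (i' = i ∧ k < m ∧ s.nat 1 v i = 1 ∧ s.nat 2 i k = 1)) s' := by
  refine (Run.forLoop (N := m) (T := 110) (fun l t =>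
      Memory.AgreeOff [14, 15, 21, 22] [6] s t ∧
      BestOf (fun i' k => C i' k ∨ (i' = i ∧ k < l ∧ s.nat 1 v i = 1 ∧ s.nat 2 i k = 1)) t)
    ?_ ?_ ?_ ?_).mono (Nat.mul_le_mul_left _ (by decide)) fun _ h => h
  · exact ⟨(Memory.AgreeOff.refl _ _ _).setNat (by decide) _ _ _, by simpa [BestOf] using hC⟩
  · rintro k t ⟨A, -⟩
    simp [A.1 0 (by decide), hm]
  · rintro l t hl ⟨A, h1, h2⟩ hx
    refine Run.of_loopFree
      (by exact ⟨⟨trivial, trivial, trivial, trivial⟩, trivial⟩) (by decide) ?_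
    rw [Program.exec]
    have e0 := A.2 0 (by decide)
    split_ifs with hc
    · simp only [BoolExpr.eval, NatExpr.eval, RealExpr.eval, eval_var, eval_realCell,
        A.1 1 (by decide), A.1 23 (by decide), A.1 18 (by decide), A.1 2 (by decide), e0, hi, hv,
        hx] at hc
      refine ⟨by simp [hx], ((((A.setReal (by decide) _ _ _).setNat (by decide) _ _ _).setNat
        (by decide) _ _ _).setNat (by decide) _ _ _).setNat (by decide) _ _ _, ?_, ?_⟩
      · intro i' k hk
        simp [hx, A.1 18 (by decide), hi, e0]
        have hlt : t.nat 15 0 0 = 1 → s.real 0 i l < t.real 6 0 0 := fun h' => by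
          by_contra h''
          exact hc.2.2 ⟨h', h''⟩
        have hold : (C i' k ∨ (i' = i ∧ k < l ∧ s.nat 1 v i = 1 ∧ s.nat 2 i k = 1)) →
            s.real 0 i l ≤ s.real 0 i' k := fun hk' => by
          obtain ⟨h3, h4⟩ := h1 i' k hk'
          rw [e0] at h4
          exact (hlt h3).le.trans h4
        rcases hk with hk | ⟨rfl, hk, hk'⟩
        · exact hold (Or.inl hk)
        · rcases Nat.lt_succ_iff_lt_or_eq.1 hk with hlt' | rfl
          · exact hold (Or.inr ⟨rfl, hlt', hk'⟩)
          · exact le_rfl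
      · intro _
        simp [hx, A.1 18 (by decide), hi, e0]
        exact Or.inr ⟨hc.1, hc.2.1⟩
    · simp only [BoolExpr.eval, NatExpr.eval, RealExpr.eval, eval_var, eval_realCell,
        A.1 1 (by decide), A.1 23 (by decide), A.1 18 (by decide), A.1 2 (by decide), e0, hi, hv,
        hx] at hc
      refine ⟨by simp [hx], A.setNat (by decide) _ _ _, ?_, ?_⟩
      · intro i' k hk
        simp only [Program.exec]
        simp [e0]
        rcases hk with hk | ⟨rfl, hk, hk'⟩
        · simpa [e0] using h1 i' k (Or.inl hk)
        · rcases Nat.lt_succ_iff_lt_or_eq.1 hk with hlt' | rfl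
          · simpa [e0] using h1 i' k (Or.inr ⟨rfl, hlt', hk'⟩)
          · by_contra h'
            exact hc ⟨hk'.1, hk'.2, fun h'' => h' ⟨h''.1, not_lt.1 h''.2⟩⟩
      · simp only [Program.exec]
        simp
        intro h3
        obtain ⟨h4, h5⟩ := h2 h3
        refine ⟨h4.imp_right fun h => ⟨h.1, by omega, h.2.2⟩, h5⟩
  · exact fun _ h => h

def bestLoop : Program := forLoop 18 (var 0) bestRow

theorem run_bestLoop {d m v : ℕ} {s : Memory} (hd : s.nat 0 0 0 = d) (hm : s.nat 0 0 1 = m)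
    (hv : s.nat 23 0 0 = v) (hf : s.nat 15 0 0 = 0) :
    Run bestLoop s ((d + 1) * ((m + 1) * 180)) fun s' =>
      Memory.AgreeOff [14, 15, 18, 21, 22] [6] s s' ∧
      BestOf (fun i k => i < d ∧ k < m ∧ s.nat 1 v i = 1 ∧ s.nat 2 i k = 1) s' := by
  refine (Run.forLoop (N := d) (T := (m + 1) * 150) (fun l t =>
      Memory.AgreeOff [14, 15, 18, 21, 22] [6] s t ∧
      BestOf (fun i k => i < l ∧ k < m ∧ s.nat 1 v i = 1 ∧ s.nat 2 i k = 1) t)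
    ?_ ?_ ?_ ?_).mono (Nat.mul_le_mul_left _ ?_) fun _ h => h
  · exact ⟨(Memory.AgreeOff.refl _ _ _).setNat (by decide) _ _ _, by simp [BestOf, hf]⟩
  · rintro k t ⟨A, -⟩
    simp [A.1 0 (by decide), hd]
  · rintro l t hl ⟨A, h⟩ hx
    refine (run_bestRow (m := m) (by rw [A.1 0 (by decide), hm]) (by rw [A.1 23 (by decide), hv]) hx
      h).mono le_rfl ?_
    rintro t' ⟨A', h'⟩
    refine ⟨by rw [A'.1 18 (by decide), hx], (A.trans (A'.mono (by decide) (by decide))).setNat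
      (by decide) _ _ _, ?_⟩
    rw [A.1 1 (by decide), A.1 2 (by decide)] at h'
    have heq : (fun i k => i < l + 1 ∧ k < m ∧ s.nat 1 v i = 1 ∧ s.nat 2 i k = 1) =
        fun i k => (i < l ∧ k < m ∧ s.nat 1 v i = 1 ∧ s.nat 2 i k = 1) ∨
          (i = l ∧ k < m ∧ s.nat 1 v l = 1 ∧ s.nat 2 l k = 1) := by
      ext i k
      constructor
      · rintro ⟨h1, h2⟩
        rcases Nat.lt_succ_iff_lt_or_eq.1 h1 with h3 | rfl
        · exact Or.inl ⟨h3, h2⟩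
        · exact Or.inr ⟨rfl, h2⟩
      · rintro (⟨h1, h2⟩ | ⟨rfl, h2⟩)
        · exact ⟨by omega, h2⟩
        · exact ⟨by omega, h2⟩
    rw [heq]
    simpa [BestOf] using h'
  · exact fun _ h => h
  · have : (var 0).cost = 3 := rfl
    omega

/-- The connection `(i, k)` is a cheapest one into the states from which `v` can be reached. -/
def IsBest (d m : ℕ) (Q B : ℕ → ℕ → ℕ) (w : ℕ → ℕ → ℝ) (v : ℕ) (x : ℕ × ℕ) : Prop :=
  (x.1 < d ∧ x.2 < m ∧ Q v x.1 = 1 ∧ B x.1 x.2 = 1) ∧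
  ∀ i < d, ∀ k < m, Q v i = 1 → B i k = 1 → w x.1 x.2 ≤ w i k

def sourceBody : Program :=
  .seq (setVar 20 (.const 1)) (.seq repLoop (.seq servedLoop (.seq (setVar 15 (.const 0))
    (.seq bestLoop (.branch (.natEq (var 20) (.const 1))
      (.setNat 3 (var 21) (var 22) (.const 1)) .skip)))))

def Selected (d m : ℕ) (Q : ℕ → ℕ → ℕ) (p : ℕ → ℕ) (v : ℕ) : Prop :=
  IsRep d Q v ∧ Unserved d m Q p v

open Classical in
-- A cheapest connection is searched for every `v`, but recorded only if `v` represents an unserved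
-- source component. Nothing is claimed about `x` otherwise, so an arbitrary value may serve there.
theorem run_sourceBody {d m v : ℕ} {s : Memory} (hd : s.nat 0 0 0 = d) (hm : s.nat 0 0 1 = m)
    (hv : s.nat 23 0 0 = v) (hex : IsRep d (s.nat 1) v →
      ∃ i < d, ∃ k < m, s.nat 1 v i = 1 ∧ s.nat 2 i k = 1) :
    Run sourceBody s ((d + 1) * ((m + 1) * 500)) fun s' =>
      Memory.AgreeOff [3, 14, 15, 18, 20, 21, 22] [6] s s' ∧
      ∃ x, (Selected d m (s.nat 1) (fun j => s.nat 5 j 0) v →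
          IsBest d m (s.nat 1) (s.nat 2) (s.real 0) v x) ∧
        ∀ i k, s'.nat 3 i k =
          if Selected d m (s.nat 1) (fun j => s.nat 5 j 0) v ∧ x = (i, k) then 1
          else s.nat 3 i k := by
  refine (Run.seq_loopFree (by simp [Program.LoopFree, setVar]) (T := (d + 1) * 100 +
    ((m + 1) * 100 + (10 + ((d + 1) * ((m + 1) * 180) + 20)))) (Run.seq ?_)).mono ?_ fun _ h => h
  swap
  · have : (setVar 20 (.const 1)).bound = 4 := rfl
    nlinarith
  set s₁ := (setVar 20 (.const 1)).exec s with hs₁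
  have A1 : Memory.AgreeOff [20] [] s s₁ := (Memory.AgreeOff.refl _ _ _).setNat (by decide) _ _ _
  refine (run_repLoop (d := d) (v := v) (by rw [A1.1 0 (by decide), hd])
    (by rw [A1.1 23 (by decide), hv])).mono le_rfl ?_
  rintro s₂ ⟨A2, h2⟩
  have A12 : Memory.AgreeOff [14, 20] [] s s₂ := (A1.mono (by decide) (by decide)).trans A2
  refine Run.seq ((run_servedLoop (d := d) (m := m) (v := v) (by rw [A12.1 0 (by decide), hd])
    (by rw [A12.1 0 (by decide), hm]) (by rw [A12.1 23 (by decide), hv])).mono le_rfl ?_)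
  rintro s₃ ⟨A3, h3⟩
  have A13 : Memory.AgreeOff [14, 20] [] s s₃ := A12.trans A3
  have hsel : s₃.nat 20 0 0 = 1 ↔ Selected d m (s.nat 1) (fun j => s.nat 5 j 0) v := by
    rw [h3, h2, A1.1 1 (by decide), A12.1 1 (by decide), A12.1 5 (by decide)]
    simp [hs₁, Selected]
  refine (Run.seq_loopFree (by simp [Program.LoopFree, setVar]) (Run.seq ?_)).mono
    (Nat.add_le_add_right (m := 10) (by decide) _) fun _ h => h
  set s₄ := (setVar 15 (.const 0)).exec s₃ with hs₄
  have A34 : Memory.AgreeOff [15] [] s₃ s₄ := (Memory.AgreeOff.refl _ _ _).setNat (by decide) _ _ _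
  have A14 : Memory.AgreeOff [14, 15, 20] [] s s₄ :=
    (A13.mono (by decide) (by decide)).trans (A34.mono (by decide) (by decide))
  refine (run_bestLoop (d := d) (m := m) (v := v) (by rw [A14.1 0 (by decide), hd])
    (by rw [A14.1 0 (by decide), hm]) (by rw [A14.1 23 (by decide), hv])
    (by simp [hs₄])).mono le_rfl ?_
  rintro s₅ ⟨A5, h5, h5'⟩
  rw [A14.1 1 (by decide), A14.1 2 (by decide)] at h5 h5'
  rw [A5.2 0 (by decide), A14.2 0 (by decide)] at h5 h5'
  have hsel5 : s₅.nat 20 0 0 = 1 ↔ Selected d m (s.nat 1) (fun j => s.nat 5 j 0) v := by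
    rw [A5.1 20 (by decide), A34.1 20 (by decide), hsel]
  have A15 : Memory.AgreeOff [3, 14, 15, 18, 20, 21, 22] [6] s s₅ :=
    (A14.mono (by decide) (by decide)).trans (A5.mono (by decide) (by decide))
  have e3 : s₅.nat 3 = s.nat 3 := by rw [A5.1 3 (by decide), A14.1 3 (by decide)]
  refine Run.of_loopFree (by exact ⟨trivial, trivial⟩) (by decide) ?_
  rw [Program.exec]
  split_ifs with hc
  · have hS := hsel5.1 (by simpa using hc)
    refine ⟨A15.setNat (by decide) _ _ _, (s₅.nat 21 0 0, s₅.nat 22 0 0), fun _ => ?_, ?_⟩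
    · obtain ⟨i, hi, k, hk, hik⟩ := hex hS.1
      have hfound := (h5 i k ⟨hi, hk, hik⟩).1
      obtain ⟨h6, h7⟩ := h5' hfound
      refine ⟨h6, fun i' hi' k' hk' h8 h9 => ?_⟩
      rw [h7]
      exact (h5 i' k' ⟨hi', hk', h8, h9⟩).2
    · intro i k
      simp [hS, e3]
      grind
  · have hS : ¬ Selected d m (s.nat 1) (fun j => s.nat 5 j 0) v := fun h => hc (by
      simpa using hsel5.2 h)
    exact ⟨A15, (0, 0), fun h => absurd h hS, fun i k => by simp [hS, e3]⟩

def sourceProgram : Program := forLoop 23 (var 0) sourceBody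

open Classical in
theorem run_sourceProgram {d m : ℕ} {s : Memory} (hd : s.nat 0 0 0 = d) (hm : s.nat 0 0 1 = m)
    (hex : ∀ v < d, IsRep d (s.nat 1) v →
      ∃ i < d, ∃ k < m, s.nat 1 v i = 1 ∧ s.nat 2 i k = 1) :
    Run sourceProgram s ((d + 1) * ((d + 1) * ((m + 1) * 530))) fun s' =>
      Memory.AgreeOff [3, 14, 15, 18, 20, 21, 22, 23] [6] s s' ∧
      ∃ b : ℕ → ℕ × ℕ, (∀ v < d, Selected d m (s.nat 1) (fun j => s.nat 5 j 0) v →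
          IsBest d m (s.nat 1) (s.nat 2) (s.real 0) v (b v)) ∧
        ∀ i k, s'.nat 3 i k =
          if ∃ v < d, Selected d m (s.nat 1) (fun j => s.nat 5 j 0) v ∧ b v = (i, k) then 1
          else s.nat 3 i k := by
  refine (Run.forLoop (N := d) (T := (d + 1) * ((m + 1) * 500)) (fun l t =>
      Memory.AgreeOff [3, 14, 15, 18, 20, 21, 22, 23] [6] s t ∧
      ∃ b : ℕ → ℕ × ℕ, (∀ v < l, Selected d m (s.nat 1) (fun j => s.nat 5 j 0) v →
          IsBest d m (s.nat 1) (s.nat 2) (s.real 0) v (b v)) ∧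
        ∀ i k, t.nat 3 i k =
          if ∃ v < l, Selected d m (s.nat 1) (fun j => s.nat 5 j 0) v ∧ b v = (i, k) then 1
          else s.nat 3 i k)
    ?_ ?_ ?_ ?_).mono (Nat.mul_le_mul_left _ ?_) fun _ h => h
  · exact ⟨(Memory.AgreeOff.refl _ _ _).setNat (by decide) _ _ _, fun _ => (0, 0), by simp, by simp⟩
  · rintro k t ⟨A, -⟩
    simp [A.1 0 (by decide), hd]
  · rintro l t hl ⟨A, b, hb, h⟩ hx
    refine (run_sourceBody (d := d) (m := m) (by rw [A.1 0 (by decide), hd])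
      (by rw [A.1 0 (by decide), hm]) hx ?_).mono le_rfl ?_
    · rw [A.1 1 (by decide), A.1 2 (by decide)]
      exact hex l hl
    rintro t' ⟨A', x, hxb, h'⟩
    rw [A.1 1 (by decide), A.1 2 (by decide), A.1 5 (by decide), A.2 0 (by decide)] at hxb
    simp only [A.1 1 (by decide), A.1 5 (by decide), h] at h'
    refine ⟨by rw [A'.1 23 (by decide), hx], (A.trans (A'.mono (by decide) (by decide))).setNat
      (by decide) _ _ _, fun v => if v = l then x else b v, ?_, ?_⟩
    · intro v hv hS
      rcases Nat.lt_succ_iff_lt_or_eq.1 hv with hlt | rfl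
      · simpa [hlt.ne] using hb v hlt hS
      · simpa using hxb hS
    · intro i k
      simp only [Memory.setNat_nat, h']
      by_cases h1 : Selected d m (s.nat 1) (fun j => s.nat 5 j 0) l ∧ x = (i, k)
      · rw [if_neg (by simp), if_pos h1, if_pos ⟨l, by omega, h1.1, by simpa using h1.2⟩]
      · rw [if_neg (by simp), if_neg h1]
        refine if_congr ⟨?_, ?_⟩ rfl rfl
        · rintro ⟨v, hv, hv'⟩
          exact ⟨v, by omega, by simpa [hv.ne] using hv'⟩
        · rintro ⟨v, hv, hv'⟩
          rcases Nat.lt_succ_iff_lt_or_eq.1 hv with hlt | rfl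
          · exact ⟨v, hlt, by simpa [hlt.ne] using hv'⟩
          · exact absurd (by simpa using hv') h1
  · exact fun _ h => h
  · have : (var 0).cost = 3 := rfl
    nlinarith

def writeProgram : Program :=
  forLoop 14 inputCount (.branch (.natEq (cell 5 (.add (var 0) (var 14))) (.const 0)) .skip
    (.setNat 3 (.sub (cell 5 (.add (var 0) (var 14))) (.const 1)) (var 14) (.const 1)))

theorem run_writeProgram {d m : ℕ} {s : Memory} (hd : s.nat 0 0 0 = d) (hm : s.nat 0 0 1 = m) :
    Run writeProgram s ((m + 1) * 100) fun s' =>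
      ∀ i k, s'.nat 3 i k = if k < m ∧ s.nat 5 (d + k) 0 = i + 1 then 1 else s.nat 3 i k := by
  refine (Run.forLoop (N := m) (T := 60) (fun l t => Memory.AgreeOff [3, 14] [] s t ∧
      ∀ i k, t.nat 3 i k = if k < l ∧ s.nat 5 (d + k) 0 = i + 1 then 1 else s.nat 3 i k)
    ?_ ?_ ?_ ?_).mono (Nat.mul_le_mul_left _ (by decide)) fun _ h => h
  · exact ⟨(Memory.AgreeOff.refl _ _ _).setNat (by decide) _ _ _, by simp⟩
  · rintro k t ⟨A, -⟩
    simp [A.1 0 (by decide), hm]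
  · rintro l t hl ⟨A, h⟩ hx
    refine Run.of_loopFree (by exact ⟨trivial, trivial⟩) (by decide) ?_
    rw [Program.exec]
    split_ifs with hc
    · simp only [BoolExpr.eval, NatExpr.eval, eval_var, eval_cell, A.1 5 (by decide),
        A.1 0 (by decide), hd, hx] at hc
      refine ⟨by simp [hx], A.setNat (by decide) _ _ _, fun i k => ?_⟩
      simp [h]
      grind
    · simp only [BoolExpr.eval, NatExpr.eval, eval_var, eval_cell, A.1 5 (by decide),
        A.1 0 (by decide), hd, hx] at hc
      refine ⟨by simp [hx], (A.setNat (by decide) _ _ _).setNat (by decide) _ _ _, fun i k => ?_⟩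
      simp [h, hx, A.1 5 (by decide), A.1 0 (by decide), hd]
      grind
  · exact fun _ h => h.2

end SourceProgram

end StructuralControl

namespace StructuralControl

/-! ### The computed cells describe an output of Algorithm 3. -/

section Correctness

variable {d m : ℕ} {A : SparsityMatrix d d} {B : SparsityMatrix d m} {w : Fin d → Fin m → ℝ}

/-- The column of a left vertex of the bipartite graph. -/
def column (x : Fin d ⊕ Fin m) : ℕ := finSumFinEquiv x

@[simp] theorem column_inl (j : Fin d) : column (m := m) (Sum.inl j) = j := by simp [column]

@[simp] theorem column_inr (k : Fin m) : column (d := d) (Sum.inr k) = d + k := by simp [column]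

theorem column_lt (x : Fin d ⊕ Fin m) : column x < d + m := (finSumFinEquiv x).2

theorem column_injective : Function.Injective (column : Fin d ⊕ Fin m → ℕ) := fun _ _ h =>
  finSumFinEquiv.injective (Fin.ext h)

theorem exists_column {j : ℕ} (hj : j < d + m) : ∃ x : Fin d ⊕ Fin m, column x = j :=
  ⟨finSumFinEquiv.symm ⟨j, hj⟩, by simp [column]⟩

theorem sum_edgeCost_eq {M : Finset (BipEdge d m)} (hcard : M.card = d) {f : Fin d → Fin d ⊕ Fin m}
    (hf : ∀ i, (f i, i) ∈ M) : ∑ e ∈ M, edgeCost w e = ∑ i, edgeCost w (f i, i) := by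
  classical
  have hinj : Function.Injective fun i => (f i, i) := fun i j h => congrArg Prod.snd h
  have : Finset.univ.image (fun i => (f i, i)) = M := by
    refine Finset.eq_of_subset_of_card_le (fun e he => ?_) ?_
    · obtain ⟨i, -, rfl⟩ := Finset.mem_image.1 he
      exact hf i
    · rw [Finset.card_image_of_injective _ hinj, hcard, Finset.card_univ, Fintype.card_fin]
  rw [← this, Finset.sum_image fun _ _ _ _ h => hinj h]

/-- Weak duality: the cost of the tight matching is the sum of all `u` and, as free columns have `v
= 0`, of all `v`. Any other maximum matching costs at least the sum of all `u` and of `v` over its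
own columns, which is no smaller because `v ≤ 0`. -/
theorem TightMatching.exists_isMCMM (hSC : StructurallyControllable A B) {E : ℕ → ℕ → ℕ}
    {c : ℕ → ℕ → ℝ} {p : ℕ → ℕ} {u v : ℕ → ℝ} (h : TightMatching (d + m) d d E c p u v)
    (hE : ∀ (i : Fin d) x, E (i + 1) (column x) = 1 ↔ Sum.elim (A i) (B i) x = true)
    (hc : ∀ (i : Fin d) x, c (i + 1) (column x) = edgeCost w (x, i)) :
    ∃ M, IsMCMM A B w M ∧ ∀ i x, (x, i) ∈ M ↔ p (column x) = i + 1 := by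
  classical
  have hex : ∀ i : Fin d, ∃ x : Fin d ⊕ Fin m, p (column x) = i + 1 := fun i => by
    obtain ⟨j, hj, hji⟩ := h.surj (i + 1) (by omega) i.2
    obtain ⟨x, rfl⟩ := exists_column hj
    exact ⟨x, hji⟩
  choose f hf using hex
  have hinj : Function.Injective f := fun i i' hii => Fin.ext (by
    have h1 := hf i
    rw [hii, hf i'] at h1
    omega)
  have htight : ∀ i : Fin d, E (i + 1) (column (f i)) = 1 ∧
      u (i + 1) + v (column (f i)) = c (i + 1) (column (f i)) := fun i => by
    have := h.tight _ (column_lt (f i)) (by rw [hf i]; omega)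
    rwa [hf i] at this
  obtain ⟨h1, h2⟩ := isMatching_image hinj fun i => (hE i (f i)).1 (htight i).1
  refine ⟨_, ⟨(isMaximumMatching_iff hSC).2 ⟨h1, h2⟩, fun M' hM' => ?_⟩, fun i x => ?_⟩
  · obtain ⟨h3, h4⟩ := (isMaximumMatching_iff hSC).1 hM'
    obtain ⟨g, hg, hgM⟩ := h3.exists_injective h4
    rw [sum_edgeCost_eq h2 fun i => Finset.mem_image_of_mem (fun i => (f i, i)) (Finset.mem_univ i),
      sum_edgeCost_eq h4 hgM]
    have himage : ∑ i, v (column (f i)) = ∑ x : Fin d ⊕ Fin m, v (column x) := by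
      rw [← Finset.sum_image (f := fun x => v (column x)) fun _ _ _ _ h => hinj h]
      refine Finset.sum_subset (Finset.subset_univ _) fun x _ hx => h.free _ (column_lt x) ?_
      by_contra hp
      have hr := h.range _ (column_lt x)
      refine hx (Finset.mem_image.2 ⟨⟨p (column x) - 1, by omega⟩, Finset.mem_univ _, ?_⟩)
      refine column_injective (h.inj _ (column_lt _) _ (column_lt x) ?_ ?_)
      · rw [hf]
        simp only
        omega
      · rw [hf]
        omega
    calc ∑ i, edgeCost w (f i, i) = ∑ i : Fin d, (u (i + 1) + v (column (f i))) :=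
          Finset.sum_congr rfl fun i _ => by rw [(htight i).2, hc]
      _ = ∑ i : Fin d, u (i + 1) + ∑ x : Fin d ⊕ Fin m, v (column x) := by
          rw [Finset.sum_add_distrib, himage]
      _ ≤ ∑ i : Fin d, u (i + 1) + ∑ i, v (column (g i)) := by
          rw [← Finset.sum_image (f := fun x => v (column x)) (s := Finset.univ) (g := g)
            fun _ _ _ _ h => hg h]
          refine add_le_add le_rfl ?_
          rw [← Finset.sum_sdiff (Finset.subset_univ (Finset.univ.image g))]
          have := Finset.sum_nonpos fun x (_ : x ∈ Finset.univ \ Finset.univ.image g) =>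
            h.nonpos _ (column_lt x)
          linarith
      _ = ∑ i : Fin d, (u (i + 1) + v (column (g i))) := Finset.sum_add_distrib.symm
      _ ≤ ∑ i, edgeCost w (g i, i) := Finset.sum_le_sum fun i _ => by
          rw [← hc]
          exact h.feasible _ _ (by omega) i.2 (column_lt _)
            ((hE i (g i)).2 (edge_of_mem h3 (hgM i)))
  · constructor
    · intro hx
      obtain ⟨i', -, heq⟩ := Finset.mem_image.1 hx
      obtain ⟨rfl, rfl⟩ := Prod.mk.inj heq
      exact hf _
    · intro hx
      refine Finset.mem_image.2 ⟨i, Finset.mem_univ i, Prod.ext (column_injective ?_) rfl⟩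
      exact h.inj _ (column_lt _) _ (column_lt x) ((hf i).trans hx.symm) (by rw [hf]; omega)

/-- The cells that hold the transitive closure of the state digraph. -/
def HoldsReachability (A : SparsityMatrix d d) (Q : ℕ → ℕ → ℕ) : Prop :=
  ∀ i j : Fin d, Q i j = 1 ↔ Reaches A j i

variable {Q : ℕ → ℕ → ℕ} {p : ℕ → ℕ}

theorem HoldsReachability.isSourceSCC (hQ : HoldsReachability A Q) {v : Fin d}
    (hv : IsRep d Q v) : IsSourceSCC A {u | Reaches A u v} :=
  isSourceSCC_of_forall fun u hu => (hQ u v).1 (hv u u.2 ((hQ v u).2 hu)).1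

theorem HoldsReachability.exists_isRep (hQ : HoldsReachability A Q) {S : Set (Fin d)}
    (hS : IsSourceSCC A S) : ∃ v ∈ S, IsRep d Q v := by
  obtain ⟨v, hv, hmin⟩ := Set.exists_min_image S id (Set.toFinite _) hS.nonempty
  refine ⟨v, hv, fun u hu h => ?_⟩
  have h1 : (⟨u, hu⟩ : Fin d) ∈ S := mem_of_reaches_mem hS ((hQ v ⟨u, hu⟩).1 h) hv
  exact ⟨(hQ ⟨u, hu⟩ v).2 (reaches_of_mem_isSCC hS.1 hv h1), hmin _ h1⟩

theorem HoldsReachability.isRep_unique (hQ : HoldsReachability A Q) {S : Set (Fin d)}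
    (hS : IsSourceSCC A S) {v v' : Fin d} (hv : v ∈ S) (hv' : v' ∈ S) (h : IsRep d Q v)
    (h' : IsRep d Q v') : v = v' :=
  le_antisymm (h v' v'.2 ((hQ v v').2 (reaches_of_mem_isSCC hS.1 hv' hv))).2
    (h' v v.2 ((hQ v' v).2 (reaches_of_mem_isSCC hS.1 hv hv'))).2

/-- The program tests whether a matched state reaches `v`; as no edge enters the source component of
`v`, those are exactly its members. -/
theorem HoldsReachability.unserved_iff (hQ : HoldsReachability A Q) {S : Set (Fin d)}
    (hS : IsSourceSCC A S) {v : Fin d} (hv : v ∈ S) (hp : ∀ k < m, p (d + k) ≤ d) :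
    Unserved d m Q p v ↔ ¬ ∃ l ∈ S, ∃ k : Fin m, p (d + k) = l + 1 := by
  constructor
  · rintro h ⟨l, hl, k, hk⟩
    refine h k k.2 (by omega) ?_
    rw [hk]
    exact (hQ v l).2 (reaches_of_mem_isSCC hS.1 hl hv)
  · intro h k hk hpk hQk
    have := hp k hk
    refine h ⟨⟨p (d + k) - 1, by omega⟩, mem_of_reaches_mem hS ((hQ v _).1 hQk) hv, ⟨k, hk⟩, ?_⟩
    simp only
    omega

theorem HoldsReachability.isBest (hQ : HoldsReachability A Q) {Bc : ℕ → ℕ → ℕ} {W : ℕ → ℕ → ℝ}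
    (hB : ∀ (i : Fin d) (k : Fin m), Bc i k = 1 ↔ B i k = true)
    (hW : ∀ (i : Fin d) (k : Fin m), W i k = w i k) {v : Fin d} {x : ℕ × ℕ}
    (h : IsBest d m Q Bc W v x) : ∃ y : Fin d × Fin m, x = (↑y.1, ↑y.2) ∧ Reaches A y.1 v ∧
      ∀ i, Reaches A i v → ∀ k, connectionCost B w y.1 y.2 ≤ connectionCost B w i k := by
  obtain ⟨⟨h1, h2, h3, h4⟩, h5⟩ := h
  refine ⟨(⟨x.1, h1⟩, ⟨x.2, h2⟩), rfl, (hQ v ⟨x.1, h1⟩).1 h3, fun i hi k => ?_⟩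
  unfold connectionCost
  rw [if_pos ((hB ⟨x.1, h1⟩ ⟨x.2, h2⟩).1 h4)]
  split_ifs with hik
  · rw [← hW, ← hW]
    exact WithTop.coe_le_coe.2 (h5 i i.2 k k.2 ((hQ v i).2 hi) ((hB i k).2 hik))
  · exact le_top

/-- The program chooses connections only into unserved components, whereas an accessibility output
needs one for every source component. The missing choices are taken from an arbitrary output `f₀`;
they do not matter, because they are deleted again. -/
theorem HoldsReachability.isCombinedOutput (hQ : HoldsReachability A Q)
    (hSC : StructurallyControllable A B) {M : Finset (BipEdge d m)} (hM : IsMCMM A B w M)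
    (hMp : ∀ i k, (Sum.inr k, i) ∈ M ↔ p (d + k) = i + 1) (hp : ∀ k < m, p (d + k) ≤ d)
    {b : ℕ → ℕ × ℕ} (hb : ∀ v : Fin d, Selected d m Q p v → ∃ y : Fin d × Fin m,
      b v = (↑y.1, ↑y.2) ∧ Reaches A y.1 v ∧
        ∀ i, Reaches A i v → ∀ k, connectionCost B w y.1 y.2 ≤ connectionCost B w i k)
    {Bs : SparsityMatrix d m} (hBs : ∀ i k, Bs i k = true ↔
      (∃ v : Fin d, Selected d m Q p v ∧ b v = (↑i, ↑k)) ∨ p (d + k) = i + 1) :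
    IsCombinedOutput A B w Bs := by
  classical
  obtain ⟨-, f₀, hf₀, -⟩ := exists_isAccessibilityOutput hSC w
  have hex : ∀ S : {S : Set (Fin d) // IsSourceSCC A S}, ∃ y : Fin d × Fin m,
      (y.1 ∈ S.1 ∧ ∀ i ∈ S.1, ∀ k, connectionCost B w y.1 y.2 ≤ connectionCost B w i k) ∧
      ∀ v ∈ S.1, Selected d m Q p v → b v = (↑y.1, ↑y.2) := by
    rintro ⟨S, hS⟩
    by_cases h : ∃ v ∈ S, Selected d m Q p v
    · obtain ⟨v, hv, hsel⟩ := h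
      obtain ⟨y, h1, h2, h3⟩ := hb v hsel
      refine ⟨y, ⟨mem_of_reaches_mem hS h2 hv, fun i hi =>
        h3 i (reaches_of_mem_isSCC hS.1 hi hv)⟩, fun v' hv' hsel' => ?_⟩
      rw [hQ.isRep_unique hS hv' hv hsel'.1 hsel.1, h1]
    · exact ⟨f₀ ⟨S, hS⟩, hf₀ ⟨S, hS⟩, fun v hv hsel => absurd ⟨v, hv, hsel⟩ h⟩
  choose f hf hfb using hex
  refine ⟨fun i k => decide (∃ S, f S = (i, k)), fun i k => decide (p (d + k) = i + 1),
    ⟨f, hf, fun i k => decide_eq_true_iff⟩, ⟨M, hM, fun i k => by rw [decide_eq_true_iff, hMp]⟩,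
    fun i k => ?_⟩
  have hserved : ∀ {S : Set (Fin d)} {v : Fin d}, IsSourceSCC A S → v ∈ S → i ∈ S →
      (Unserved d m Q p v ↔ ¬ AlreadyServed A
        (fun (i : Fin d) (k : Fin m) => decide (p (d + k) = i + 1)) i) := by
    intro S v hS hv hi
    rw [hQ.unserved_iff hS hv hp, not_iff_not]
    simp only [AlreadyServed, decide_eq_true_iff]
    constructor
    · exact fun h => ⟨S, hS, hi, h⟩
    · rintro ⟨S', hS', hi', h⟩
      rwa [hS'.eq_setOf hi', ← hS.eq_setOf hi] at h
  simp only [hBs, decide_eq_true_iff]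
  refine or_congr_left ⟨?_, ?_⟩
  · rintro ⟨v, hsel, hbv⟩
    have hS := hQ.isSourceSCC hsel.1
    have hvS : v ∈ {u | Reaches A u v} := Relation.ReflTransGen.refl
    have h1 := hfb ⟨_, hS⟩ v hvS hsel
    have h2 : f ⟨_, hS⟩ = (i, k) := by
      rw [hbv, Prod.mk.injEq] at h1
      exact Prod.ext (Fin.ext h1.1.symm) (Fin.ext h1.2.symm)
    refine ⟨⟨_, h2⟩, (hserved hS hvS ?_).1 hsel.2⟩
    have := (hf ⟨_, hS⟩).1
    rwa [h2] at this
  · rintro ⟨⟨S, hSf⟩, hns⟩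
    obtain ⟨v, hv, hrep⟩ := hQ.exists_isRep S.2
    have hi := (hf S).1
    rw [hSf] at hi
    have hsel : Selected d m Q p v := ⟨hrep, (hserved S.2 hv hi).2 hns⟩
    exact ⟨v, hsel, by rw [hfb S v hv hsel, hSf]⟩

end Correctness

end StructuralControl

namespace StructuralControl

/-! ### The whole program and its running time. -/

section CombinedProgram

variable {d m : ℕ} {A : SparsityMatrix d d} {B : SparsityMatrix d m} {w : Fin d → Fin m → ℝ}

theorem matrixCells_eq_one_iff {n k : ℕ} (N : SparsityMatrix n k) (i j : ℕ) :
    matrixCells N i j = 1 ↔ ∃ (hi : i < n) (hj : j < k), N ⟨i, hi⟩ ⟨j, hj⟩ = true := by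
  unfold matrixCells
  split_ifs with h1 h2
  · simp [h1, h2]
  · simp [h1, h2]
  · simp only [false_iff]
    rintro ⟨hi, hj, -⟩
    exact h1 ⟨hi, hj⟩

theorem matrixCells_fin {n k : ℕ} (N : SparsityMatrix n k) (i : Fin n) (j : Fin k) :
    matrixCells N i j = 1 ↔ N i j = true := by
  simp [matrixCells_eq_one_iff]

/-- Row and column are transposed against the edge direction, as in `A`: the entry at `i`, `j`
belongs to paths from `j` to `i`. Minimality is applied to reachability between indices within
range. -/
theorem holdsReachability_of_closure {Q : ℕ → ℕ → ℕ} (hrefl : ∀ i < d, Q i i = 1)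
    (hedge : ∀ i j, matrixCells A i j = 1 → Q i j = 1)
    (htrans : ∀ k < d, ∀ i < d, ∀ j < d, Q i k = 1 → Q k j = 1 → Q i j = 1)
    (hmin : ∀ R : ℕ → ℕ → Prop, (∀ i j k, R i k → R k j → R i j) →
      (∀ i < d, R i i) → (∀ i j, matrixCells A i j = 1 → R i j) → ∀ i j, Q i j = 1 → R i j) :
    HoldsReachability A Q := by
  intro i j
  constructor
  · intro h
    have := hmin (fun i j => ∃ (hi : i < d) (hj : j < d), Reaches A ⟨j, hj⟩ ⟨i, hi⟩) ?_ ?_ ?_ i j h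
    · exact this.2.2
    · rintro i j k ⟨hi, _, h1⟩ ⟨_, hj, h2⟩
      exact ⟨hi, hj, Relation.ReflTransGen.trans h2 h1⟩
    · exact fun i hi => ⟨hi, hi, .refl⟩
    · intro i j hij
      obtain ⟨hi, hj, hA⟩ := (matrixCells_eq_one_iff A i j).1 hij
      exact ⟨hi, hj, .single hA⟩
  · intro h
    induction h with
    | refl => exact hrefl j j.2
    | @tail k i _ hadj ih =>
      exact htrans k k.2 i i.2 j j.2 (hedge i k ((matrixCells_fin A i k).2 hadj)) ih

theorem hasRowMatching (hSC : StructurallyControllable A B) {E : ℕ → ℕ → ℕ}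
    (hE : ∀ (i : Fin d) x, E (i + 1) (column x) = 1 ↔ Sum.elim (A i) (B i) x = true) :
    HasRowMatching (d + m) d E := by
  obtain ⟨-, f, hf, hAB⟩ := structurallyControllable_iff.1 hSC
  let g : ℕ → ℕ := fun i => if h : 1 ≤ i ∧ i ≤ d then column (f ⟨i - 1, by omega⟩) else 0
  have heq : ∀ i, (h1 : 1 ≤ i) → (h2 : i ≤ d) → g i = column (f ⟨i - 1, by omega⟩) :=
    fun i h1 h2 => dif_pos ⟨h1, h2⟩
  refine ⟨g, fun i h1 h2 => ?_, fun i h1 h2 i' h1' h2' h => ?_⟩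
  · rw [heq i h1 h2]
    have := (hE ⟨i - 1, by omega⟩ _).2 (hAB ⟨i - 1, by omega⟩)
    rw [show ((⟨i - 1, by omega⟩ : Fin d) : ℕ) + 1 = i from Nat.sub_add_cancel h1] at this
    exact ⟨column_lt _, this⟩
  · rw [heq i h1 h2, heq i' h1' h2'] at h
    have := congrArg Fin.val (hf (column_injective h))
    simp only at this
    omega

/-- The empty matching with zero potentials is feasible because costs are nonnegative. -/
theorem tightMatching_zero {E : ℕ → ℕ → ℕ} {c : ℕ → ℕ → ℝ} {p : ℕ → ℕ} {u v : ℕ → ℝ}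
    (hw : ∀ i j, B i j = true → 0 ≤ w i j)
    (hE : ∀ (i : Fin d) x, E (i + 1) (column x) = 1 ↔ Sum.elim (A i) (B i) x = true)
    (hc : ∀ (i : Fin d) x, c (i + 1) (column x) = edgeCost w (x, i))
    (hp : ∀ j, p j = 0) (hu : ∀ i, u i = 0) (hv : ∀ j, v j = 0) :
    TightMatching (d + m) d 0 E c p u v where
  feasible i j h1 h2 hj hij := by
    obtain ⟨x, rfl⟩ := exists_column hj
    obtain ⟨i, rfl⟩ := Nat.exists_eq_add_of_le' h1
    have h3 := hc ⟨i, h2⟩ x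
    have h4 := (hE ⟨i, h2⟩ x).1 hij
    simp only at h3
    rw [h3, hu, hv, add_zero]
    cases x with
    | inl j => exact le_rfl
    | inr k => exact hw _ _ h4
  nonpos j _ := (hv j).le
  free j _ _ := hv j
  inj j _ _ _ _ h := absurd (hp j) h
  range j _ := (hp j).le
  tight j _ h := absurd (hp j) h
  surj i h1 h2 := by omega

def combinedProgram : Program :=
  .seq (setVar 17 (.add (var 0) inputCount)) (.seq copyProgram (.seq reflProgram
    (.seq closureProgram (.seq hungarian (.seq sourceProgram writeProgram)))))

theorem run_combinedProgram (hSC : StructurallyControllable A B)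
    (hw : ∀ i j, B i j = true → 0 ≤ w i j) :
    Run combinedProgram (inputMemory A B w)
      (10 + ((d + 1) * ((d + m + 2) * 130) + ((d + 1) * 60 +
        ((d + 1) * ((d + 1) * ((d + 1) * 160)) + ((d + 1) * ((d + m + 2) * (d + m + 2) * 2100) +
          ((d + 1) * ((d + 1) * ((m + 1) * 530)) + (m + 1) * 100))))))
      fun s => ∃ Bs, HoldsOutput s Bs ∧ IsCombinedOutput A B w Bs := by
  classical
  set s₀ := inputMemory A B w with hs₀
  refine (Run.seq_loopFree (by simp [Program.LoopFree, setVar]) (Run.seq ?_)).mono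
    (Nat.add_le_add_right (m := 10) (by decide) _) fun _ h => h
  set s₁ := (setVar 17 (.add (var 0) inputCount)).exec s₀ with hs₁
  have A1 : Memory.AgreeOff [17] [] s₀ s₁ := (Memory.AgreeOff.refl _ _ _).setNat (by decide) _ _ _
  have hn1 : s₁.nat 17 0 0 = d + m := by simp [hs₁, hs₀, inputMemory]
  have hd0 : s₀.nat 0 0 0 = d := by simp [hs₀, inputMemory]
  have hm0 : s₀.nat 0 0 1 = m := by simp [hs₀, inputMemory]
  refine (run_copyProgram (d := d) (m := m) (by rw [A1.1 0 (by decide), hd0])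
    (by rw [A1.1 0 (by decide), hm0])).mono le_rfl ?_
  rintro s₂ ⟨A2, h2⟩
  rw [A1.1 1 (by decide), A1.1 2 (by decide), A1.2 0 (by decide), A1.2 1 (by decide)] at h2
  have B2 : Memory.AgreeOff [4, 14, 17, 18] [1] s₀ s₂ :=
    (A1.mono (by decide) (by decide)).trans (A2.mono (by decide) (by decide))
  have hE : ∀ (i : Fin d) x, s₂.nat 4 (i + 1) (column x) = 1 ↔
      Sum.elim (A i) (B i) x = true := by
    rintro i (j | k)
    · rw [column_inl, ((h2 i i.2).1 j j.2).1]
      exact matrixCells_fin A i j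
    · rw [column_inr, ((h2 i i.2).2 k k.2).1]
      exact matrixCells_fin B i k
  have hc : ∀ (i : Fin d) x, s₂.real 1 (i + 1) (column x) = edgeCost w (x, i) := by
    rintro i (j | k)
    · rw [column_inl, ((h2 i i.2).1 j j.2).2]
      simp [hs₀, inputMemory, edgeCost]
    · rw [column_inr, ((h2 i i.2).2 k k.2).2]
      simp [hs₀, inputMemory, edgeCost]
  refine Run.seq ((run_reflProgram (d := d) (by rw [B2.1 0 (by decide), hd0])).mono le_rfl ?_)
  rintro s₃ ⟨A3, h3⟩
  rw [B2.1 1 (by decide)] at h3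
  have B3 : Memory.AgreeOff [1, 4, 14, 17, 18] [1] s₀ s₃ :=
    (B2.mono (by decide) (by decide)).trans (A3.mono (by decide) (by decide))
  refine Run.seq ((run_closureProgram (d := d) (by rw [B3.1 0 (by decide), hd0])).mono le_rfl ?_)
  rintro s₄ ⟨A4, h4, h4', h4''⟩
  have B4 : Memory.AgreeOff [1, 4, 14, 17, 18, 19] [1] s₀ s₄ :=
    (B3.mono (by decide) (by decide)).trans (A4.mono (by decide) (by decide))
  have hQ : HoldsReachability A (s₄.nat 1) := by
    refine holdsReachability_of_closure (fun i hi => h4 i i ?_) (fun i j hij => h4 i j ?_) h4'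
      fun R hR hrefl hedge => h4'' R hR fun i j hij => ?_
    · rw [h3, if_pos ⟨rfl, hi⟩]
    · rw [h3]
      split_ifs
      · rfl
      · exact hij
    · rw [h3] at hij
      split_ifs at hij with h
      · obtain ⟨rfl, h⟩ := h
        exact hrefl i h
      · exact hedge i j hij
  have e4 : s₄.nat 4 = s₂.nat 4 := by rw [A4.1 4 (by decide), A3.1 4 (by decide)]
  have e4' : s₄.real 1 = s₂.real 1 := by rw [A4.2 1 (by decide), A3.2 1 (by decide)]
  refine Run.seq ((run_hungarian (n := d + m) (d := d)
    (by rw [A4.1 17 (by decide), A3.1 17 (by decide), A2.1 17 (by decide), hn1])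
    (by rw [B4.1 0 (by decide), hd0]) ?_ ?_).mono le_rfl ?_)
  · rw [MatchingAt, e4, e4', B4.1 5 (by decide), B4.2 2 (by decide), B4.2 3 (by decide)]
    exact tightMatching_zero hw hE hc (by simp [hs₀, inputMemory]) (by simp [hs₀, inputMemory])
      (by simp [hs₀, inputMemory])
  · rw [e4]
    exact hasRowMatching hSC hE
  rintro s₅ ⟨A5, h5⟩
  have B5 : Memory.AgreeOff [1, 4, 5, 6, 7, 8, 10, 11, 12, 13, 14, 15, 16, 17, 18, 19]
      [1, 2, 3, 4, 5] s₀ s₅ := (B4.mono (by decide) (by decide)).trans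
        (A5.mono (by decide) (by decide))
  rw [MatchingAt, A5.1 4 (by decide), A5.2 1 (by decide), e4, e4'] at h5
  obtain ⟨M, hM, hMp⟩ := h5.exists_isMCMM hSC hE hc
  have hQ5 : HoldsReachability A (s₅.nat 1) := by
    rw [A5.1 1 (by decide)]
    exact hQ
  have hB5 : s₅.nat 2 = matrixCells B := by
    rw [B5.1 2 (by decide)]
    rfl
  have hW5 : ∀ (i : Fin d) (k : Fin m), s₅.real 0 i k = w i k := fun i k => by
    rw [B5.2 0 (by decide)]
    simp [hs₀, inputMemory]
  refine Run.seq ((run_sourceProgram (d := d) (m := m) (by rw [B5.1 0 (by decide), hd0])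
    (by rw [B5.1 0 (by decide), hm0]) ?_).mono le_rfl ?_)
  · intro v hv hrep
    obtain ⟨i, hi, k, hk⟩ :=
      (structurallyControllable_iff.1 hSC).1 _ (hQ5.isSourceSCC (v := ⟨v, hv⟩) hrep)
    exact ⟨i, i.2, k, k.2, (hQ5 ⟨v, hv⟩ i).2 hi, by rw [hB5]; exact (matrixCells_fin B i k).2 hk⟩
  rintro s₆ ⟨A6, b, hb, h6⟩
  rw [hB5] at hb
  have B6 : s₆.nat 0 = s₀.nat 0 := by rw [A6.1 0 (by decide), B5.1 0 (by decide)]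
  have e3 : ∀ i k, s₅.nat 3 i k = 0 := by
    rw [B5.1 3 (by decide)]
    simp [hs₀, inputMemory]
  refine (run_writeProgram (d := d) (m := m) (by rw [B6, hd0]) (by rw [B6, hm0])).mono le_rfl ?_
  intro s₇ h7
  rw [A6.1 5 (by decide)] at h7
  have hb' : ∀ v : Fin d, Selected d m (s₅.nat 1) (fun j => s₅.nat 5 j 0) v → _ := fun v hv =>
    hQ5.isBest (fun i k => matrixCells_fin B i k) hW5 (hb v v.2 hv)
  have hrange : ∀ k < m, s₅.nat 5 (d + k) 0 ≤ d := fun k hk => h5.range (d + k) (by omega)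
  have hcell : ∀ i k, s₇.nat 3 i k =
      if (∃ v : Fin d, Selected d m (s₅.nat 1) (fun j => s₅.nat 5 j 0) v ∧ b v = (i, k)) ∨
        (k < m ∧ s₅.nat 5 (d + k) 0 = i + 1) then 1 else 0 := by
    intro i k
    rw [h7, h6, e3]
    simp only [Fin.exists_iff, exists_prop]
    split_ifs <;> grind
  refine ⟨fun i k => decide ((∃ v : Fin d, Selected d m (s₅.nat 1) (fun j => s₅.nat 5 j 0) v ∧
    b v = (↑i, ↑k)) ∨ s₅.nat 5 (d + k) 0 = i + 1), fun i k => ?_, ?_⟩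
  · rw [hcell]
    unfold matrixCells
    by_cases hik : i < d ∧ k < m
    · simp [hik]
    · rw [dif_neg hik, if_neg]
      rintro (⟨v, hv, hbv⟩ | ⟨hk, hp⟩)
      · obtain ⟨y, hy, -⟩ := hb' v hv
        rw [hbv, Prod.mk.injEq] at hy
        exact hik ⟨hy.1 ▸ y.1.2, hy.2 ▸ y.2.2⟩
      · have := hrange k hk
        exact hik ⟨by omega, hk⟩
  · exact hQ5.isCombinedOutput hSC hM (fun i k => by rw [hMp, column_inr]) hrange hb'
      fun i k => decide_eq_true_iff

theorem combinedProgram_time_le (hd : 0 < d) :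
    10 + ((d + 1) * ((d + m + 2) * 130) + ((d + 1) * 60 + ((d + 1) * ((d + 1) * ((d + 1) * 160)) +
      ((d + 1) * ((d + m + 2) * (d + m + 2) * 2100) + ((d + 1) * ((d + 1) * ((m + 1) * 530)) +
        (m + 1) * 100))))) ≤ 100000 * (d + m) ^ 3 := by
  obtain ⟨N, hN⟩ : ∃ N, N = d + m := ⟨_, rfl⟩
  have h1 : 1 ≤ N := by omega
  have hd1 : d + 1 ≤ 2 * N := by omega
  have hm1 : m + 1 ≤ 2 * N := by omega
  have hn1 : N + 2 ≤ 3 * N := by omega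
  have h2 : N ≤ N ^ 3 := Nat.le_self_pow (by decide) N
  have h3 : N ^ 2 ≤ N ^ 3 := Nat.pow_le_pow_right h1 (by decide)
  rw [← hN]
  -- As `N ≥ 1`, every additive constant is absorbed into a multiple of `N`; the cubic terms come
  -- from closure, matching and source scan.
  calc _ ≤ 10 * N + (2 * N * (3 * N * 130) + (2 * N * 60 + (2 * N * (2 * N * (2 * N * 160)) +
        (2 * N * (3 * N * (3 * N) * 2100) + (2 * N * (2 * N * (2 * N * 530)) +
          2 * N * 100))))) := by gcongr; omega
    _ = 330 * N + 780 * N ^ 2 + 43320 * N ^ 3 := by ring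
    _ ≤ _ := by omega

end CombinedProgram

end StructuralControl

theorem mainTheorem3 :
    (∀ (d m : ℕ) (A : SparsityMatrix d d) (B : SparsityMatrix d m) (w : Fin d → Fin m → ℝ),
      StructurallyControllable A B → (∀ i j, B i j = true → 0 ≤ w i j) →
      (∃ Bs, IsCombinedOutput A B w Bs) ∧
      ∀ Bs, IsCombinedOutput A B w Bs →
        Bs ∈ admissible A B ∧
        ∃ Bhat, SolvesMinCost A B w Bhat ∧ weightedNorm w Bs ≤ 2 * weightedNorm w Bhat) ∧
    (∃ (p : Program) (C : ℕ),
      ∀ (d m : ℕ) (A : SparsityMatrix d d) (B : SparsityMatrix d m) (w : Fin d → Fin m → ℝ),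
        0 < d → StructurallyControllable A B → (∀ i j, B i j = true → 0 ≤ w i j) →
        ∃ (t : ℕ) (s : Memory) (Bs : SparsityMatrix d m),
          Runs p (inputMemory A B w) t s ∧ t ≤ C * (d + m) ^ 3 ∧
          HoldsOutput s Bs ∧ IsCombinedOutput A B w Bs) := by
  refine ⟨fun d m A B w hSC hw => ⟨exists_isCombinedOutput hSC w, fun Bs hBs =>
    ⟨hBs.mem_admissible hSC, ?_⟩⟩, ?_⟩
  · obtain ⟨Bhat, h⟩ := exists_solvesMinCost hSC w
    exact ⟨Bhat, h, hBs.weightedNorm_le hSC hw h.1⟩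
  · refine ⟨combinedProgram, 100000, fun d m A B w hd hSC hw => ?_⟩
    obtain ⟨t, s, hrun, ht, Bs, hs, hBs⟩ := run_combinedProgram hSC hw
    exact ⟨t, s, Bs, hrun, ht.trans (combinedProgram_time_le hd), hs, hBs⟩
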